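/- Work in $\mathbb{R}^2$ with points $(x,t)$, and let $W(x,t)=(4\pi t)^{-1/2}e^{-x^2/(4t)}\chi_{\{t>0\}}$ be the heat kernel. For a function $\varphi$ put $$(-\Delta_x)^{1/2}\varphi(x,t)=\frac1{2\pi}\int_{\mathbb{R}}\frac{2\varphi(x,t)-\varphi(x+y,t)-\varphi(x-y,t)}{y^2}\,dy,\qquad \partial_t^{1/2}\varphi(x,t)=\int_{\mathbb{R}}\frac{\varphi(x,\tau)-\varphi(x,t)}{|\tau-t|^{3/2}}\,d\tau .$$ For a compactly supported real distribution $T$ these operators, and $\partial_x$, are applied to $W\ast T$ in the sense of distributions. Let $\|\cdot\|_{\ast,p}$ be the parabolic BMO norm $$\|g\|_{\ast,p}=\sup_Q \frac1{|Q|}\int_Q |g-g_Q|,\qquad g_Q=\frac1{|Q|}\int_Q g,$$ the supremum being over all parabolic cubes $Q=I\times J$, where $I,J$ are intervals with $|I|=\ell$, $|J|=\ell^2$, $\ell>0$. For a compact set $E\subset\mathbb{R}^2$ define the Lipschitz caloric capacity $$\Gamma_\Theta(E)=\sup\big\{|\langle T,1\rangle| : \operatorname{supp}T\subset E,\ \|\partial_x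 (W\ast T)\|_{L^\infty(\mathbb{R}^2)}\le 1,\ \|\partial_t^{1/2}(W\ast T)\|_{\ast,p}\le 1\big\}$$ and the $\Delta^{1/2}$-caloric capacity $$\gamma^{1/2}_\Theta(E)=\sup\big\{|\langle T,1\rangle| : \operatorname{supp}T\subset E,\ \|(-\Delta_x)^{1/2} (W\ast T)\|_{L^\infty(\mathbb{R}^2)}\le 1,\ \|\partial_t^{1/2}(W\ast T)\|_{\ast,p}\le 1\big\},$$ the suprema being over real distributions $T$ on $\mathbb{R}^2$; a norm bound on a distribution means that it is given by a locally integrable function that satisfies the bound. Theorem. The vertical segment $E_0=\{0\}\times[0,1]$ satisfies $\gamma^{1/2}_\Theta(E_0)=0$ and $\Gamma_\Theta(E_0)>0$. Consequently $\Gamma_\Theta$ and $\gamma^{1/2}_\Theta$ are not comparable in $\mathbb{R}^2$: there is no finite constant $C$ such that $\Gamma_\Theta(E)\le C\,\gamma^{1/2}_\Theta(E)$ and $\gamma^{1/2}_\Theta(E)\le C\,\Gamma_\Theta(E)$ for all compact sets $E\subset\mathbb{R}^2$. -/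

import Mathlib

open MeasureTheory Set TopologicalSpace Topology Distribution
open scoped ENNReal NNReal Distributions ContDiff Manifold

/-! Points of the plane are written `p = (x, t)`, with `p.1 = x` the spatial variable and
`p.2 = t` the time variable. -/

namespace CaloricCapacity

/-- The heat kernel `W` of `ℝ²`, fundamental solution of `∂ₜ - ∂ₓ²`. -/
noncomputable def heatKernel (p : ℝ × ℝ) : ℝ :=
  if 0 < p.2 then (Real.sqrt (4 * Real.pi * p.2))⁻¹ * Real.exp (-p.1 ^ 2 / (4 * p.2)) else 0

/-- The transpose of convolution with the heat kernel:
`(Wᵗ ∗ ψ)(q) = ∫ W(p - q) ψ(p) dp`. -/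
noncomputable def heatTranspose (ψ : ℝ × ℝ → ℝ) (q : ℝ × ℝ) : ℝ :=
  ∫ p : ℝ × ℝ, heatKernel (p - q) * ψ p

/-- The spatial derivative `∂ₓφ`, which is the whole spatial gradient in the plane. -/
noncomputable def spaceDeriv (φ : ℝ × ℝ → ℝ) (p : ℝ × ℝ) : ℝ :=
  deriv (fun x : ℝ => φ (x, p.2)) p.1

/-- The spatial half Laplacian `(-Δₓ)^{1/2}φ`, with Fourier symbol `|ξ|`
(for the Fourier transform `∫ f(x) exp(-i x ξ) dx`), through its absolutely convergent
second-difference formula, equal to `π⁻¹ p.v. ∫ (φ(x,t) - φ(y,t)) / |x - y|² dy`. -/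
noncomputable def halfLaplacian (φ : ℝ × ℝ → ℝ) (p : ℝ × ℝ) : ℝ :=
  (2 * Real.pi)⁻¹ *
    ∫ y : ℝ, (2 * φ (p.1, p.2) - φ (p.1 + y, p.2) - φ (p.1 - y, p.2)) / y ^ 2

/-- The fractional time derivative `∂ₜ^{1/2}φ(x,t) = ∫ (φ(x,τ) - φ(x,t)) / |τ - t|^{3/2} dτ`. -/
noncomputable def halfTimeDeriv (φ : ℝ × ℝ → ℝ) (p : ℝ × ℝ) : ℝ :=
  ∫ τ : ℝ, (φ (p.1, τ) - φ (p.1, p.2)) / |τ - p.2| ^ (3 / 2 : ℝ)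

/-- A distribution vanishes on the test functions that are zero near its support. -/
theorem apply_eq_zero_of_eventuallyEq (T : 𝓓'((⊤ : Opens (ℝ × ℝ)), ℝ))
    (φ : 𝓓((⊤ : Opens (ℝ × ℝ)), ℝ))
    (h : (φ : ℝ × ℝ → ℝ) =ᶠ[𝓝ˢ (dsupport T)] fun _ => 0) : T φ = 0 := by
  classical
  have hdisj : ∀ x ∈ tsupport φ, x ∉ dsupport T := by
    intro x hx hxT
    have h0 : (φ : ℝ × ℝ → ℝ) =ᶠ[𝓝 x] fun _ => 0 := h.filter_mono (nhds_le_nhdsSet hxT)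
    exact (notMem_tsupport_iff_eventuallyEq.2 h0) hx
  have hcov : ∀ x ∈ tsupport φ, ∃ s : Set (ℝ × ℝ), IsVanishingOn T s ∧ IsOpen s ∧ x ∈ s :=
    fun x hx => (notMem_dsupport_iff x).1 (hdisj x hx)
  choose! s hs1 hs2 hs3 using hcov
  obtain ⟨b, hb, hbc⟩ := φ.hasCompactSupport.isCompact.elim_nhds_subcover s
    (fun x hx => (hs2 x hx).mem_nhds (hs3 x hx))
  obtain ⟨ρ, hρ⟩ := SmoothPartitionOfUnity.exists_isSubordinate (ι := b) 𝓘(ℝ, ℝ × ℝ)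
    (isClosed_tsupport φ) (fun i => s i.1) (fun i => hs2 _ (hb _ i.2)) (by
      intro x hx
      obtain ⟨i, hi, hxi⟩ := mem_iUnion₂.1 (hbc hx)
      exact mem_iUnion.2 ⟨⟨i, hi⟩, hxi⟩)
  let ψ : b → 𝓓((⊤ : Opens (ℝ × ℝ)), ℝ) := fun i =>
    { toFun := fun x => ρ i x * φ x
      contDiff' := ((ρ i).contMDiff.contDiff).mul φ.contDiff
      hasCompactSupport' := φ.hasCompactSupport.mul_left
      tsupport_subset' := fun _ _ => trivial }
  have hψ : φ = ∑ i, ψ i := by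
    apply TestFunction.ext
    intro x
    have hsum : (∑ i, ψ i) x = ∑ i, ρ i x * φ x := by
      have : ∀ S : Finset b, (∑ i ∈ S, ψ i) x = ∑ i ∈ S, ρ i x * φ x := by
        intro S
        induction S using Finset.induction_on with
        | empty => simp
        | insert a S ha ih => rw [Finset.sum_insert ha, Finset.sum_insert ha, ← ih]; rfl
      exact this _
    rw [hsum, ← Finset.sum_mul]
    by_cases hx : x ∈ tsupport φ
    · have h1 := ρ.sum_eq_one hx
      rw [finsum_eq_sum_of_fintype] at h1
      rw [h1, one_mul]
    · rw [image_eq_zero_of_notMem_tsupport hx, mul_zero]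
  rw [hψ, map_sum]
  refine Finset.sum_eq_zero fun i _ => hs1 _ (hb _ i.2) (ψ i) ?_
  exact (tsupport_mul_subset_left).trans (hρ i)

open Classical in
/-- The extension of a compactly supported distribution `T` to functions `u` that are smooth near
the support of `T`: `⟨T, u⟩` is `T φ` for any test function `φ` equal to `u` near the support. -/
noncomputable def pairing (T : 𝓓'((⊤ : Opens (ℝ × ℝ)), ℝ)) (u : ℝ × ℝ → ℝ) : ℝ :=
  if h : ∃ φ : 𝓓((⊤ : Opens (ℝ × ℝ)), ℝ), (φ : ℝ × ℝ → ℝ) =ᶠ[𝓝ˢ (dsupport T)] u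
  then T h.choose else 0

/-- The value `⟨T, u⟩` does not depend on the test function that is used to compute it. -/
theorem pairing_eq (T : 𝓓'((⊤ : Opens (ℝ × ℝ)), ℝ)) (u : ℝ × ℝ → ℝ)
    (φ : 𝓓((⊤ : Opens (ℝ × ℝ)), ℝ)) (h : (φ : ℝ × ℝ → ℝ) =ᶠ[𝓝ˢ (dsupport T)] u) :
    pairing T u = T φ := by
  have hex : ∃ φ : 𝓓((⊤ : Opens (ℝ × ℝ)), ℝ), (φ : ℝ × ℝ → ℝ) =ᶠ[𝓝ˢ (dsupport T)] u := ⟨φ, h⟩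
  rw [pairing, dif_pos hex, ← sub_eq_zero, ← map_sub]
  refine apply_eq_zero_of_eventuallyEq T _ ?_
  filter_upwards [hex.choose_spec, h] with x h1 h2
  change hex.choose x - φ x = 0
  rw [h1, h2, sub_self]

/-- The distribution `∂ₓ(W ∗ T)`. -/
noncomputable def spaceDerivPotential (T : 𝓓'((⊤ : Opens (ℝ × ℝ)), ℝ))
    (φ : 𝓓((⊤ : Opens (ℝ × ℝ)), ℝ)) : ℝ :=
  pairing T (heatTranspose fun p => -spaceDeriv φ p)

/-- The distribution `(-Δₓ)^{1/2}(W ∗ T)`. The operator `(-Δₓ)^{1/2}` is its own transpose. -/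
noncomputable def halfLaplacianPotential (T : 𝓓'((⊤ : Opens (ℝ × ℝ)), ℝ))
    (φ : 𝓓((⊤ : Opens (ℝ × ℝ)), ℝ)) : ℝ :=
  pairing T (heatTranspose (halfLaplacian φ))

/-- The distribution `∂ₜ^{1/2}(W ∗ T)`. The operator `∂ₜ^{1/2}` is its own transpose. -/
noncomputable def halfTimeDerivPotential (T : 𝓓'((⊤ : Opens (ℝ × ℝ)), ℝ))
    (φ : 𝓓((⊤ : Opens (ℝ × ℝ)), ℝ)) : ℝ :=
  pairing T (heatTranspose (halfTimeDeriv φ))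

/-- The functional `Λ` on test functions is given by the locally integrable function `g`. -/
def IsGivenBy (Λ : 𝓓((⊤ : Opens (ℝ × ℝ)), ℝ) → ℝ) (g : ℝ × ℝ → ℝ) : Prop :=
  LocallyIntegrable g ∧ ∀ φ : 𝓓((⊤ : Opens (ℝ × ℝ)), ℝ), Λ φ = ∫ p, g p * φ p

/-- The parabolic cube of the plane with lower left corner `a` and side length `ℓ`. -/
def parabolicCube (a : ℝ × ℝ) (ℓ : ℝ) : Set (ℝ × ℝ) :=
  Icc a.1 (a.1 + ℓ) ×ˢ Icc a.2 (a.2 + ℓ ^ 2)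

/-- The parabolic BMO norm of a locally integrable function. -/
noncomputable def parabolicBMONorm (g : ℝ × ℝ → ℝ) : ℝ≥0∞ :=
  ⨆ (a : ℝ × ℝ) (ℓ : ℝ) (_ : 0 < ℓ),
    (volume (parabolicCube a ℓ))⁻¹ *
      ∫⁻ p in parabolicCube a ℓ, ‖g p - ⨍ q in parabolicCube a ℓ, g q‖ₑ

/-- `‖Λ‖_∞ ≤ 1` for a distribution `Λ`. -/
def LInftyNormLeOne (Λ : 𝓓((⊤ : Opens (ℝ × ℝ)), ℝ) → ℝ) : Prop :=
  ∃ g : ℝ × ℝ → ℝ, IsGivenBy Λ g ∧ eLpNorm g ∞ volume ≤ 1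

/-- `‖Λ‖_{∗,p} ≤ 1` for a distribution `Λ`. -/
def BMONormLeOne (Λ : 𝓓((⊤ : Opens (ℝ × ℝ)), ℝ) → ℝ) : Prop :=
  ∃ g : ℝ × ℝ → ℝ, IsGivenBy Λ g ∧ parabolicBMONorm g ≤ 1

/-- The distributions admissible for the Lipschitz caloric capacity of `E`. -/
structure LipschitzAdmissible (E : Set (ℝ × ℝ)) (T : 𝓓'((⊤ : Opens (ℝ × ℝ)), ℝ)) : Prop where
  support_subset : dsupport T ⊆ E
  space : LInftyNormLeOne (spaceDerivPotential T)
  time : BMONormLeOne (halfTimeDerivPotential T)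

/-- The distributions admissible for the `Δ^{1/2}`-caloric capacity of `E`. -/
structure HalfLaplacianAdmissible (E : Set (ℝ × ℝ)) (T : 𝓓'((⊤ : Opens (ℝ × ℝ)), ℝ)) : Prop where
  support_subset : dsupport T ⊆ E
  space : LInftyNormLeOne (halfLaplacianPotential T)
  time : BMONormLeOne (halfTimeDerivPotential T)

/-- The Lipschitz caloric capacity `Γ_Θ(E)` of a compact set `E`. -/
noncomputable def lipschitzCaloricCapacity (E : Set (ℝ × ℝ)) : ℝ≥0∞ :=
  ⨆ (T : 𝓓'((⊤ : Opens (ℝ × ℝ)), ℝ)) (_ : LipschitzAdmissible E T), ‖pairing T fun _ => 1‖ₑ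

/-- The `Δ^{1/2}`-caloric capacity `γ_Θ^{1/2}(E)` of a compact set `E`. -/
noncomputable def halfLaplacianCaloricCapacity (E : Set (ℝ × ℝ)) : ℝ≥0∞ :=
  ⨆ (T : 𝓓'((⊤ : Opens (ℝ × ℝ)), ℝ)) (_ : HalfLaplacianAdmissible E T), ‖pairing T fun _ => 1‖ₑ

/-- The vertical segment `{0} × [0,1]`. -/
def verticalSegment : Set (ℝ × ℝ) := {0} ×ˢ Icc 0 1

/-- Two set functions on the plane are comparable if each of them is bounded, on all compact sets,
by a fixed finite multiple of the other. -/
def Comparable (c₁ c₂ : Set (ℝ × ℝ) → ℝ≥0∞) : Prop :=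
  ∃ C : ℝ≥0, ∀ E : Set (ℝ × ℝ), IsCompact E → c₁ E ≤ C * c₂ E ∧ c₂ E ≤ C * c₁ E

end CaloricCapacity

/-! The two capacities are separated because a point of the line is negligible for `(-Δ)^{1/2}` in
`L¹`, whereas a smooth density on a vertical line has a heat potential that is Lipschitz in `x`.

Vanishing (`pairing_one_eq_zero`). For every `ε > 0` there is a smooth `V`, equal to one near `0`
and supported in `[-2, 2]`, such that `V` and `(-Δ)^{1/2}V` have `L¹` norm at most `ε`
(`exists_capacitary_function`). It is a logarithmic average of dilates of a bump: its half Laplacian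
stays bounded in `L¹` while its height grows like `log R`. Let `χ` be a time cutoff that is one for
`|t| ≤ 3`. The backward heat equation `Wᵗ ∗ ((∂ₜ + ∂ₓ²)(χ ⊗ V)) = -χ ⊗ V` (`heatTranspose_heat_eq`)
and the identity `(-Δ)^{1/2}(-Δ)^{1/2}V = -c V''` with `c > 0` (`exists_halfLap_halfLap`) give `c
⟨T, 1⟩ = ⟨T, Wᵗ ∗ (χ ⊗ (-Δ)^{1/2}(-Δ)^{1/2}V)⟩ - c ⟨T, Wᵗ ∗ (χ' ⊗ V)⟩`. The first pairing tests
`(-Δₓ)^{1/2}(W ∗ T)` against `χ ⊗ (-Δ)^{1/2}V`, so the `L^∞` bound makes it `O(ε)`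
(`abs_pairing_heatTranspose_le`, which handles the missing compact support by truncation). In the
second the source lives in `3 ≤ |t| ≤ 4`, away from the segment, where the kernel is smooth; it is
`O(‖V‖₁) = O(ε)` (`exists_pairing_heatTranspose_le`). Hence `⟨T, 1⟩ = 0`.

Positivity (`exists_lipschitzAdmissible`). Take for `T` a small multiple of a smooth density `f` on
the segment. With time written as `r²`, the potential is an integral of `f(t - r²) exp(-x²/(4r²))`,
and `∫₀^∞ (1 - exp(-x²/(4r²))) dr` is a multiple of `|x|`; so the potential is Lipschitz in `x`, and
it is Lipschitz in `t` because `f` is. Being also bounded, it has a bounded space derivative and a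
bounded half derivative in time, and the second bound controls the BMO norm. -/

set_option maxSynthPendingDepth 3

namespace CaloricCapacity

/-! ### Smoothness of integrals depending on a parameter. -/

section ParametricIntegral

variable {α E F : Type*} [MeasurableSpace α] [NormedAddCommGroup E] [NormedSpace ℝ E]
  [NormedAddCommGroup F] [NormedSpace ℝ F]

/-- Hypotheses for repeated differentiation under the integral sign. -/
structure DominatedFamily (μ : Measure α) (f : α → E → F) : Prop where
  contDiff : ∀ a, ContDiff ℝ ∞ (f a)
  meas : ∀ k q, AEStronglyMeasurable (fun a => iteratedFDeriv ℝ k (f a) q) μ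
  bound : ∀ k q₀, ∃ b : α → ℝ, Integrable b μ ∧
    ∀ᵐ a ∂μ, ∀ q ∈ Metric.ball q₀ 1, ‖iteratedFDeriv ℝ k (f a) q‖ ≤ b a

variable {μ : Measure α} {f : α → E → F}

theorem DominatedFamily.integrable (h : DominatedFamily μ f) (k : ℕ) (q : E) :
    Integrable (fun a => iteratedFDeriv ℝ k (f a) q) μ := by
  obtain ⟨b, hb, hbound⟩ := h.bound k q
  exact Integrable.mono' hb (h.meas k q)
    (hbound.mono fun a ha => ha q (Metric.mem_ball_self one_pos))

theorem DominatedFamily.hasFDerivAt (h : DominatedFamily μ f) (k : ℕ) (q : E) :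
    HasFDerivAt (fun q => ∫ a, iteratedFDeriv ℝ k (f a) q ∂μ)
      (∫ a, fderiv ℝ (iteratedFDeriv ℝ k (f a)) q ∂μ) q := by
  obtain ⟨b, hb, hbound⟩ := h.bound (k + 1) q
  refine hasFDerivAt_integral_of_dominated_of_fderiv_le (𝕜 := ℝ) (bound := b)
    (F' := fun q a => fderiv ℝ (iteratedFDeriv ℝ k (f a)) q)
    (Metric.ball_mem_nhds q one_pos) (.of_forall fun x => h.meas k x) (h.integrable k q) ?_ ?_ hb ?_
  · simp only [fderiv_iteratedFDeriv]
    exact (continuousMultilinearCurryLeftEquiv ℝ (fun _ : Fin (k + 1) => E)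
      F).continuous.comp_aestronglyMeasurable (h.meas (k + 1) q)
  · refine hbound.mono fun a ha x hx => ?_
    rw [norm_fderiv_iteratedFDeriv]
    exact ha x hx
  · refine .of_forall fun a x _ => DifferentiableAt.hasFDerivAt ?_
    exact ((h.contDiff a).differentiable_iteratedFDeriv (by exact_mod_cast ENat.natCast_lt_top k)) x

theorem DominatedFamily.integrable_fderiv (h : DominatedFamily μ f) (k : ℕ) (q : E) :
    Integrable (fun a => fderiv ℝ (iteratedFDeriv ℝ k (f a)) q) μ := by
  simp only [fderiv_iteratedFDeriv]
  let L : (E [×(k + 1)]→L[ℝ] F) →L[ℝ] (E →L[ℝ] E [×k]→L[ℝ] F) :=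
      (continuousMultilinearCurryLeftEquiv ℝ
        (fun _ : Fin (k + 1) => E) F).toContinuousLinearEquiv.toContinuousLinearMap
  exact L.integrable_comp (h.integrable (k + 1) q)

/-- Each step of the induction is one differentiation under the integral; the currying isometries
are continuous linear and so commute with the integral. -/
theorem DominatedFamily.iteratedFDeriv_integral [CompleteSpace F] (h : DominatedFamily μ f) (k : ℕ) :
    iteratedFDeriv ℝ k (fun q => ∫ a, f a q ∂μ) =
      fun q => ∫ a, iteratedFDeriv ℝ k (f a) q ∂μ := by
  induction k with
  | zero =>
    ext1 q
    simp only [iteratedFDeriv_zero_eq_comp, Function.comp_apply]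
    exact ((continuousMultilinearCurryFin0 ℝ E F).symm.toContinuousLinearEquiv.integral_comp_comm
      (fun a => f a q)).symm
  | succ k ih =>
    rw [iteratedFDeriv_succ_eq_comp_left, ih]
    ext1 q
    rw [Function.comp_apply, (h.hasFDerivAt k q).fderiv]
    simp only [iteratedFDeriv_succ_eq_comp_left, Function.comp_apply]
    let L : (E →L[ℝ] E [×k]→L[ℝ] F) →L[ℝ] (E [×(k + 1)]→L[ℝ] F) :=
      (continuousMultilinearCurryLeftEquiv ℝ
        (fun _ : Fin (k + 1) => E) F).symm.toContinuousLinearEquiv.toContinuousLinearMap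
    exact (ContinuousLinearMap.integral_comp_comm (𝕜 := ℝ) (E := E →L[ℝ] E [×k]→L[ℝ] F)
      (Fₗ := E [×(k + 1)]→L[ℝ] F) L (h.integrable_fderiv k q)).symm

theorem DominatedFamily.contDiff_integral [CompleteSpace F] (h : DominatedFamily μ f) :
    ContDiff ℝ ∞ (fun q => ∫ a, f a q ∂μ) := by
  refine contDiff_of_differentiable_iteratedFDeriv fun k _ => ?_
  rw [h.iteratedFDeriv_integral]
  exact fun q => (h.hasFDerivAt k q).differentiableAt

end ParametricIntegral

/-! ### Functions with all derivatives bounded, and their differences. -/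

section DerivBound

variable {E F : Type*} [NormedAddCommGroup E] [NormedSpace ℝ E]
  [NormedAddCommGroup F] [NormedSpace ℝ F]

/-- `Φ` is smooth and its `k`-th derivative is bounded by `M k`. -/
structure DerivBound (Φ : E → F) (M : ℕ → ℝ) : Prop where
  contDiff : ContDiff ℝ ∞ Φ
  le : ∀ k q, ‖iteratedFDeriv ℝ k Φ q‖ ≤ M k

variable {Φ : E → F} {M : ℕ → ℝ}

theorem DerivBound.nonneg (h : DerivBound Φ M) (k : ℕ) : 0 ≤ M k :=
  (norm_nonneg _).trans (h.le k 0)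

theorem DerivBound.norm_le (h : DerivBound Φ M) (q : E) : ‖Φ q‖ ≤ M 0 := by
  simpa using h.le 0 q

theorem DerivBound.iteratedFDeriv_differentiable (h : DerivBound Φ M) (k : ℕ) :
    Differentiable ℝ (iteratedFDeriv ℝ k Φ) :=
  h.contDiff.differentiable_iteratedFDeriv (by exact_mod_cast ENat.natCast_lt_top k)

theorem DerivBound.continuous_iteratedFDeriv (h : DerivBound Φ M) (k : ℕ) :
    Continuous (iteratedFDeriv ℝ k Φ) := (h.iteratedFDeriv_differentiable k).continuous

theorem _root_.HasCompactSupport.exists_derivBound (hc : HasCompactSupport Φ)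
    (hs : ContDiff ℝ ∞ Φ) : ∃ M, DerivBound Φ M := by
  have : ∀ k : ℕ, ∃ C, ∀ q, ‖iteratedFDeriv ℝ k Φ q‖ ≤ C := fun k =>
    (hc.iteratedFDeriv k).exists_bound_of_continuous
      (hs.continuous_iteratedFDeriv (by exact_mod_cast le_top))
  choose M hM using this
  exact ⟨M, hs, hM⟩

theorem DerivBound.norm_sub_le (h : DerivBound Φ M) (k : ℕ) (q v : E) :
    ‖iteratedFDeriv ℝ k Φ (q + v) - iteratedFDeriv ℝ k Φ q‖ ≤ M (k + 1) * ‖v‖ := by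
  have := Convex.norm_image_sub_le_of_norm_fderiv_le (𝕜 := ℝ) (f := iteratedFDeriv ℝ k Φ)
    (s := univ) (C := M (k + 1)) (fun x _ => h.iteratedFDeriv_differentiable k x)
    (fun x _ => by rw [norm_fderiv_iteratedFDeriv]; exact h.le _ _) convex_univ
    (mem_univ q) (mem_univ (q + v))
  simpa using this

theorem DerivBound.norm_sub_le_two (h : DerivBound Φ M) (k : ℕ) (q v : E) :
    ‖iteratedFDeriv ℝ k Φ (q + v) - iteratedFDeriv ℝ k Φ q‖ ≤ 2 * M k := by
  refine (_root_.norm_sub_le _ _).trans ?_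
  linarith [h.le k (q + v), h.le k q]

theorem DerivBound.norm_fderiv_sub_le (h : DerivBound Φ M) (k : ℕ) (q v : E) :
    ‖fderiv ℝ (iteratedFDeriv ℝ k Φ) (q + v) - fderiv ℝ (iteratedFDeriv ℝ k Φ) q‖
      ≤ M (k + 2) * ‖v‖ := by
  have := h.norm_sub_le (k + 1) q v
  simp only [fderiv_iteratedFDeriv, Function.comp_apply]
  rwa [← LinearIsometryEquiv.map_sub (continuousMultilinearCurryLeftEquiv ℝ
    (fun _ : Fin (k + 1) => E) F), LinearIsometryEquiv.norm_map]

/-- The mean value inequality is applied to the second difference along `r ↦ r • v`, which vanishes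
at `r = 0`. Its derivative is a difference of first derivatives at points `2r • v` apart, which
gives the second power of `‖v‖`. -/
theorem DerivBound.norm_secondDiff_le (h : DerivBound Φ M) (k : ℕ) (q v : E) :
    ‖(2 : ℝ) • iteratedFDeriv ℝ k Φ q - iteratedFDeriv ℝ k Φ (q + v)
      - iteratedFDeriv ℝ k Φ (q - v)‖ ≤ 2 * M (k + 2) * ‖v‖ ^ 2 := by
  set A := iteratedFDeriv ℝ k Φ with hA
  have hd : ∀ x, HasFDerivAt A (fderiv ℝ A x) x :=
    fun x => (h.iteratedFDeriv_differentiable k x).hasFDerivAt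
  let g : ℝ → ContinuousMultilinearMap ℝ (fun _ : Fin k => E) F :=
    fun r => (2 : ℝ) • A q - A (q + r • v) - A (q - r • v)
  have hline : ∀ r : ℝ, HasDerivAt (fun r : ℝ => q + r • v) v r := fun r => by
    simpa using ((hasDerivAt_id r).smul_const v).const_add q
  have hline' : ∀ r : ℝ, HasDerivAt (fun r : ℝ => q - r • v) (-v) r := fun r => by
    simpa using ((hasDerivAt_id r).smul_const v).const_sub q
  have hg : ∀ r, HasDerivAt g (-(fderiv ℝ A (q + r • v) v) + fderiv ℝ A (q - r • v) v) r := by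
    intro r
    have h1 := (hd (q + r • v)).comp_hasDerivAt r (hline r)
    have h2 := (hd (q - r • v)).comp_hasDerivAt r (hline' r)
    have h3 := (h1.const_sub ((2 : ℝ) • A q)).sub h2
    rw [map_neg, sub_neg_eq_add] at h3
    exact h3
  have hbound : ∀ r ∈ Icc (0 : ℝ) 1, ‖deriv g r‖ ≤ 2 * M (k + 2) * ‖v‖ ^ 2 := by
    intro r hr
    rw [(hg r).deriv]
    have h3 := h.norm_fderiv_sub_le k (q + r • v) (-((2 * r) • v))
    have e : q + r • v + -((2 * r) • v) = q - r • v := by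
      rw [mul_smul, two_smul]; abel
    rw [e, norm_neg, norm_smul, Real.norm_eq_abs, abs_of_nonneg (by linarith [hr.1])] at h3
    calc ‖-(fderiv ℝ A (q + r • v) v) + fderiv ℝ A (q - r • v) v‖
        = ‖(fderiv ℝ A (q - r • v) - fderiv ℝ A (q + r • v)) v‖ := by
          congr 1
          rw [sub_apply]; abel
      _ ≤ (M (k + 2) * (2 * r * ‖v‖)) * ‖v‖ := ContinuousLinearMap.le_of_opNorm_le _ h3 v
      _ ≤ 2 * M (k + 2) * ‖v‖ ^ 2 := by
          have := mul_nonneg (h.nonneg (k + 2)) (sq_nonneg ‖v‖)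
          nlinarith [hr.2]
  have := Convex.norm_image_sub_le_of_norm_deriv_le (f := g) (s := Icc (0 : ℝ) 1)
    (fun r _ => (hg r).differentiableAt) hbound (convex_Icc 0 1) (left_mem_Icc.2 zero_le_one)
    (right_mem_Icc.2 zero_le_one)
  have h0 : g 0 = 0 := by simp [g, two_smul]
  rw [h0] at this
  simpa [g] using this

theorem DerivBound.norm_secondDiff_le_four (h : DerivBound Φ M) (k : ℕ) (q v : E) :
    ‖(2 : ℝ) • iteratedFDeriv ℝ k Φ q - iteratedFDeriv ℝ k Φ (q + v)
      - iteratedFDeriv ℝ k Φ (q - v)‖ ≤ 4 * M k := by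
  refine (_root_.norm_sub_le _ _).trans ((add_le_add_left (_root_.norm_sub_le _ _) _).trans ?_)
  rw [norm_smul, Real.norm_two]
  linarith [h.le k (q + v), h.le k q, h.le k (q - v)]

end DerivBound

end CaloricCapacity

namespace CaloricCapacity

/-! ### Integrable majorants for the two singular kernels. -/

section Weights

/-- A function dominating the kernel of the half derivative on bounded Lipschitz functions. -/
noncomputable def halfWeight (s : ℝ) : ℝ :=
  if |s| ≤ 1 then |s| ^ (-(1 / 2) : ℝ) else |s| ^ (-(3 / 2) : ℝ)

theorem halfWeight_nonneg (s : ℝ) : 0 ≤ halfWeight s := by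
  unfold halfWeight; split_ifs <;> positivity

theorem halfWeight_neg (s : ℝ) : halfWeight (-s) = halfWeight s := by
  simp [halfWeight]

theorem integrableOn_halfWeight_Ioi : IntegrableOn halfWeight (Ioi 0) := by
  rw [← Ioc_union_Ioi_eq_Ioi zero_le_one]
  refine IntegrableOn.union ?_ ?_
  · have h := (intervalIntegral.intervalIntegrable_rpow' (a := 0) (b := 1)
      (r := -(1 / 2)) (by norm_num)).1
    refine h.congr_fun (fun s hs => ?_) measurableSet_Ioc
    simp only [halfWeight]
    rw [abs_of_pos hs.1, if_pos hs.2]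
  · have h := integrableOn_Ioi_rpow_of_lt (a := -(3 / 2)) (by norm_num) zero_lt_one
    refine h.congr_fun (fun s hs => ?_) measurableSet_Ioi
    have hs' : (1 : ℝ) < s := hs
    simp only [halfWeight]
    rw [abs_of_pos (by linarith), if_neg (by linarith)]

theorem integrable_halfWeight : Integrable halfWeight := by
  have h1 := integrableOn_halfWeight_Ioi
  have h2 : IntegrableOn halfWeight (Iio 0) := by
    have := h1.comp_neg
    simp only [neg_Ioi, neg_zero, halfWeight_neg] at this
    exact this
  have h3 : IntegrableOn halfWeight (Iic 0) := by
    rw [← Iio_union_right]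
    exact h2.union (by simp)
  rw [← integrableOn_univ, ← Iic_union_Ioi (a := (0 : ℝ))]
  exact h3.union h1

/-- The Lipschitz bound tames the singularity for `|s| ≤ 1` and the uniform bound gives decay for
`|s| > 1`. At `s = 0` the inverse is zero by convention. -/
theorem inv_rpow_mul_le_halfWeight {s A B d : ℝ} (hA : 0 ≤ A) (hB : 0 ≤ B) (h1 : d ≤ A)
    (h2 : d ≤ B * |s|) : (|s| ^ (3 / 2 : ℝ))⁻¹ * d ≤ (A + B) * halfWeight s := by
  rcases eq_or_ne s 0 with rfl | hs
  · rw [abs_zero, Real.zero_rpow (by norm_num), inv_zero, zero_mul]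
    exact mul_nonneg (by positivity) (halfWeight_nonneg _)
  have hs0 : 0 < |s| := abs_pos.2 hs
  unfold halfWeight
  split_ifs with h
  · calc (|s| ^ (3 / 2 : ℝ))⁻¹ * d ≤ (|s| ^ (3 / 2 : ℝ))⁻¹ * (B * |s|) := by gcongr
      _ = B * |s| ^ (-(1 / 2) : ℝ) := by
        rw [← Real.rpow_neg hs0.le, mul_left_comm]
        nth_rewrite 2 [← Real.rpow_one |s|]
        rw [← Real.rpow_add hs0]; norm_num
      _ ≤ _ := by gcongr; linarith
  · rw [← Real.rpow_neg hs0.le, mul_comm]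
    gcongr; linarith

theorem inv_sq_mul_le {y A B d : ℝ} (hA : 0 ≤ A) (hB : 0 ≤ B) (h1 : d ≤ A)
    (h2 : d ≤ B * y ^ 2) : (y ^ 2)⁻¹ * d ≤ 2 * (A + B) * (1 + y ^ 2)⁻¹ := by
  rcases eq_or_ne y 0 with rfl | hy
  · simp; positivity
  have hy2 : 0 < y ^ 2 := by positivity
  rw [inv_mul_eq_div, ← div_eq_mul_inv, div_le_div_iff₀ hy2 (by positivity)]
  nlinarith [mul_nonneg hA hy2.le, mul_nonneg hB hy2.le]

end Weights

/-! ### The half Laplacian and the half derivative on smooth bounded functions. -/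

section Operators

variable {E F : Type*} [NormedAddCommGroup E] [NormedSpace ℝ E]
  [NormedAddCommGroup F] [NormedSpace ℝ F]

/-- The half Laplacian in the direction `e`. -/
noncomputable def halfLap (e : E) (Φ : E → F) (q : E) : F :=
  (2 * Real.pi)⁻¹ • ∫ y : ℝ, (y ^ 2)⁻¹ • ((2 : ℝ) • Φ q - Φ (q + y • e) - Φ (q - y • e))

/-- The half derivative in the direction `e`. -/
noncomputable def halfDeriv (e : E) (Φ : E → F) (q : E) : F :=
  ∫ s : ℝ, (|s| ^ (3 / 2 : ℝ))⁻¹ • (Φ (q + s • e) - Φ q)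

variable {Φ : E → F} {M : ℕ → ℝ} {e : E}

theorem halfTimeDeriv_eq (φ : ℝ × ℝ → ℝ) : halfTimeDeriv φ = halfDeriv ((0, 1) : ℝ × ℝ) φ := by
  ext p
  simp only [halfTimeDeriv, halfDeriv, smul_eq_mul]
  rw [← integral_add_left_eq_self _ p.2]
  refine integral_congr_ae (.of_forall fun y => ?_)
  simp only [div_eq_inv_mul, add_sub_cancel_left]
  obtain ⟨x, t⟩ := p
  simp

theorem DerivBound.iteratedFDeriv_secondDiff (h : DerivBound Φ M) (k : ℕ) (c : ℝ) (v q : E) :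
    iteratedFDeriv ℝ k (fun q => c • ((2 : ℝ) • Φ q - Φ (q + v) - Φ (q - v))) q =
      c • ((2 : ℝ) • iteratedFDeriv ℝ k Φ q - iteratedFDeriv ℝ k Φ (q + v)
        - iteratedFDeriv ℝ k Φ (q - v)) := by
  have hk : ContDiff ℝ k Φ := h.contDiff.of_le (by exact_mod_cast le_top)
  have h2 : ContDiffAt ℝ k (fun q => Φ (q + v)) q :=
    (hk.comp (contDiff_id.add contDiff_const)).contDiffAt
  have h3 : ContDiffAt ℝ k (fun q => Φ (q - v)) q :=
    (hk.comp (contDiff_id.sub contDiff_const)).contDiffAt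
  have h1 : ContDiffAt ℝ k ((2 : ℝ) • Φ) q := (contDiff_const.smul hk).contDiffAt
  have h12 : ContDiffAt ℝ k ((2 : ℝ) • Φ - fun q => Φ (q + v)) q := h1.sub h2
  have h123 : ContDiffAt ℝ k ((2 : ℝ) • Φ - (fun q => Φ (q + v)) - fun q => Φ (q - v)) q :=
    h12.sub h3
  change iteratedFDeriv ℝ k (c • ((2 : ℝ) • Φ - (fun q => Φ (q + v)) - (fun q => Φ (q - v)))) q = _
  rw [iteratedFDeriv_const_smul_apply h123, iteratedFDeriv_sub_apply h12 h3,
    iteratedFDeriv_sub_apply h1 h2, iteratedFDeriv_const_smul_apply hk.contDiffAt,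
    iteratedFDeriv_comp_add_right]
  simp only [sub_eq_add_neg q v]
  rw [← iteratedFDeriv_comp_add_right k (-v) q]
  simp only [sub_eq_add_neg]

theorem DerivBound.iteratedFDeriv_diff (h : DerivBound Φ M) (k : ℕ) (c : ℝ) (v q : E) :
    iteratedFDeriv ℝ k (fun q => c • (Φ (q + v) - Φ q)) q =
      c • (iteratedFDeriv ℝ k Φ (q + v) - iteratedFDeriv ℝ k Φ q) := by
  have hk : ContDiff ℝ k Φ := h.contDiff.of_le (by exact_mod_cast le_top)
  have h2 : ContDiffAt ℝ k (fun q => Φ (q + v)) q :=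
    (hk.comp (contDiff_id.add contDiff_const)).contDiffAt
  have h3 : ContDiffAt ℝ k ((fun q => Φ (q + v)) - Φ) q := h2.sub hk.contDiffAt
  change iteratedFDeriv ℝ k (c • ((fun q => Φ (q + v)) - Φ)) q = _
  rw [iteratedFDeriv_const_smul_apply h3,
    iteratedFDeriv_sub_apply h2 hk.contDiffAt, iteratedFDeriv_comp_add_right]

theorem DerivBound.secondDiff_le (h : DerivBound Φ M) (he : ‖e‖ ≤ 1) (k : ℕ) (q : E) (y : ℝ) :
    ‖(y ^ 2)⁻¹ • ((2 : ℝ) • iteratedFDeriv ℝ k Φ q - iteratedFDeriv ℝ k Φ (q + y • e)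
        - iteratedFDeriv ℝ k Φ (q - y • e))‖
      ≤ 2 * (4 * M k + 2 * M (k + 2)) * (1 + y ^ 2)⁻¹ := by
  have h0 := h.nonneg k
  have h1 := h.nonneg (k + 2)
  rw [norm_smul, Real.norm_of_nonneg (by positivity)]
  refine inv_sq_mul_le (by positivity) (by positivity) (h.norm_secondDiff_le_four k q _)
    ((h.norm_secondDiff_le k q _).trans ?_)
  rw [norm_smul, mul_pow, Real.norm_eq_abs, sq_abs]
  gcongr
  exact mul_le_of_le_one_right (sq_nonneg _) (pow_le_one₀ (norm_nonneg _) he)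

theorem DerivBound.diff_le (h : DerivBound Φ M) (he : ‖e‖ ≤ 1) (k : ℕ) (q : E) (s : ℝ) :
    ‖(|s| ^ (3 / 2 : ℝ))⁻¹ • (iteratedFDeriv ℝ k Φ (q + s • e) - iteratedFDeriv ℝ k Φ q)‖
      ≤ (2 * M k + M (k + 1)) * halfWeight s := by
  have h0 := h.nonneg k
  have h1 := h.nonneg (k + 1)
  rw [norm_smul, Real.norm_of_nonneg (by positivity)]
  refine inv_rpow_mul_le_halfWeight (by positivity) (by positivity) (h.norm_sub_le_two k q _)
    ((h.norm_sub_le k q _).trans ?_)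
  rw [norm_smul, Real.norm_eq_abs]
  gcongr
  exact mul_le_of_le_one_right (abs_nonneg _) he

theorem DerivBound.dominatedFamily_secondDiff (h : DerivBound Φ M) (he : ‖e‖ ≤ 1) :
    DominatedFamily volume
      (fun (y : ℝ) q => (y ^ 2)⁻¹ • ((2 : ℝ) • Φ q - Φ (q + y • e) - Φ (q - y • e))) where
  contDiff y := by
    have := h.contDiff
    fun_prop
  meas k q := by
    simp only [h.iteratedFDeriv_secondDiff]
    have := h.continuous_iteratedFDeriv k
    refine AEStronglyMeasurable.smul (f := fun y : ℝ => (y ^ 2)⁻¹) ?_ ?_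
    · exact (by fun_prop : Measurable fun y : ℝ => (y ^ 2)⁻¹).aestronglyMeasurable
    · exact (by fun_prop : Continuous _).aestronglyMeasurable
  bound k q₀ := by
    refine ⟨fun y => 2 * (4 * M k + 2 * M (k + 2)) * (1 + y ^ 2)⁻¹,
      integrable_inv_one_add_sq.const_mul _, .of_forall fun y q _ => ?_⟩
    rw [h.iteratedFDeriv_secondDiff]
    exact h.secondDiff_le he k q y

theorem DerivBound.dominatedFamily_diff (h : DerivBound Φ M) (he : ‖e‖ ≤ 1) :
    DominatedFamily volume
      (fun (s : ℝ) q => (|s| ^ (3 / 2 : ℝ))⁻¹ • (Φ (q + s • e) - Φ q)) where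
  contDiff y := by
    have := h.contDiff
    fun_prop
  meas k q := by
    simp only [h.iteratedFDeriv_diff]
    have := h.continuous_iteratedFDeriv k
    refine AEStronglyMeasurable.smul (f := fun s : ℝ => (|s| ^ (3 / 2 : ℝ))⁻¹) ?_ ?_
    · exact (by fun_prop : Measurable fun s : ℝ => (|s| ^ (3 / 2 : ℝ))⁻¹).aestronglyMeasurable
    · exact (by fun_prop : Continuous _).aestronglyMeasurable
  bound k q₀ := by
    refine ⟨fun y => (2 * M k + M (k + 1)) * halfWeight y,
      integrable_halfWeight.const_mul _, .of_forall fun y q _ => ?_⟩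
    rw [h.iteratedFDeriv_diff]
    exact h.diff_le he k q y

variable [CompleteSpace F]

theorem DerivBound.iteratedFDeriv_halfLap (h : DerivBound Φ M) (he : ‖e‖ ≤ 1) (k : ℕ) :
    iteratedFDeriv ℝ k (halfLap e Φ) = halfLap e (iteratedFDeriv ℝ k Φ) := by
  have hd := h.dominatedFamily_secondDiff he
  have hc : ContDiff ℝ k (fun q => ∫ y : ℝ,
      (y ^ 2)⁻¹ • ((2 : ℝ) • Φ q - Φ (q + y • e) - Φ (q - y • e))) :=
    hd.contDiff_integral.of_le (by exact_mod_cast le_top)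
  ext1 q
  change iteratedFDeriv ℝ k ((2 * Real.pi)⁻¹ • (fun q => ∫ y : ℝ,
      (y ^ 2)⁻¹ • ((2 : ℝ) • Φ q - Φ (q + y • e) - Φ (q - y • e)))) q = _
  rw [iteratedFDeriv_const_smul_apply hc.contDiffAt, hd.iteratedFDeriv_integral]
  simp only [h.iteratedFDeriv_secondDiff]
  rfl

/-- The operator commutes with derivatives, and `∫ (1 + y²)⁻¹ = π` cancels the normalisation
`(2π)⁻¹` against the factor `2` of the majorant. -/
theorem DerivBound.halfLap (h : DerivBound Φ M) (he : ‖e‖ ≤ 1) :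
    DerivBound (halfLap e Φ) (fun k => 4 * M k + 2 * M (k + 2)) where
  contDiff := contDiff_const.smul (h.dominatedFamily_secondDiff he).contDiff_integral
  le k q := by
    rw [h.iteratedFDeriv_halfLap he, CaloricCapacity.halfLap, norm_smul]
    have := norm_integral_le_of_norm_le (integrable_inv_one_add_sq.const_mul
      (2 * (4 * M k + 2 * M (k + 2)))) (.of_forall fun y : ℝ => h.secondDiff_le he k q y)
    rw [integral_const_mul, integral_univ_inv_one_add_sq] at this
    rw [Real.norm_of_nonneg (by positivity), inv_mul_le_iff₀ (by positivity)]
    linarith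

theorem DerivBound.halfDeriv (h : DerivBound Φ M) (he : ‖e‖ ≤ 1) :
    DerivBound (halfDeriv e Φ) (fun k => (2 * M k + M (k + 1)) * ∫ s, halfWeight s) where
  contDiff := (h.dominatedFamily_diff he).contDiff_integral
  le k q := by
    have hd := h.dominatedFamily_diff he
    change ‖iteratedFDeriv ℝ k (fun q => ∫ s : ℝ, (|s| ^ (3 / 2 : ℝ))⁻¹ •
      (Φ (q + s • e) - Φ q)) q‖ ≤ _
    rw [hd.iteratedFDeriv_integral]
    simp only [h.iteratedFDeriv_diff]
    have := norm_integral_le_of_norm_le (integrable_halfWeight.const_mul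
      (2 * M k + M (k + 1))) (.of_forall fun y : ℝ => h.diff_le he k q y)
    rwa [integral_const_mul] at this

end Operators

end CaloricCapacity

namespace CaloricCapacity

/-! ### Integrability of the heat kernel on time strips. -/

section HeatKernel

theorem heatKernel_nonneg (p : ℝ × ℝ) : 0 ≤ heatKernel p := by
  unfold heatKernel; split_ifs <;> positivity

theorem heatKernel_of_nonpos {p : ℝ × ℝ} (h : p.2 ≤ 0) : heatKernel p = 0 :=
  if_neg h.not_gt

theorem heatKernel_of_pos {p : ℝ × ℝ} (h : 0 < p.2) :
    heatKernel p = (Real.sqrt (4 * Real.pi * p.2))⁻¹ * Real.exp (-p.1 ^ 2 / (4 * p.2)) :=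
  if_pos h

theorem measurable_heatKernel : Measurable heatKernel := by
  unfold heatKernel
  refine Measurable.ite (measurableSet_lt measurable_const measurable_snd) ?_ measurable_const
  fun_prop

theorem heatKernel_slice {s : ℝ} (hs : 0 < s) (y : ℝ) :
    heatKernel (y, s) = (Real.sqrt (4 * Real.pi * s))⁻¹ * Real.exp (-(4 * s)⁻¹ * y ^ 2) := by
  rw [heatKernel_of_pos hs]
  congr 2
  field_simp

theorem integrable_heatKernel_slice (s : ℝ) : Integrable fun y => heatKernel (y, s) := by
  rcases le_or_gt s 0 with hs | hs
  · simp [heatKernel_of_nonpos (p := (_, s)) hs]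
  · simp only [heatKernel_slice hs]
    exact (integrable_exp_neg_mul_sq (by positivity)).const_mul _

theorem integral_heatKernel_slice {s : ℝ} (hs : 0 < s) : ∫ y, heatKernel (y, s) = 1 := by
  simp only [heatKernel_slice hs]
  rw [integral_const_mul, integral_gaussian, div_inv_eq_mul,
    show Real.pi * (4 * s) = 4 * Real.pi * s by ring]
  exact inv_mul_cancel₀ (by positivity)

/-- The heat kernel restricted to a time strip. -/
noncomputable def heatStrip (a b : ℝ) (p : ℝ × ℝ) : ℝ :=
  (Icc a b).indicator (fun _ => heatKernel p) p.2

theorem heatStrip_nonneg (a b : ℝ) (p : ℝ × ℝ) : 0 ≤ heatStrip a b p :=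
  indicator_nonneg (fun _ _ => heatKernel_nonneg p) _

theorem measurable_heatStrip (a b : ℝ) : Measurable (heatStrip a b) := by
  have : heatStrip a b = (Prod.snd ⁻¹' Icc a b).indicator heatKernel := rfl
  rw [this]
  exact measurable_heatKernel.indicator (measurable_snd measurableSet_Icc)

theorem integral_heatStrip_slice (a b s : ℝ) :
    ∫ y, heatStrip a b (y, s) = (Icc a b ∩ Ioi 0).indicator (fun _ => 1) s := by
  by_cases hs : s ∈ Icc a b
  · have : ∀ y, heatStrip a b (y, s) = heatKernel (y, s) := fun y => indicator_of_mem hs _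
    simp only [this]
    rcases le_or_gt s 0 with h | h
    · rw [indicator_of_notMem (fun h' => h'.2.not_ge h)]
      simp [heatKernel_of_nonpos (p := (_, s)) h]
    · rw [indicator_of_mem (show s ∈ Icc a b ∩ Ioi 0 from ⟨hs, h⟩), integral_heatKernel_slice h]
  · have : ∀ y, heatStrip a b (y, s) = 0 := fun y => indicator_of_notMem hs _
    simp only [this, integral_zero]
    rw [indicator_of_notMem (fun h' => hs h'.1)]

theorem integrable_heatStrip_slice_integral (a b : ℝ) :
    Integrable ((Icc a b ∩ Ioi 0).indicator (fun _ => (1 : ℝ))) := by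
  rw [integrable_indicator_iff (measurableSet_Icc.inter measurableSet_Ioi)]
  refine integrableOn_const ?_
  exact ((measure_mono inter_subset_left).trans_lt measure_Icc_lt_top).ne

theorem integrable_heatStrip (a b : ℝ) : Integrable (heatStrip a b) := by
  rw [Measure.volume_eq_prod,
    integrable_prod_iff' (measurable_heatStrip a b).aestronglyMeasurable]
  constructor
  · refine .of_forall fun s => ?_
    by_cases hs : s ∈ Icc a b
    · simp only [heatStrip, indicator_of_mem hs]
      exact integrable_heatKernel_slice s
    · simp only [heatStrip, indicator_of_notMem hs]
      exact integrable_zero _ _ _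
  · simp only [Real.norm_of_nonneg (heatStrip_nonneg _ _ _), integral_heatStrip_slice]
    exact integrable_heatStrip_slice_integral a b

/-- Every slice at a positive time has mass one and the others have mass zero. -/
theorem integral_heatStrip_le {a b : ℝ} (hab : a ≤ b) : ∫ p, heatStrip a b p ≤ b - a := by
  have h := integrable_heatStrip a b
  rw [Measure.volume_eq_prod] at h ⊢
  rw [integral_prod_symm _ h]
  simp only [integral_heatStrip_slice]
  rw [integral_indicator (measurableSet_Icc.inter measurableSet_Ioi), setIntegral_const,
    smul_eq_mul, mul_one]
  calc volume.real (Icc a b ∩ Ioi 0) ≤ volume.real (Icc a b) :=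
        measureReal_mono inter_subset_left measure_Icc_lt_top.ne
    _ = b - a := by simp [hab]

/-- In this form the singularity of the kernel stays fixed, so derivatives in `q` fall on `ψ` only.
-/
theorem heatTranspose_eq (ψ : ℝ × ℝ → ℝ) (q : ℝ × ℝ) :
    heatTranspose ψ q = ∫ p, heatKernel p * ψ (q + p) := by
  rw [heatTranspose, ← integral_sub_right_eq_self (fun p => heatKernel p * ψ (q + p)) q]
  simp only [add_sub_cancel]

end HeatKernel

/-! ### Heat potentials of sources supported in a bounded time interval. -/

section HeatBound

variable {Φ : ℝ × ℝ → ℝ} {M : ℕ → ℝ} {a b : ℝ}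

/-- The function `Φ` vanishes outside the time interval `[a, b]`. -/
def TimeSupp (a b : ℝ) {F : Type*} [Zero F] (Φ : ℝ × ℝ → F) : Prop :=
  ∀ p, p.2 ∉ Icc a b → Φ p = 0

theorem TimeSupp.iteratedFDeriv (h : TimeSupp a b Φ) (k : ℕ) :
    TimeSupp a b (iteratedFDeriv ℝ k Φ) := by
  intro p hp
  have : Φ =ᶠ[𝓝 p] fun _ => 0 := by
    have ho : IsOpen {p : ℝ × ℝ | p.2 ∉ Icc a b} :=
      (isClosed_Icc.preimage continuous_snd).isOpen_compl
    filter_upwards [ho.mem_nhds hp] with x hx using h x hx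
  rw [(this.iteratedFDeriv ℝ k).self_of_nhds]
  simp

theorem norm_heatKernel_smul_le {F : Type*} [NormedAddCommGroup F] [NormedSpace ℝ F]
    {G : ℝ × ℝ → F} {C : ℝ} (hG : TimeSupp a b G) (hC : ∀ p, ‖G p‖ ≤ C) (q p : ℝ × ℝ) :
    ‖heatKernel p • G (q + p)‖ ≤ C * heatStrip (a - q.2) (b - q.2) p := by
  by_cases hp : p.2 ∈ Icc (a - q.2) (b - q.2)
  · rw [heatStrip, indicator_of_mem hp, norm_smul, Real.norm_of_nonneg (heatKernel_nonneg p),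
      mul_comm]
    exact mul_le_mul_of_nonneg_right (hC _) (heatKernel_nonneg p)
  · rw [hG (q + p) (fun h => hp ⟨by linarith [h.1, Prod.snd_add q p],
      by linarith [h.2, Prod.snd_add q p]⟩), smul_zero, norm_zero]
    exact mul_nonneg ((norm_nonneg _).trans (hC 0)) (heatStrip_nonneg _ _ _)

theorem integrable_heatKernel_mul {G : ℝ × ℝ → ℝ} {C : ℝ} (hm : Continuous G)
    (hG : TimeSupp a b G) (hC : ∀ p, ‖G p‖ ≤ C) (q : ℝ × ℝ) :
    Integrable fun p => heatKernel p * G (q + p) := by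
  refine ((integrable_heatStrip (a - q.2) (b - q.2)).const_mul C).mono' ?_
    (.of_forall fun p => norm_heatKernel_smul_le hG hC q p)
  exact (measurable_heatKernel.mul (hm.comp (continuous_const_add q)).measurable).aestronglyMeasurable

theorem norm_heatTranspose_le {G : ℝ × ℝ → ℝ} {C : ℝ} (hab : a ≤ b)
    (hG : TimeSupp a b G) (hC : ∀ p, ‖G p‖ ≤ C) (q : ℝ × ℝ) :
    ‖heatTranspose G q‖ ≤ C * (b - a) := by
  rw [heatTranspose_eq]
  refine (norm_integral_le_of_norm_le ((integrable_heatStrip (a - q.2) (b - q.2)).const_mul C)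
    (.of_forall fun p => norm_heatKernel_smul_le hG hC q p)).trans ?_
  rw [integral_const_mul]
  refine mul_le_mul_of_nonneg_left ((integral_heatStrip_le (by linarith)).trans (by linarith))
    ((norm_nonneg _).trans (hC 0))

theorem iteratedFDeriv_heatKernel_smul (h : DerivBound Φ M) (k : ℕ) (p q : ℝ × ℝ) :
    iteratedFDeriv ℝ k (fun q => heatKernel p * Φ (q + p)) q =
      heatKernel p • iteratedFDeriv ℝ k Φ (q + p) := by
  have hk : ContDiff ℝ k Φ := h.contDiff.of_le (by exact_mod_cast le_top)
  have h2 : ContDiffAt ℝ k (fun q => Φ (q + p)) q :=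
    (hk.comp (contDiff_id.add contDiff_const)).contDiffAt
  change iteratedFDeriv ℝ k (heatKernel p • fun q => Φ (q + p)) q = _
  rw [iteratedFDeriv_const_smul_apply h2, iteratedFDeriv_comp_add_right]

theorem DerivBound.dominatedFamily_heat (h : DerivBound Φ M) (hs : TimeSupp a b Φ) :
    DominatedFamily volume (fun (p : ℝ × ℝ) q => heatKernel p * Φ (q + p)) where
  contDiff y := by
    have := h.contDiff
    fun_prop
  meas k q := by
    simp only [iteratedFDeriv_heatKernel_smul h]
    exact measurable_heatKernel.aestronglyMeasurable.smul
      ((h.continuous_iteratedFDeriv k).comp (continuous_const_add q)).aestronglyMeasurable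
  bound k q₀ := by
    -- The strip is enlarged by one on each side so that a single majorant serves all `q` in the
    -- unit ball about `q₀`.
    refine ⟨fun p => M k * heatStrip (a - q₀.2 - 1) (b - q₀.2 + 1) p,
      (integrable_heatStrip _ _).const_mul _, .of_forall fun p q hq => ?_⟩
    rw [iteratedFDeriv_heatKernel_smul h]
    refine (norm_heatKernel_smul_le (hs.iteratedFDeriv k) (h.le k) q p).trans ?_
    refine mul_le_mul_of_nonneg_left ?_ (h.nonneg k)
    refine indicator_le_indicator_of_subset ?_ (fun _ => heatKernel_nonneg p) _
    have : |q.2 - q₀.2| < 1 := (norm_snd_le (q - q₀)).trans_lt (mem_ball_iff_norm.1 hq)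
    rw [abs_lt] at this
    exact Icc_subset_Icc (by linarith) (by linarith)

theorem DerivBound.heatTranspose (h : DerivBound Φ M) (hab : a ≤ b) (hs : TimeSupp a b Φ) :
    DerivBound (heatTranspose Φ) (fun k => M k * (b - a)) where
  contDiff := by
    have := (h.dominatedFamily_heat hs).contDiff_integral
    simpa only [← heatTranspose_eq] using this
  le k q := by
    have := congrFun ((h.dominatedFamily_heat hs).iteratedFDeriv_integral k) q
    simp only [← heatTranspose_eq, iteratedFDeriv_heatKernel_smul h] at this
    rw [this]
    refine (norm_integral_le_of_norm_le ((integrable_heatStrip (a - q.2) (b - q.2)).const_mul (M k))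
      (.of_forall fun p => norm_heatKernel_smul_le (hs.iteratedFDeriv k) (h.le k) q p)).trans ?_
    rw [integral_const_mul]
    exact mul_le_mul_of_nonneg_left ((integral_heatStrip_le (by linarith)).trans (by linarith))
      (h.nonneg k)

end HeatBound

/-! ### The heat kernel inverts the backward heat operator. -/

section HeatIdentity

/-- The standard Gaussian density. -/
noncomputable def gauss (z : ℝ) : ℝ := (Real.sqrt (2 * Real.pi))⁻¹ * Real.exp (-(1 / 2) * z ^ 2)

theorem gauss_nonneg (z : ℝ) : 0 ≤ gauss z := by unfold gauss; positivity

theorem continuous_gauss : Continuous gauss := by unfold gauss; fun_prop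

theorem integrable_gauss : Integrable gauss :=
  (integrable_exp_neg_mul_sq (by norm_num)).const_mul _

theorem integrable_id_mul_gauss : Integrable fun z => z * gauss z := by
  have := (integrable_mul_exp_neg_mul_sq (b := 1 / 2) (by norm_num)).const_mul
    (Real.sqrt (2 * Real.pi))⁻¹
  refine this.congr (.of_forall fun z => ?_)
  simp only [gauss]; ring

theorem integral_gauss : ∫ z, gauss z = 1 := by
  simp only [gauss]
  rw [integral_const_mul, integral_gaussian, show Real.pi / (1 / 2) = 2 * Real.pi by ring]
  exact inv_mul_cancel₀ (by positivity)

theorem hasDerivAt_gauss (z : ℝ) : HasDerivAt gauss (-(z * gauss z)) z := by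
  have := (((hasDerivAt_pow 2 z).const_mul (-(1 / 2))).exp).const_mul (Real.sqrt (2 * Real.pi))⁻¹
  refine this.congr_deriv ?_
  simp only [gauss]; push_cast; ring

theorem heatKernel_sqrt_mul {s : ℝ} (hs : 0 < s) (z : ℝ) :
    Real.sqrt (2 * s) * heatKernel (Real.sqrt (2 * s) * z, s) = gauss z := by
  rw [heatKernel_slice hs, gauss, mul_pow, Real.sq_sqrt (by positivity),
    show 4 * Real.pi * s = (2 * s) * (2 * Real.pi) by ring,
    Real.sqrt_mul (show 0 ≤ 2 * s by positivity) (2 * Real.pi), mul_inv,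
    ← mul_assoc, ← mul_assoc, mul_inv_cancel₀ (by positivity), one_mul]
  congr 2
  field_simp
  norm_num

/-- The substitution `y = √(2s) z` turns each slice of the kernel into the standard Gaussian and
moves the dependence on `s` into the argument of `G`. -/
theorem integral_heatKernel_mul {G : ℝ × ℝ → ℝ} {q : ℝ × ℝ}
    (hG : Integrable fun p => heatKernel p * G (q + p)) :
    heatTranspose G q = ∫ s in Ioi (0 : ℝ), ∫ z, gauss z * G (q.1 + Real.sqrt (2 * s) * z, q.2 + s)
    := by
  rw [heatTranspose_eq]
  rw [Measure.volume_eq_prod] at hG ⊢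
  rw [integral_prod_symm _ hG, ← integral_indicator measurableSet_Ioi]
  congr 1
  ext1 s
  by_cases hs : s ∈ Ioi (0 : ℝ)
  · rw [indicator_of_mem hs]
    have hs' : 0 < s := hs
    have hr : 0 < Real.sqrt (2 * s) := Real.sqrt_pos.2 (by positivity)
    have := Measure.integral_comp_mul_left (fun y => heatKernel (y, s) * G (q + (y, s)))
      (Real.sqrt (2 * s))
    rw [abs_of_pos (by positivity), smul_eq_mul, eq_inv_mul_iff_mul_eq₀ hr.ne'] at this
    rw [← this, ← integral_const_mul]
    simp only [← mul_assoc, heatKernel_sqrt_mul hs']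
    rfl
  · rw [indicator_of_notMem hs]
    have : ∀ x, heatKernel (x, s) = 0 := fun x => heatKernel_of_nonpos (not_lt.1 hs)
    simp [this]

/-- Integration by parts with `gauss' = -z gauss`. It trades the second space derivative for a
factor `z`, which is what differentiating `V (x + √(2s) z)` in `s` produces. -/
theorem integral_gauss_mul_deriv {f f' : ℝ → ℝ} {C : ℝ} (hf : ∀ z, HasDerivAt f (f' z) z)
    (hf' : Continuous f') (h0 : ∀ z, ‖f z‖ ≤ C) (h1 : ∀ z, ‖f' z‖ ≤ C) :
    ∫ z, gauss z * f' z = ∫ z, z * gauss z * f z := by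
  have hfc : Continuous f := continuous_iff_continuousAt.2 fun z => (hf z).continuousAt
  have := integral_mul_deriv_eq_deriv_mul_of_integrable (u := gauss) (v := f) (v' := f')
    (u' := fun z => -(z * gauss z)) (fun z _ => hasDerivAt_gauss z) (fun z _ => hf z)
    (integrable_gauss.mul_bdd hf'.aestronglyMeasurable (.of_forall h1))
    (integrable_id_mul_gauss.neg.mul_bdd hfc.aestronglyMeasurable (.of_forall h0))
    (integrable_gauss.mul_bdd hfc.aestronglyMeasurable (.of_forall h0))
  rw [this, ← integral_neg]
  simp

/-- After the Gaussian substitution and integration by parts, the integrand becomes the total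
`s`-derivative of `χ (t + s) V (x + √(2s) z)`. Fubini lets the `s`-integral be done first; only the
value at `s = 0` survives, and the Gaussian has mass one. -/
theorem heatTranspose_heat_eq {χ χ' V V' V'' : ℝ → ℝ} {a b C : ℝ}
    (hχ : ∀ t, HasDerivAt χ (χ' t) t) (hχ' : Continuous χ') (hχs : ∀ t ∉ Icc a b, χ t = 0)
    (hχs' : ∀ t ∉ Icc a b, χ' t = 0) (hV : ∀ x, HasDerivAt V (V' x) x)
    (hV' : ∀ x, HasDerivAt V' (V'' x) x) (hV'' : Continuous V'')
    (bχ : ∀ t, ‖χ t‖ ≤ C) (bχ' : ∀ t, ‖χ' t‖ ≤ C) (bV : ∀ x, ‖V x‖ ≤ C) (bV' : ∀ x, ‖V' x‖ ≤ C)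
    (bV'' : ∀ x, ‖V'' x‖ ≤ C) (q : ℝ × ℝ) :
    heatTranspose (fun p => χ' p.2 * V p.1 + χ p.2 * V'' p.1) q = -(χ q.2 * V q.1) := by
  obtain ⟨x, t⟩ := q
  have hC : 0 ≤ C := (norm_nonneg _).trans (bχ 0)
  have cχ : Continuous χ := continuous_iff_continuousAt.2 fun z => (hχ z).continuousAt
  have cV : Continuous V := continuous_iff_continuousAt.2 fun z => (hV z).continuousAt
  have cV' : Continuous V' := continuous_iff_continuousAt.2 fun z => (hV' z).continuousAt
  have hint : Integrable fun p : ℝ × ℝ => heatKernel p *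
      ((fun p : ℝ × ℝ => χ' p.2 * V p.1 + χ p.2 * V'' p.1) ((x, t) + p)) := by
    have hc : Continuous fun p : ℝ × ℝ => χ' p.2 * V p.1 + χ p.2 * V'' p.1 := by fun_prop
    refine integrable_heatKernel_mul (a := a) (b := b) (C := C * C + C * C) hc
      (fun p hp => by simp [hχs _ hp, hχs' _ hp]) (fun p => ?_) (x, t)
    refine (norm_add_le _ _).trans ?_
    rw [norm_mul, norm_mul]
    gcongr
    exacts [bχ' _, bV _, bχ _, bV'' _]
  rw [integral_heatKernel_mul hint]
  let D : ℝ → ℝ → ℝ := fun s z => χ' (t + s) * V (x + Real.sqrt (2 * s) * z) +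
    χ (t + s) * (V' (x + Real.sqrt (2 * s) * z) * (z * (Real.sqrt (2 * s))⁻¹))
  have hD : ∀ s ∈ Ioi (0 : ℝ), ∀ z,
      HasDerivAt (fun s => χ (t + s) * V (x + Real.sqrt (2 * s) * z)) (D s z) s := by
    intro s hs z
    have hs' : 0 < s := hs
    have hr : HasDerivAt (fun s => Real.sqrt (2 * s)) (Real.sqrt (2 * s))⁻¹ s := by
      have := (((hasDerivAt_id s).const_mul 2).sqrt (by simp; positivity))
      refine this.congr_deriv ?_
      simp only [id, mul_one]
      rw [div_mul_eq_div_div, div_self two_ne_zero, one_div]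
    have h1 : HasDerivAt (fun s => χ (t + s)) (χ' (t + s)) s := by
      simpa using (hχ (t + s)).comp_const_add t s
    have h2 := (hV (x + Real.sqrt (2 * s) * z)).comp s ((hr.mul_const z).const_add x)
    refine (h1.mul h2).congr_deriv ?_
    simp only [D, Function.comp_apply]
    ring
  have hinner : ∀ s ∈ Ioi (0 : ℝ), ∫ z, gauss z * (χ' (t + s) * V (x + Real.sqrt (2 * s) * z) +
      χ (t + s) * V'' (x + Real.sqrt (2 * s) * z)) = ∫ z, gauss z * D s z := by
    intro s hs
    have hs' : 0 < s := hs
    set r := Real.sqrt (2 * s) with hr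
    have hr0 : 0 < r := Real.sqrt_pos.2 (by positivity)
    have ibp := integral_gauss_mul_deriv (f := fun z => V' (x + r * z))
      (f' := fun z => V'' (x + r * z) * r) (C := max C (C * r))
      (fun z => by
        exact ((hV' (x + r * z)).comp z
          (((hasDerivAt_id z).const_mul r).const_add x)).congr_deriv (by simp))
      (by fun_prop) (fun z => (bV' _).trans (le_max_left _ _))
      (fun z => by
        rw [norm_mul, Real.norm_of_nonneg hr0.le]
        exact (mul_le_mul_of_nonneg_right (bV'' _) hr0.le).trans (le_max_right _ _))
    have i1 : Integrable fun z => gauss z * (χ' (t + s) * V (x + r * z)) := by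
      refine integrable_gauss.mul_bdd (c := C * C) (by fun_prop) (.of_forall fun z => ?_)
      rw [norm_mul]; gcongr; exacts [bχ' _, bV _]
    have i2 : Integrable fun z => gauss z * (χ (t + s) * V'' (x + r * z)) := by
      refine integrable_gauss.mul_bdd (c := C * C) (by fun_prop) (.of_forall fun z => ?_)
      rw [norm_mul]; gcongr; exacts [bχ _, bV'' _]
    have i3 : Integrable fun z => gauss z * (χ (t + s) * (V' (x + r * z) * (z * r⁻¹))) := by
      have : Integrable fun z => z * gauss z * (χ (t + s) * (V' (x + r * z) * r⁻¹)) := by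
        refine integrable_id_mul_gauss.mul_bdd (c := C * (C * r⁻¹)) (by fun_prop)
          (.of_forall fun z => ?_)
        rw [norm_mul, norm_mul, Real.norm_of_nonneg (inv_nonneg.2 hr0.le)]
        gcongr; exacts [bχ _, bV' _]
      refine this.congr (.of_forall fun z => ?_)
      simp only; ring
    simp only [D, mul_add]
    rw [integral_add i1 i2, integral_add i1 i3]
    congr 1
    calc ∫ z, gauss z * (χ (t + s) * V'' (x + r * z))
        = χ (t + s) * r⁻¹ * ∫ z, gauss z * (V'' (x + r * z) * r) := by
          rw [← integral_const_mul]
          refine integral_congr_ae (.of_forall fun z => ?_)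
          simp only; field_simp
      _ = ∫ z, gauss z * (χ (t + s) * (V' (x + r * z) * (z * r⁻¹))) := by
          rw [ibp, ← integral_const_mul]
          refine integral_congr_ae (.of_forall fun z => ?_)
          simp only; ring
  rw [setIntegral_congr_fun measurableSet_Ioi hinner]
  -- Differentiating `√(2s)` costs a factor of order `s^{-1/2}`, which is integrable at zero; the
  -- support of `χ` bounds `s` from above.
  have hjoint : Integrable (Function.uncurry fun s z => gauss z * D s z)
      ((volume.restrict (Ioi (0 : ℝ))).prod volume) := by
    let w : ℝ → ℝ := (Icc (a - t) (b - t)).indicator fun _ => C * C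
    let w' : ℝ → ℝ := (Ioc 0 (b - t)).indicator fun s => C * C * (s ^ (-(1 / 2) : ℝ))
    have hw : Integrable w (volume.restrict (Ioi (0 : ℝ))) := by
      refine Integrable.mono_measure ?_ Measure.restrict_le_self
      exact (integrable_indicator_iff measurableSet_Icc).2
        (integrableOn_const (measure_Icc_lt_top.ne))
    have hw' : Integrable w' (volume.restrict (Ioi (0 : ℝ))) := by
      refine Integrable.mono_measure ?_ Measure.restrict_le_self
      refine (integrable_indicator_iff measurableSet_Ioc).2 (Integrable.const_mul ?_ _)
      rcases le_total 0 (b - t) with h | h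
      · exact ((intervalIntegral.intervalIntegrable_rpow' (by norm_num)).1)
      · simp [Ioc_eq_empty_of_le h]
    have hb := (hw.mul_prod integrable_gauss).add (hw'.mul_prod integrable_id_mul_gauss.norm)
    refine hb.mono' ?_ ?_
    · refine Measurable.aestronglyMeasurable ?_
      have := cχ.measurable
      have := cV.measurable
      have := cV'.measurable
      have := hχ'.measurable
      have := continuous_gauss.measurable
      simp only [D, Function.uncurry_def]
      fun_prop
    · have hpos : ∀ᵐ p ∂((volume.restrict (Ioi (0 : ℝ))).prod (volume : Measure ℝ)), 0 < p.1 := by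
        have := Measure.quasiMeasurePreserving_fst
          (μ := volume.restrict (Ioi (0 : ℝ))) (ν := (volume : Measure ℝ))
        exact this.ae (ae_restrict_mem measurableSet_Ioi)
      filter_upwards [hpos] with p hp
      obtain ⟨s, z⟩ := p
      simp only [Function.uncurry_apply_pair, Pi.add_apply] at hp ⊢
      by_cases hs : t + s ∈ Icc a b
      · have m1 : s ∈ Icc (a - t) (b - t) := ⟨by linarith [hs.1], by linarith [hs.2]⟩
        have m2 : s ∈ Ioc 0 (b - t) := ⟨hp, m1.2⟩
        simp only [w, w', indicator_of_mem m1, indicator_of_mem m2, D]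
        rw [norm_mul, norm_mul, Real.norm_of_nonneg (gauss_nonneg z)]
        have hsq : (Real.sqrt (2 * s))⁻¹ ≤ s ^ (-(1 / 2) : ℝ) := by
          rw [Real.rpow_neg hp.le, ← Real.sqrt_eq_rpow]
          exact inv_anti₀ (Real.sqrt_pos.2 hp) (Real.sqrt_le_sqrt (by linarith))
        have e1 : ‖χ' (t + s) * V (x + Real.sqrt (2 * s) * z)‖ ≤ C * C := by
          rw [norm_mul]; gcongr; exacts [bχ' _, bV _]
        have e2 : ‖χ (t + s) * (V' (x + Real.sqrt (2 * s) * z) * (z * (Real.sqrt (2 * s))⁻¹))‖ ≤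
            C * (C * (‖z‖ * s ^ (-(1 / 2) : ℝ))) := by
          rw [norm_mul, norm_mul, norm_mul, Real.norm_of_nonneg (inv_nonneg.2 (Real.sqrt_nonneg _))]
          gcongr; exacts [bχ _, bV' _]
        calc gauss z * _ ≤ gauss z * (C * C + C * (C * (‖z‖ * s ^ (-(1 / 2) : ℝ)))) :=
              mul_le_mul_of_nonneg_left ((norm_add_le _ _).trans (add_le_add e1 e2))
                (gauss_nonneg z)
          _ = _ := by ring
      · have : D s z = 0 := by simp [D, hχs _ hs, hχs' _ hs]
        rw [this, mul_zero, norm_zero]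
        have h1 : 0 ≤ w s := indicator_nonneg (fun _ _ => by positivity) _
        have h2 : 0 ≤ w' s := indicator_nonneg (fun s hs => by
          have := hs.1; positivity) _
        have := gauss_nonneg z
        positivity
  rw [integral_integral_swap hjoint]
  -- Fundamental theorem of calculus for fixed `z`: the term at infinity vanishes because `χ` has
  -- bounded support.
  have hfinal : ∀ᵐ z, ∫ s in Ioi (0 : ℝ), gauss z * D s z = gauss z * -(χ t * V x) := by
    filter_upwards [hjoint.prod_left_ae] with z hz
    rcases eq_or_ne (gauss z) 0 with h0 | h0
    · simp [h0]
    rw [integral_const_mul]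
    have hz' : IntegrableOn (fun s => D s z) (Ioi 0) := by
      have := Integrable.const_mul hz (gauss z)⁻¹
      refine this.congr (.of_forall fun s => ?_)
      simp only [Function.uncurry_apply_pair]
      rw [inv_mul_cancel_left₀ h0]
    have hlim : Filter.Tendsto (fun s => χ (t + s) * V (x + Real.sqrt (2 * s) * z)) Filter.atTop
        (𝓝 0) := by
      refine tendsto_const_nhds.congr' ?_
      filter_upwards [Filter.eventually_gt_atTop (b - t)] with s hs
      rw [hχs (t + s) (fun h => by linarith [h.2]), zero_mul]
    have := integral_Ioi_of_hasDerivAt_of_tendsto (a := 0)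
      (f := fun s => χ (t + s) * V (x + Real.sqrt (2 * s) * z)) (f' := fun s => D s z)
      (by fun_prop) (fun s hs => hD s hs z) hz' hlim
    rw [this]
    simp
  rw [integral_congr_ae hfinal, integral_mul_const, integral_gauss, one_mul]

end HeatIdentity

end CaloricCapacity

namespace CaloricCapacity

/-! ### Pairing distributions on the segment with smooth functions. -/

section Pairing

/-- A cutoff function of the plane, equal to one near the vertical segment. -/
noncomputable def planeBump : ContDiffBump (0 : ℝ × ℝ) := ⟨2, 3, by norm_num, by norm_num⟩

theorem contDiff_planeBump : ContDiff ℝ ∞ planeBump := planeBump.contDiff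

theorem isCompact_verticalSegment : IsCompact verticalSegment :=
  isCompact_singleton.prod isCompact_Icc

theorem verticalSegment_subset_ball : verticalSegment ⊆ Metric.ball (0 : ℝ × ℝ) 2 := by
  rintro ⟨x, t⟩ ⟨hx, ht⟩
  rw [mem_singleton_iff] at hx
  simp only [mem_ball_zero_iff, Prod.norm_def, max_lt_iff, Real.norm_eq_abs] at hx ht ⊢
  rw [hx, abs_of_nonneg ht.1]
  exact ⟨by norm_num, by linarith [ht.2]⟩

/-- The product of a smooth function with the cutoff function `planeBump`. -/
noncomputable def localize (u : ℝ × ℝ → ℝ) (hu : ContDiff ℝ ∞ u) :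
    𝓓((⊤ : Opens (ℝ × ℝ)), ℝ) where
  toFun p := planeBump p * u p
  contDiff' := contDiff_planeBump.mul hu
  hasCompactSupport' := planeBump.hasCompactSupport.mul_right
  tsupport_subset' := fun _ _ => trivial

variable {T : 𝓓'((⊤ : Opens (ℝ × ℝ)), ℝ)} {u v : ℝ × ℝ → ℝ}

theorem localize_eventuallyEq (hT : dsupport T ⊆ verticalSegment) (hu : ContDiff ℝ ∞ u) :
    (localize u hu : ℝ × ℝ → ℝ) =ᶠ[𝓝ˢ (dsupport T)] u := by
  have h : Metric.ball (0 : ℝ × ℝ) 2 ∈ 𝓝ˢ (dsupport T) :=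
    Metric.isOpen_ball.mem_nhdsSet.2 (hT.trans verticalSegment_subset_ball)
  filter_upwards [h] with p hp
  change planeBump p * u p = u p
  rw [planeBump.one_of_mem_closedBall (Metric.ball_subset_closedBall hp), one_mul]

theorem pairing_eq_localize (hT : dsupport T ⊆ verticalSegment) (hu : ContDiff ℝ ∞ u) :
    pairing T u = T (localize u hu) :=
  pairing_eq T u _ (localize_eventuallyEq hT hu)

theorem pairing_congr (hT : dsupport T ⊆ verticalSegment) (hu : ContDiff ℝ ∞ u)
    (h : u =ᶠ[𝓝ˢ (dsupport T)] v) : pairing T v = pairing T u := by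
  rw [pairing_eq_localize hT hu]
  exact pairing_eq T v _ ((localize_eventuallyEq hT hu).trans h)

theorem pairing_add (hT : dsupport T ⊆ verticalSegment) (hu : ContDiff ℝ ∞ u)
    (hv : ContDiff ℝ ∞ v) : pairing T (u + v) = pairing T u + pairing T v := by
  rw [pairing_eq_localize hT hu, pairing_eq_localize hT hv,
    pairing_eq_localize hT (u := u + v) (hu.add hv), ← map_add]
  congr 1
  ext p
  change planeBump p * (u p + v p) = planeBump p * u p + planeBump p * v p
  ring

theorem pairing_smul (hT : dsupport T ⊆ verticalSegment) (hu : ContDiff ℝ ∞ u) (c : ℝ) :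
    pairing T (c • u) = c * pairing T u := by
  rw [pairing_eq_localize hT hu, pairing_eq_localize hT (u := c • u) (contDiff_const.smul hu),
    ← smul_eq_mul, ← map_smul]
  congr 1
  ext p
  change planeBump p * (c * u p) = c * (planeBump p * u p)
  ring

/-- A distribution has finite order on functions supported in a fixed compact set. The pairing may
be computed after multiplication by `planeBump`, and Leibniz absorbs the derivatives of that cutoff
into the constant. -/
theorem exists_pairing_bound (hT : dsupport T ⊆ verticalSegment) :
    ∃ (C : ℝ) (N : ℕ), 0 ≤ C ∧ ∀ (u : ℝ × ℝ → ℝ) (M : ℕ → ℝ) (S : ℝ), DerivBound u M →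
      (∀ k ≤ N, M k ≤ S) → |pairing T u| ≤ C * S := by
  obtain ⟨B, hB⟩ := planeBump.hasCompactSupport.exists_derivBound contDiff_planeBump
  let K : Compacts (ℝ × ℝ) := ⟨Metric.closedBall 0 3, isCompact_closedBall 0 3⟩
  have hK : (K : Set (ℝ × ℝ)) ⊆ (⊤ : Opens (ℝ × ℝ)) := fun _ _ => trivial
  let L : 𝓓_{K}(ℝ × ℝ, ℝ) →ₗ[ℝ] ℝ :=
    { toFun := fun f => T (TestFunction.ofSupportedIn hK f)
      map_add' := fun f g => map_add T (TestFunction.ofSupportedIn hK f) (TestFunction.ofSupportedIn hK g)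
      map_smul' := fun c f => map_smul T c (TestFunction.ofSupportedIn hK f) }
  have hL : Continuous L :=
    (map_continuous T).comp (TestFunction.continuous_ofSupportedIn hK)
  obtain ⟨s, C, -, hC⟩ := Seminorm.bound_of_continuous
    (ContDiffMapSupportedIn.withSeminorms ℝ (ℝ × ℝ) ℝ ⊤ K) ((normSeminorm ℝ ℝ).comp L)
    (by exact continuous_norm.comp hL)
  let A : ℕ → ℝ := fun k => ∑ i ∈ Finset.range (k + 1), (k.choose i : ℝ) * B i
  have hA : ∀ k, 0 ≤ A k := fun k =>
    Finset.sum_nonneg fun i _ => mul_nonneg (Nat.cast_nonneg _) (hB.nonneg i)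
  -- The order `N` is the largest index among the finitely many seminorms that control `T`.
  refine ⟨C * ∑ k ∈ s, A k, s.sup id,
    mul_nonneg C.2 (Finset.sum_nonneg fun k _ => hA k), fun u M S hu hS => ?_⟩
  have hS0 : 0 ≤ S := (hu.nonneg 0).trans (hS 0 (Nat.zero_le _))
  let f : 𝓓_{K}(ℝ × ℝ, ℝ) := ContDiffMapSupportedIn.of_support_subset
    (f := fun p => planeBump p * u p) (contDiff_planeBump.mul hu.contDiff) (by
      refine (Function.support_mul_subset_left _ _).trans ?_
      rw [planeBump.support_eq]
      exact Metric.ball_subset_closedBall)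
  have e : pairing T u = L f := pairing_eq_localize hT hu.contDiff
  have h1 := hC f
  rw [e]
  refine h1.trans ?_
  change (C : ℝ) * _ ≤ _
  rw [mul_assoc]
  refine mul_le_mul_of_nonneg_left ?_ C.2
  refine Seminorm.finset_sup_apply_le (mul_nonneg (Finset.sum_nonneg fun k _ => hA k) hS0)
    fun k hk => ?_
  refine le_trans ?_ (mul_le_mul_of_nonneg_right
    (Finset.single_le_sum (fun k _ => hA k) hk) hS0)
  rw [ContDiffMapSupportedIn.seminorm_top_le_iff ℝ (mul_nonneg (hA k) hS0)]
  intro x _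
  refine (norm_iteratedFDeriv_mul_le contDiff_planeBump hu.contDiff x
    (n := k) (by exact_mod_cast le_top)).trans ?_
  rw [Finset.sum_mul]
  refine Finset.sum_le_sum fun i hi => ?_
  have hkN : k ≤ s.sup id := Finset.le_sup (f := id) hk
  gcongr
  · exact mul_nonneg (Nat.cast_nonneg _) (hB.nonneg i)
  · exact hB.le i x
  · exact (hu.le (k - i) x).trans (hS _ ((Nat.sub_le k i).trans hkN))

end Pairing

/-! ### Products of a function of time and a function of space. -/

section TensorProducts

theorem DerivBound.comp_clm {E E' F : Type*} [NormedAddCommGroup E] [NormedSpace ℝ E]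
    [NormedAddCommGroup E'] [NormedSpace ℝ E'] [NormedAddCommGroup F] [NormedSpace ℝ F]
    {f : E → F} {M : ℕ → ℝ} (hf : DerivBound f M) {g : E' →L[ℝ] E} (hg : ‖g‖ ≤ 1) :
    DerivBound (f ∘ g) M where
  contDiff := hf.contDiff.comp g.contDiff
  le k q := by
    rw [g.iteratedFDeriv_comp_right hf.contDiff q (by exact_mod_cast le_top)]
    refine (ContinuousMultilinearMap.norm_compContinuousLinearMap_le _ _).trans ?_
    refine (mul_le_of_le_one_right (norm_nonneg _) ?_).trans (hf.le k _)
    exact Finset.prod_le_one (fun _ _ => norm_nonneg _) fun _ _ => hg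

/-- The product of a smooth function of `x` and a smooth function of `t`. -/
theorem DerivBound.tensor {χ ψ : ℝ → ℝ} {A B : ℕ → ℝ} (hχ : DerivBound χ A)
    (hψ : DerivBound ψ B) :
    DerivBound (fun p : ℝ × ℝ => χ p.2 * ψ p.1)
      (fun k => ∑ i ∈ Finset.range (k + 1), (k.choose i : ℝ) * A i * B (k - i)) where
  contDiff := (hχ.contDiff.comp contDiff_snd).mul (hψ.contDiff.comp contDiff_fst)
  le k q := by
    have h1 : ContDiff ℝ ∞ (fun p : ℝ × ℝ => χ p.2) := hχ.contDiff.comp contDiff_snd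
    have h2 : ContDiff ℝ ∞ (fun p : ℝ × ℝ => ψ p.1) := hψ.contDiff.comp contDiff_fst
    have e1 := (hχ.comp_clm (g := ContinuousLinearMap.snd ℝ ℝ ℝ)
      (ContinuousLinearMap.norm_snd_le ℝ ℝ ℝ)).le
    have e2 := (hψ.comp_clm (g := ContinuousLinearMap.fst ℝ ℝ ℝ)
      (ContinuousLinearMap.norm_fst_le ℝ ℝ ℝ)).le
    refine (norm_iteratedFDeriv_mul_le h1 h2 q (n := k) (by exact_mod_cast le_top)).trans ?_
    refine Finset.sum_le_sum fun i _ => ?_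
    gcongr
    · exact mul_nonneg (Nat.cast_nonneg _) (hχ.nonneg i)
    · exact e1 i q
    · exact e2 _ q

theorem halfLaplacian_tensor (χ ψ : ℝ → ℝ) :
    halfLaplacian (fun p => χ p.2 * ψ p.1) = fun p => χ p.2 * halfLap (1 : ℝ) ψ p.1 := by
  ext p
  simp only [halfLaplacian, halfLap, smul_eq_mul, mul_one]
  rw [mul_left_comm (χ p.2), ← integral_const_mul (χ p.2)]
  congr 1
  congr 1
  ext y
  rw [div_eq_inv_mul]
  ring

end TensorProducts

end CaloricCapacity

namespace CaloricCapacity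

/-! ### The square of the half Laplacian via the Fourier transform. -/

section Fourier

open scoped FourierTransform SchwartzMap

/-- The second difference of a character divided by the square of the step. -/
noncomputable def cosKernel (y : ℝ) : ℝ := (y ^ 2)⁻¹ * (2 - 2 * Real.cos (2 * Real.pi * y))

theorem cosKernel_nonneg (y : ℝ) : 0 ≤ cosKernel y :=
  mul_nonneg (by positivity) (by linarith [Real.cos_le_one (2 * Real.pi * y)])

theorem measurable_cosKernel : Measurable cosKernel := by unfold cosKernel; fun_prop

theorem integrable_cosKernel : Integrable cosKernel := by
  refine (integrable_inv_one_add_sq.const_mul (2 * (4 + (2 * Real.pi) ^ 2))).mono'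
    measurable_cosKernel.aestronglyMeasurable (.of_forall fun y => ?_)
  rw [Real.norm_of_nonneg (cosKernel_nonneg y)]
  refine inv_sq_mul_le (by norm_num) (by positivity) ?_ ?_
  · linarith [Real.neg_one_le_cos (2 * Real.pi * y)]
  · have := Real.one_sub_sq_div_two_le_cos (x := 2 * Real.pi * y)
    nlinarith

theorem integral_cosKernel_pos : 0 < ∫ y, cosKernel y := by
  rw [integral_pos_iff_support_of_nonneg cosKernel_nonneg integrable_cosKernel]
  refine lt_of_lt_of_le ?_ (measure_mono (s := Ioo 0 (1 / 2)) fun y hy => ?_)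
  · simp
  · have h1 : 2 * Real.pi * y ≤ Real.pi := by nlinarith [hy.2, Real.pi_pos]
    have h2 : Real.cos (2 * Real.pi * y) < 1 := by
      rw [← Real.cos_zero]
      exact Real.cos_lt_cos_of_nonneg_of_le_pi le_rfl h1 (by have := hy.1; positivity)
    have h3 := hy.1
    refine (mul_pos (by positivity) (by linarith) : 0 < cosKernel y).ne'

theorem sq_mul_cosKernel (ξ y : ℝ) :
    (y ^ 2)⁻¹ * (2 - 2 * Real.cos (2 * Real.pi * (y * ξ))) = ξ ^ 2 * cosKernel (ξ * y) := by
  rcases eq_or_ne ξ 0 with rfl | h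
  · simp
  · rw [cosKernel, mul_comm ξ y, mul_pow, mul_inv, ← mul_assoc]
    field_simp

/-- Rescaling `y` shows that the Fourier symbol is a multiple of `|ξ|`; of the constant only the
positivity will matter. -/
theorem integral_sq_mul_cosKernel (ξ : ℝ) :
    ∫ y, ξ ^ 2 * cosKernel (ξ * y) = |ξ| * ∫ y, cosKernel y := by
  rw [integral_const_mul, Measure.integral_comp_mul_left, smul_eq_mul, ← mul_assoc]
  congr 1
  rcases eq_or_ne ξ 0 with rfl | h
  · simp
  · rw [abs_inv, ← sq_abs]
    have := abs_pos.2 h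
    field_simp

theorem integrable_sq_mul_cosKernel (ξ : ℝ) : Integrable fun y => ξ ^ 2 * cosKernel (ξ * y) := by
  rcases eq_or_ne ξ 0 with rfl | h
  · simp
  · exact (integrable_cosKernel.comp_mul_left' h).const_mul _

/-- The half Laplacian acts on Fourier integrals by a multiple of `|ξ|`. -/
theorem halfLap_fourierIntegral {h : ℝ → ℂ} (h0 : Integrable h)
    (h1 : Integrable fun ξ : ℝ => ((|ξ| : ℝ) : ℂ) * h ξ) (x : ℝ) :
    halfLap (1 : ℝ) (fun x : ℝ => ∫ ξ : ℝ, Complex.exp (2 * Real.pi * x * ξ * Complex.I) * h ξ) x =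
      (((2 * Real.pi)⁻¹ * ∫ y, cosKernel y : ℝ) : ℂ) *
        ∫ ξ : ℝ, Complex.exp (2 * Real.pi * x * ξ * Complex.I) * (((|ξ| : ℝ) : ℂ) * h ξ) := by
  have hexp : ∀ a : ℝ, ∀ ξ : ℝ, ‖Complex.exp (2 * Real.pi * a * ξ * Complex.I)‖ = 1 := fun a ξ => by
    have : (2 * Real.pi * a * ξ * Complex.I : ℂ) = ((2 * Real.pi * a * ξ : ℝ) : ℂ) * Complex.I := by
      push_cast; ring
    rw [this, Complex.norm_exp_ofReal_mul_I]
  have hint : ∀ a : ℝ, Integrable fun ξ : ℝ =>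
      Complex.exp (2 * Real.pi * a * ξ * Complex.I) * h ξ := fun a =>
    h0.bdd_mul (c := 1) (by fun_prop) (.of_forall fun ξ => (hexp a ξ).le)
  -- The second difference of the character `exp (2πixξ)` is the character times `2 - 2 cos (2πyξ)`.
  have hpt : ∀ y : ℝ, (y ^ 2)⁻¹ •
      ((2 : ℝ) • (∫ ξ : ℝ, Complex.exp (2 * Real.pi * x * ξ * Complex.I) * h ξ)
      - (∫ ξ : ℝ, Complex.exp (2 * Real.pi * (x + y • (1 : ℝ) : ℝ) * ξ * Complex.I) * h ξ)
      - ∫ ξ : ℝ, Complex.exp (2 * Real.pi * (x - y • (1 : ℝ) : ℝ) * ξ * Complex.I) * h ξ) =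
      ∫ ξ : ℝ, ((ξ ^ 2 * cosKernel (ξ * y) : ℝ) : ℂ) *
        (Complex.exp (2 * Real.pi * x * ξ * Complex.I) * h ξ) := by
    intro y
    have hint2 : Integrable fun ξ : ℝ =>
      (2 : ℝ) • (Complex.exp (2 * Real.pi * x * ξ * Complex.I) * h ξ) := (hint x).smul (2 : ℝ)
    have hint3 : Integrable fun ξ : ℝ =>
      (2 : ℝ) • (Complex.exp (2 * Real.pi * x * ξ * Complex.I) * h ξ) -
        Complex.exp (2 * Real.pi * (x + y • (1 : ℝ) : ℝ) * ξ * Complex.I) * h ξ :=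
      hint2.sub (hint _)
    rw [← integral_smul, ← integral_sub hint2 (hint _), ← integral_sub hint3 (hint _),
      ← integral_smul]
    congr 1
    ext1 ξ
    rw [← sq_mul_cosKernel]
    simp only [smul_eq_mul, mul_one, Complex.real_smul, Complex.ofReal_add, Complex.ofReal_sub,
      Complex.ofReal_mul, Complex.ofReal_cos, Complex.cos, Complex.ofReal_ofNat]
    rw [show (2 * Real.pi * (x + y) * ξ * Complex.I : ℂ) = 2 * Real.pi * x * ξ * Complex.I +
      2 * Real.pi * (y * ξ) * Complex.I by ring,
      show (2 * Real.pi * (x - y) * ξ * Complex.I : ℂ) = 2 * Real.pi * x * ξ * Complex.I +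
      -(2 * Real.pi * (y * ξ)) * Complex.I by ring, Complex.exp_add, Complex.exp_add]
    ring
  -- The `y`-integral of the kernel is a multiple of `|ξ|`, so joint integrability amounts to that
  -- of `|ξ| h(ξ)`.
  have hswap : Integrable (Function.uncurry fun (y ξ : ℝ) =>
      ((ξ ^ 2 * cosKernel (ξ * y) : ℝ) : ℂ) *
        (Complex.exp (2 * Real.pi * x * ξ * Complex.I) * h ξ)) (volume.prod volume) := by
    have hm : AEStronglyMeasurable (Function.uncurry fun (y ξ : ℝ) =>
      ((ξ ^ 2 * cosKernel (ξ * y) : ℝ) : ℂ) *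
        (Complex.exp (2 * Real.pi * x * ξ * Complex.I) * h ξ)) (volume.prod volume) := by
      refine AEStronglyMeasurable.mul ?_ ((hint x).aestronglyMeasurable.comp_snd)
      refine Measurable.aestronglyMeasurable ?_
      have := measurable_cosKernel
      fun_prop
    rw [integrable_prod_iff' hm]
    refine ⟨.of_forall fun ξ => ?_, ?_⟩
    · exact ((integrable_sq_mul_cosKernel ξ).ofReal (𝕜 := ℂ)).mul_const
        (Complex.exp (2 * Real.pi * x * ξ * Complex.I) * h ξ)
    · have : ∀ ξ y : ℝ, ‖((ξ ^ 2 * cosKernel (ξ * y) : ℝ) : ℂ) *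
        (Complex.exp (2 * Real.pi * x * ξ * Complex.I) * h ξ)‖ =
          ξ ^ 2 * cosKernel (ξ * y) * ‖h ξ‖ := fun ξ y => by
        rw [norm_mul, norm_mul, hexp, one_mul, Complex.norm_real, Real.norm_of_nonneg
          (mul_nonneg (sq_nonneg _) (cosKernel_nonneg _))]
      simp only [Function.uncurry_apply_pair, this, integral_mul_const, integral_sq_mul_cosKernel]
      refine (h1.norm.const_mul (∫ y, cosKernel y)).congr (.of_forall fun ξ => ?_)
      simp only [norm_mul, Complex.norm_real, Real.norm_eq_abs, abs_abs]
      ring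
  simp only [halfLap]
  simp only [hpt]
  rw [integral_integral_swap hswap]
  have hk : ∀ ξ : ℝ, ∫ y : ℝ, ((ξ ^ 2 * cosKernel (ξ * y) : ℝ) : ℂ) =
      ((|ξ| : ℝ) : ℂ) * ((∫ y, cosKernel y : ℝ) : ℂ) := fun ξ => by
    rw [integral_complex_ofReal, integral_sq_mul_cosKernel, Complex.ofReal_mul]
  simp only [integral_mul_const, hk]
  rw [Complex.ofReal_mul, mul_assoc (((2 * Real.pi)⁻¹ : ℝ) : ℂ),
    ← integral_const_mul ((∫ y, cosKernel y : ℝ) : ℂ),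
    Complex.real_smul]
  congr 2
  ext1 ξ
  ring

theorem halfLap_ofReal (V : ℝ → ℝ) (x : ℝ) :
    halfLap (1 : ℝ) (fun x => (V x : ℂ)) x = (halfLap (1 : ℝ) V x : ℝ) := by
  simp only [halfLap, smul_eq_mul]
  rw [Complex.ofReal_mul, ← integral_complex_ofReal, Complex.real_smul]
  congr 2
  ext1 y
  simp

/-- With symbol `a |ξ|`, the square has symbol `a² ξ²`, while `V''` has symbol `-(2πξ)²`; hence `c =
a² / (2π)²`. -/
theorem exists_halfLap_halfLap : ∃ c : ℝ, 0 < c ∧ ∀ V : ℝ → ℝ, ContDiff ℝ ∞ V →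
    HasCompactSupport V → ∀ x,
      halfLap (1 : ℝ) (halfLap (1 : ℝ) V) x = -(c * deriv (deriv V) x) := by
  set a : ℝ := (2 * Real.pi)⁻¹ * ∫ y, cosKernel y with ha
  have ha0 : 0 < a := mul_pos (by positivity) integral_cosKernel_pos
  refine ⟨a ^ 2 / (2 * Real.pi) ^ 2, by positivity, fun V hV hVc x => ?_⟩
  have hVc' : HasCompactSupport (fun x => (V x : ℂ)) := hVc.comp_left Complex.ofReal_zero
  have hV' : ContDiff ℝ ∞ (fun x => (V x : ℂ)) := Complex.ofRealCLM.contDiff.comp hV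
  let f : 𝓢(ℝ, ℂ) := hVc'.toSchwartzMap hV'
  have hf : (f : ℝ → ℂ) = fun x => (V x : ℂ) := rfl
  let f1 : 𝓢(ℝ, ℂ) := SchwartzMap.derivCLM ℝ ℂ f
  let f2 : 𝓢(ℝ, ℂ) := SchwartzMap.derivCLM ℝ ℂ f1
  have hf1 : (f1 : ℝ → ℂ) = deriv f := rfl
  have hf2 : (f2 : ℝ → ℂ) = deriv f1 := rfl
  let h : ℝ → ℂ := 𝓕 (f : ℝ → ℂ)
  have hh : h = ((𝓕 f : 𝓢(ℝ, ℂ)) : ℝ → ℂ) := (SchwartzMap.fourier_coe f).symm ▸ rfl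
  have i0 : Integrable h := by rw [hh]; exact (𝓕 f : 𝓢(ℝ, ℂ)).integrable
  have hcont : Continuous h := by rw [hh]; exact (𝓕 f : 𝓢(ℝ, ℂ)).continuous
  have i1 : Integrable fun ξ : ℝ => ((|ξ| : ℝ) : ℂ) * h ξ := by
    have := (𝓕 f : 𝓢(ℝ, ℂ)).integrable_pow_mul volume 1
    rw [← hh] at this
    refine this.mono' (by fun_prop) (.of_forall fun ξ => ?_)
    simp
  have i2 : Integrable fun ξ : ℝ => ((|ξ| : ℝ) : ℂ) * (((|ξ| : ℝ) : ℂ) * h ξ) := by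
    have := (𝓕 f : 𝓢(ℝ, ℂ)).integrable_pow_mul volume 2
    rw [← hh] at this
    refine this.mono' (by fun_prop) (.of_forall fun ξ => ?_)
    simp only [norm_mul, Complex.norm_real, Real.norm_eq_abs, abs_abs]
    exact le_of_eq (by ring)
  have inv : ∀ g : 𝓢(ℝ, ℂ), ∀ x, g x =
      ∫ ξ : ℝ, Complex.exp (2 * Real.pi * x * ξ * Complex.I) * 𝓕 (g : ℝ → ℂ) ξ := by
    intro g x
    have hg : Integrable (𝓕 (g : ℝ → ℂ)) := by
      rw [← SchwartzMap.fourier_coe]; exact (𝓕 g : 𝓢(ℝ, ℂ)).integrable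
    have := congrFun (g.continuous.fourierInv_fourier_eq g.integrable hg) x
    rw [Real.fourierInv_eq'] at this
    rw [← this]
    congr 1
    ext1 ξ
    rw [smul_eq_mul, RCLike.inner_apply, conj_trivial]
    congr 2
    push_cast
    ring
  have e0 : (fun x => (V x : ℂ)) =
      fun x : ℝ => ∫ ξ : ℝ, Complex.exp (2 * Real.pi * x * ξ * Complex.I) * h ξ := by
    rw [← hf]; ext1 x; exact inv f x
  have e1 : (fun x => ((halfLap (1 : ℝ) V x : ℝ) : ℂ)) = (a : ℂ) •
      fun x : ℝ => ∫ ξ : ℝ, Complex.exp (2 * Real.pi * x * ξ * Complex.I) * (((|ξ| : ℝ) : ℂ) * h ξ) := by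
    ext1 x
    rw [← halfLap_ofReal, e0, halfLap_fourierIntegral i0 i1]
    rfl
  have hsm : ∀ (c : ℂ) (g : ℝ → ℂ) (x : ℝ),
      halfLap (1 : ℝ) (c • g) x = c * halfLap (1 : ℝ) g x := by
    intro c g x
    simp only [halfLap, Pi.smul_apply, Complex.real_smul, smul_eq_mul]
    rw [mul_left_comm c, ← integral_const_mul c]
    congr 2
    ext1 y
    ring
  -- The second application is to the density `|ξ| h`, which need not be smooth at `0`; this is why
  -- `halfLap_fourierIntegral` asks only for integrability.
  have e2 : ((halfLap (1 : ℝ) (halfLap (1 : ℝ) V) x : ℝ) : ℂ) = (a : ℂ) ^ 2 *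
      ∫ ξ : ℝ, Complex.exp (2 * Real.pi * x * ξ * Complex.I) * (((|ξ| : ℝ) : ℂ) * (((|ξ| : ℝ) : ℂ) * h ξ)) := by
    rw [← halfLap_ofReal, e1, hsm, halfLap_fourierIntegral i1 i2, ← mul_assoc, sq]
  have e3 : ((deriv (deriv V) x : ℝ) : ℂ) = f2 x := by
    have hd : ∀ g : ℝ → ℝ, Differentiable ℝ g → deriv (fun x => (g x : ℂ)) =
        fun x => ((deriv g x : ℝ) : ℂ) := fun g hg => by
      ext1 x; exact ((hg x).hasDerivAt.ofReal_comp).deriv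
    have hV1 : ContDiff ℝ ∞ (deriv V) := (contDiff_infty_iff_deriv.1 hV).2
    rw [hf2, hf1, hf, hd V (hV.differentiable (by simp)), hd _ (hV1.differentiable (by simp))]
  have e4 : 𝓕 (f2 : ℝ → ℂ) = fun ξ : ℝ =>
      -((2 * Real.pi : ℝ) : ℂ) ^ 2 * (((|ξ| : ℝ) : ℂ) * (((|ξ| : ℝ) : ℂ) * h ξ)) := by
    have hdf : Integrable (deriv f) := by rw [← hf1]; exact f1.integrable
    have hdf1 : Integrable (deriv f1) := by rw [← hf2]; exact f2.integrable
    rw [hf2, Real.fourier_deriv f1.integrable f1.differentiable hdf1, hf1,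
      Real.fourier_deriv f.integrable f.differentiable hdf]
    ext1 ξ
    have : ((|ξ| : ℝ) : ℂ) * ((|ξ| : ℝ) : ℂ) = (ξ : ℂ) * ξ := by
      exact_mod_cast abs_mul_abs_self ξ
    simp only [smul_eq_mul]
    rw [← mul_assoc ((|ξ| : ℝ) : ℂ), this]
    push_cast
    linear_combination (4 * Real.pi ^ 2 * ξ ^ 2 * h ξ : ℂ) * Complex.I_sq
  have e5 := inv f2 x
  rw [e4] at e5
  have e6 : ∫ ξ : ℝ, Complex.exp (2 * Real.pi * x * ξ * Complex.I) *
      (-((2 * Real.pi : ℝ) : ℂ) ^ 2 * (((|ξ| : ℝ) : ℂ) * (((|ξ| : ℝ) : ℂ) * h ξ))) =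
      -((2 * Real.pi : ℝ) : ℂ) ^ 2 * ∫ ξ : ℝ, Complex.exp (2 * Real.pi * x * ξ * Complex.I) *
      (((|ξ| : ℝ) : ℂ) * (((|ξ| : ℝ) : ℂ) * h ξ)) := by
    rw [← integral_const_mul]; congr 1; ext1 ξ; ring
  rw [e6, ← e3] at e5
  have : ((halfLap (1 : ℝ) (halfLap (1 : ℝ) V) x : ℝ) : ℂ) =
      ((-(a ^ 2 / (2 * Real.pi) ^ 2 * deriv (deriv V) x) : ℝ) : ℂ) := by
    have e7 : ((-(a ^ 2 / (2 * Real.pi) ^ 2 * deriv (deriv V) x) : ℝ) : ℂ) =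
        -(((a ^ 2 / (2 * Real.pi) ^ 2 : ℝ) : ℂ) * ((deriv (deriv V) x : ℝ) : ℂ)) := by
      push_cast; ring
    have e8 : ((a ^ 2 / (2 * Real.pi) ^ 2 : ℝ) : ℂ) * ((2 * Real.pi : ℝ) : ℂ) ^ 2 = (a : ℂ) ^ 2 := by
      norm_cast
      field_simp
    rw [e2, e7, e5]
    linear_combination -(∫ ξ : ℝ, Complex.exp (2 * Real.pi * x * ξ * Complex.I) *
      (((|ξ| : ℝ) : ℂ) * (((|ξ| : ℝ) : ℂ) * h ξ))) * e8
  exact_mod_cast this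

end Fourier

end CaloricCapacity

namespace CaloricCapacity

/-! ### Decay and vanishing mean of the half Laplacian of a bump. -/

section Decay

variable {F : Type*} [NormedAddCommGroup F] [NormedSpace ℝ F]

/-- At such `x` the function vanishes, and `V (x ± y) ≠ 0` forces `|y| ≥ |x| / 2`, so the kernel is
at most `4 / x²` wherever it counts. -/
theorem norm_halfLap_le_of_support {V : ℝ → F} {b : ℝ} (hb : 0 < b) (hi : Integrable V)
    (hV : ∀ x, b < |x| → V x = 0) {x : ℝ} (hx : 2 * b < |x|) :
    ‖halfLap (1 : ℝ) V x‖ ≤ 8 * (∫ y, ‖V y‖) / x ^ 2 := by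
  have hx0 : 0 < |x| := by linarith
  have hx2 : 0 < x ^ 2 := by rw [← sq_abs]; positivity
  have key : ∀ y v, |v| = |y| → (y ^ 2)⁻¹ * ‖V (x + v)‖ ≤ 4 / x ^ 2 * ‖V (x + v)‖ := by
    intro y v hv
    by_cases h : b < |x + v|
    · simp [hV _ h]
    · have h1 : |x| ≤ |x + v| + |v| := by
        have := abs_sub (x + v) v
        rwa [add_sub_cancel_right] at this
      have h2 : |x| / 2 ≤ |y| := by rw [← hv]; linarith
      refine mul_le_mul_of_nonneg_right ?_ (norm_nonneg _)
      have hy0 : 0 < |y| := by linarith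
      rw [← sq_abs y, inv_le_comm₀ (by positivity) (by positivity), inv_div]
      calc x ^ 2 / 4 = (|x| / 2) ^ 2 := by rw [div_pow, sq_abs]; norm_num
        _ ≤ |y| ^ 2 := by gcongr
  have i1 : Integrable fun y => ‖V (x + y)‖ := (hi.comp_add_left x).norm
  have i2 : Integrable fun y => ‖V (x - y)‖ := (hi.comp_sub_left x).norm
  rw [halfLap, norm_smul, Real.norm_of_nonneg (by positivity)]
  have h1 : ‖∫ y : ℝ, (y ^ 2)⁻¹ • ((2 : ℝ) • V x - V (x + y • (1 : ℝ)) - V (x - y • (1 : ℝ)))‖ ≤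
      ∫ y, (4 / x ^ 2 * ‖V (x + y)‖ + 4 / x ^ 2 * ‖V (x - y)‖) := by
    refine norm_integral_le_of_norm_le ((i1.const_mul _).add (i2.const_mul _))
      (.of_forall fun y => ?_)
    rw [hV x (by linarith), smul_zero, zero_sub, norm_smul, smul_eq_mul, mul_one,
      Real.norm_of_nonneg (by positivity)]
    have h3 := key y y rfl
    have h4 := key y (-y) (abs_neg y)
    rw [← sub_eq_add_neg] at h4
    calc (y ^ 2)⁻¹ * ‖-V (x + y) - V (x - y)‖
        ≤ (y ^ 2)⁻¹ * (‖V (x + y)‖ + ‖V (x - y)‖) := by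
          gcongr
          refine (norm_sub_le _ _).trans ?_
          rw [norm_neg]
      _ ≤ _ := by rw [mul_add]; exact add_le_add h3 h4
  rw [integral_add (i1.const_mul _) (i2.const_mul _), integral_const_mul, integral_const_mul,
    integral_add_left_eq_self (fun y => ‖V y‖), integral_sub_left_eq_self (fun y => ‖V y‖)] at h1
  have h2 : (2 * Real.pi)⁻¹ ≤ 1 := inv_le_one_of_one_le₀ (by linarith [Real.pi_gt_three])
  refine (mul_le_of_le_one_left (norm_nonneg _) h2).trans (h1.trans (le_of_eq ?_))
  ring

/-- Derivatives commute with the half Laplacian, so the far-field estimate applies to the compactly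
supported function `iteratedFDeriv ℝ k V`; near the support the uniform bound is enough. -/
theorem exists_halfLap_decay {V : ℝ → ℝ} (hV : ContDiff ℝ ∞ V) (hc : HasCompactSupport V)
    (k : ℕ) : ∃ C, ∀ x, ‖iteratedFDeriv ℝ k (halfLap (1 : ℝ) V) x‖ ≤ C * (1 + x ^ 2)⁻¹ := by
  obtain ⟨M, hM⟩ := hc.exists_derivBound hV
  have he : ‖(1 : ℝ)‖ ≤ 1 := by simp
  have hL := hM.halfLap he
  obtain ⟨r, hr⟩ := (hc.iteratedFDeriv (𝕜 := ℝ) k).isCompact.isBounded.subset_closedBall 0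
  set b := max r 1 with hb
  have hb1 : 1 ≤ b := le_max_right _ _
  have hsupp : ∀ x, b < |x| → iteratedFDeriv ℝ k V x = 0 := fun x hx => by
    by_contra h
    have := hr (subset_tsupport _ h)
    rw [mem_closedBall_zero_iff, Real.norm_eq_abs] at this
    linarith [le_max_left r 1]
  have hi : Integrable (iteratedFDeriv ℝ k V) :=
    (hM.continuous_iteratedFDeriv k).integrable_of_hasCompactSupport (hc.iteratedFDeriv k)
  set I := ∫ y, ‖iteratedFDeriv ℝ k V y‖ with hI
  have hI0 : 0 ≤ I := integral_nonneg fun _ => norm_nonneg _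
  set A := 4 * M k + 2 * M (k + 2) with hA
  have hA0 : 0 ≤ A := by have := hM.nonneg k; have := hM.nonneg (k + 2); positivity
  refine ⟨A * (1 + (2 * b) ^ 2) + 16 * I, fun x => ?_⟩
  rw [← div_eq_mul_inv, le_div_iff₀ (by positivity)]
  rcases lt_or_ge (2 * b) |x| with hx | hx
  · rw [hM.iteratedFDeriv_halfLap he]
    have h := norm_halfLap_le_of_support (by linarith) hi hsupp hx
    have hx1 : 1 ≤ x ^ 2 := by rw [← sq_abs]; nlinarith
    calc _ ≤ 8 * I / x ^ 2 * (1 + x ^ 2) := by gcongr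
      _ ≤ 8 * I / x ^ 2 * (2 * x ^ 2) := by gcongr; linarith
      _ = 16 * I := by rw [div_mul_eq_mul_div, div_eq_iff (by positivity)]; ring
      _ ≤ _ := le_add_of_nonneg_left (by positivity)
  · have h2 : x ^ 2 ≤ (2 * b) ^ 2 := by rw [← sq_abs]; gcongr
    calc _ ≤ A * (1 + (2 * b) ^ 2) :=
          mul_le_mul (hL.le k x) (by linarith) (by positivity) hA0
      _ ≤ _ := le_add_of_nonneg_right (by positivity)

theorem halfLap_neg_arg {V : ℝ → F} (hV : ∀ x, V (-x) = V x) (x : ℝ) :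
    halfLap (1 : ℝ) V (-x) = halfLap (1 : ℝ) V x := by
  simp only [halfLap, smul_eq_mul, mul_one]
  congr 2
  ext1 y
  rw [hV, ← hV (-x + y), ← hV (-x - y)]
  congr 1
  rw [show -(-x + y) = x - y by ring, show -(-x - y) = x + y by ring, sub_right_comm]

theorem integral_secondDiff_comp_mul (V : ℝ → ℝ) {s : ℝ} (hs : 0 < s) (x : ℝ) :
    ∫ y : ℝ, (y ^ 2)⁻¹ * (2 * V (s * x) - V (s * (x + y)) - V (s * (x - y))) =
      s * ∫ y : ℝ, (y ^ 2)⁻¹ * (2 * V (s * x) - V (s * x + y) - V (s * x - y)) := by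
  have := Measure.integral_comp_mul_left
    (fun y : ℝ => (y ^ 2)⁻¹ * (2 * V (s * x) - V (s * x + y) - V (s * x - y))) s
  rw [smul_eq_mul, abs_of_pos (inv_pos.2 hs), eq_inv_mul_iff_mul_eq₀ hs.ne'] at this
  rw [← this, ← mul_assoc, ← integral_const_mul]
  congr 1
  ext1 y
  rw [mul_pow, mul_inv, mul_add, mul_sub]
  field_simp

/-- By translation invariance each second difference has integral zero. Fubini applies because the
`L¹` norm of the second difference is both bounded and `O(y²)`. -/
theorem integral_halfLap_eq_zero {V : ℝ → ℝ} (hV : ContDiff ℝ ∞ V) (hc : HasCompactSupport V) :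
    ∫ x, halfLap (1 : ℝ) V x = 0 := by
  obtain ⟨M, hM⟩ := hc.exists_derivBound hV
  obtain ⟨r, hr⟩ := hc.isCompact.isBounded.subset_closedBall 0
  set b := max r 1 with hb
  have hb1 : 1 ≤ b := le_max_right _ _
  have hsupp : ∀ x, b < |x| → V x = 0 := fun x hx => by
    by_contra h
    have := hr (subset_tsupport _ h)
    rw [mem_closedBall_zero_iff, Real.norm_eq_abs] at this
    linarith [le_max_left r 1]
  have hi : Integrable V := hV.continuous.integrable_of_hasCompactSupport hc
  set I := ∫ y, ‖V y‖ with hI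
  have hI0 : 0 ≤ I := integral_nonneg fun _ => norm_nonneg _
  have hVc := hV.continuous
  let D : ℝ → ℝ → ℝ := fun y x => 2 * V x - V (x + y) - V (x - y)
  have iD : ∀ y, Integrable (D y) := fun y =>
    ((hi.const_mul 2).sub (hi.comp_add_right y)).sub (hi.comp_sub_right y)
  have b1 : ∀ y, ∫ x, ‖D y x‖ ≤ 4 * I := by
    intro y
    have j1 := (hi.norm.const_mul 2)
    have j2 := (hi.comp_add_right y).norm
    have j3 := (hi.comp_sub_right y).norm
    have : ∫ x, ‖D y x‖ ≤ ∫ x, (2 * ‖V x‖ + ‖V (x + y)‖ + ‖V (x - y)‖) := by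
      refine integral_mono (iD y).norm ((j1.add j2).add j3) fun x => ?_
      refine (norm_sub_le _ _).trans (add_le_add ((norm_sub_le _ _).trans
        (add_le_add (le_of_eq ?_) le_rfl)) le_rfl)
      rw [norm_mul, Real.norm_two]
    rw [integral_add (by exact j1.add j2) j3, integral_add j1 j2, integral_const_mul,
      integral_add_right_eq_self (fun y => ‖V y‖),
      integral_sub_right_eq_self (fun y => ‖V y‖)] at this
    linarith
  have hM2 := hM.nonneg 2
  -- For `|y| ≤ 1` the second difference lives on an interval of length `2 (b + 1)` and is at most
  -- `2 M₂ y²`; for `|y| > 1` the bound `4 I` is enough.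
  have b2 : ∀ y, ∫ x, ‖D y x‖ ≤ (4 * I + 4 * (b + 1) * M 2) * y ^ 2 := by
    intro y
    rcases le_or_gt |y| 1 with hy | hy
    · have hbd : ∀ x, ‖D y x‖ ≤ (Icc (-(b + 1)) (b + 1)).indicator
          (fun _ => 2 * M 2 * y ^ 2) x := by
        intro x
        by_cases hx : x ∈ Icc (-(b + 1)) (b + 1)
        · rw [indicator_of_mem hx]
          have := hM.norm_secondDiff_le 0 x y
          simp only [iteratedFDeriv_zero_eq_comp, Function.comp_apply, zero_add] at this
          rw [← map_smul, ← map_sub, ← map_sub, LinearIsometryEquiv.norm_map, Real.norm_eq_abs y,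
            sq_abs] at this
          exact this
        · rw [indicator_of_notMem hx]
          have hx' : b + 1 < |x| := by
            by_contra h; exact hx (abs_le.1 (not_lt.1 h))
          have h1 : |x| ≤ |x + y| + |y| := by
            have := abs_sub (x + y) y; rwa [add_sub_cancel_right] at this
          have h2 : |x| ≤ |x - y| + |y| := by
            have := abs_add_le (x - y) y; rwa [sub_add_cancel] at this
          simp only [D]
          rw [hsupp x (by linarith), hsupp (x + y) (by linarith), hsupp (x - y) (by linarith)]
          simp
      have := integral_mono (iD y).norm ((integrable_indicator_iff measurableSet_Icc).2
        (integrableOn_const measure_Icc_lt_top.ne)) hbd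
      rw [integral_indicator measurableSet_Icc, setIntegral_const, smul_eq_mul,
        Real.volume_real_Icc_of_le (by linarith)] at this
      nlinarith [mul_nonneg hI0 (sq_nonneg y)]
    · have : 1 ≤ y ^ 2 := by rw [← sq_abs]; nlinarith
      refine (b1 y).trans ?_
      have h3 : 0 ≤ 4 * (b + 1) * M 2 := by positivity
      nlinarith
  have hm : AEStronglyMeasurable (Function.uncurry fun y x => (y ^ 2)⁻¹ * D y x)
      (volume.prod volume) := by
    refine Measurable.aestronglyMeasurable ?_
    have := hVc.measurable
    simp only [D, Function.uncurry_def]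
    fun_prop
  have hint : Integrable (Function.uncurry fun y x => (y ^ 2)⁻¹ * D y x)
      (volume.prod volume) := by
    rw [integrable_prod_iff hm]
    refine ⟨.of_forall fun y => (iD y).const_mul (y ^ 2)⁻¹, ?_⟩
    refine (integrable_inv_one_add_sq.const_mul
      (2 * (4 * I + (4 * I + 4 * (b + 1) * M 2)))).mono' hm.norm.integral_prod_right'
      (.of_forall fun y => ?_)
    rw [Real.norm_of_nonneg (integral_nonneg fun _ => norm_nonneg _)]
    simp only [Function.uncurry_apply_pair, norm_mul, integral_const_mul]
    rw [Real.norm_of_nonneg (by positivity)]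
    exact inv_sq_mul_le (by positivity) (by positivity) (b1 y) (b2 y)
  have hz : ∀ y, ∫ x, (y ^ 2)⁻¹ * D y x = 0 := fun y => by
    rw [integral_const_mul]
    have hi2 : Integrable fun x => 2 * V x - V (x + y) :=
      (hi.const_mul 2).sub (hi.comp_add_right y)
    simp only [D]
    rw [integral_sub hi2 (hi.comp_sub_right y), integral_sub (hi.const_mul 2) (hi.comp_add_right y), integral_const_mul,
      integral_add_right_eq_self V, integral_sub_right_eq_self V]
    ring
  have := integral_integral_swap hint
  simp only [hz, integral_zero] at this
  simp only [halfLap, smul_eq_mul, mul_one]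
  rw [integral_const_mul]
  simp only [D] at this
  rw [← this, mul_zero]

end Decay

/-! ### Integrals of dilates of an even kernel of mean zero. -/

section Dilates

variable {k : ℝ → ℝ} {C R : ℝ}

theorem abs_tail_le (hb : ∀ x, |k x| ≤ C * (1 + x ^ 2)⁻¹) (hC : 0 ≤ C) {a x : ℝ}
    (ha : 0 < a) (hx : x ≠ 0) : |∫ s in Ioi a, k (s * x)| ≤ C / (a * x ^ 2) := by
  have h := integral_Ioi_rpow_of_lt (a := -2) (by norm_num) ha
  have hi := integrableOn_Ioi_rpow_of_lt (a := -2) (by norm_num) ha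
  have hx2 : 0 < x ^ 2 := by positivity
  have := norm_integral_le_of_norm_le (f := fun s => k (s * x)) (μ := volume.restrict (Ioi a))
    (hi.const_mul (C / x ^ 2)) (by
      filter_upwards [ae_restrict_mem measurableSet_Ioi] with s hs
      have hs' : 0 < s := ha.trans hs
      rw [Real.norm_eq_abs]
      refine (hb _).trans ?_
      rw [Real.rpow_neg hs'.le, Real.rpow_two, ← div_eq_mul_inv, ← div_eq_mul_inv, div_div]
      gcongr
      nlinarith)
  rw [integral_const_mul, h] at this
  refine this.trans (le_of_eq ?_)
  norm_num
  rw [Real.rpow_neg_one]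
  field_simp

/-- Evenness and mean zero give `∫₀^∞ k(sx) ds = 0`, which removes the non-integrable `1/|x|` that
`∫₁^∞ k(sx) ds` would otherwise have at the origin. The point of the bound is that its `L¹` norm in
`x` does not depend on `R`. -/
theorem abs_integral_dilates_le (hk : Continuous k) (hb : ∀ x, |k x| ≤ C * (1 + x ^ 2)⁻¹)
    (heven : ∀ x, k (-x) = k x) (h0 : ∫ x, k x = 0) (hR : 1 ≤ R) (x : ℝ) :
    |∫ s in (1 : ℝ)..R, k (s * x)| ≤
      2 * C * (1 + x ^ 2)⁻¹ + 2 * C * (R * (1 + (R * x) ^ 2)⁻¹) := by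
  have hC : 0 ≤ C := by have := (abs_nonneg _).trans (hb 0); simpa using this
  have hki : Integrable k := (integrable_inv_one_add_sq.const_mul C).mono'
    hk.aestronglyMeasurable (.of_forall hb)
  have hkC : ∀ x, |k x| ≤ C := fun x => (hb x).trans
    (mul_le_of_le_one_right hC (inv_le_one_of_one_le₀ (by nlinarith [sq_nonneg x])))
  have w1 : ∀ z : ℝ, |z| ≤ 1 → 1 ≤ 2 * (1 + z ^ 2)⁻¹ := fun z hz => by
    rw [← div_eq_mul_inv, le_div_iff₀ (by positivity)]
    have : z ^ 2 ≤ 1 := by rw [← sq_abs]; exact pow_le_one₀ (abs_nonneg _) hz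
    linarith
  have w2 : ∀ z : ℝ, 1 ≤ |z| → (z ^ 2)⁻¹ ≤ 2 * (1 + z ^ 2)⁻¹ := fun z hz => by
    have : 1 ≤ z ^ 2 := by rw [← sq_abs]; exact one_le_pow₀ hz
    rw [← div_eq_mul_inv, le_div_iff₀ (by positivity), inv_mul_le_iff₀ (by positivity)]
    linarith
  have hRx : |R * x| = R * |x| := by rw [abs_mul, abs_of_pos (by linarith)]
  have p1 : 0 ≤ 2 * C * (1 + x ^ 2)⁻¹ := by positivity
  have p2 : 0 ≤ 2 * C * (R * (1 + (R * x) ^ 2)⁻¹) := by positivity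
  -- When `R|x| ≤ 1` the trivial bound `C R` is already comparable with the second term on the
  -- right.
  rcases le_or_gt (R * |x|) 1 with hs | hs
  · have := intervalIntegral.norm_integral_le_of_norm_le_const (a := 1) (b := R) (C := C)
      (f := fun s => k (s * x)) (fun s _ => hkC _)
    rw [Real.norm_eq_abs, abs_of_nonneg (by linarith : 0 ≤ R - 1)] at this
    have h1 := w1 (R * x) (by rw [hRx]; exact hs)
    have h2 : C * R ≤ 2 * C * (R * (1 + (R * x) ^ 2)⁻¹) := by
      calc C * R = C * R * 1 := (mul_one _).symm
        _ ≤ C * R * (2 * (1 + (R * x) ^ 2)⁻¹) := by gcongr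
        _ = _ := by ring
    nlinarith
  have hx0 : x ≠ 0 := by
    rintro rfl
    rw [abs_zero, mul_zero] at hs
    linarith
  have hii : Integrable fun s => k (s * x) := hki.comp_mul_right' hx0
  have hsplit : ∫ s in (1 : ℝ)..R, k (s * x) =
      (∫ s in Ioi (1 : ℝ), k (s * x)) - ∫ s in Ioi R, k (s * x) := by
    rw [intervalIntegral.integral_of_le hR, ← Ioc_union_Ioi_eq_Ioi hR,
      setIntegral_union (Ioc_disjoint_Ioi le_rfl) measurableSet_Ioi hii.integrableOn
      hii.integrableOn]
    ring
  have hzero : ∫ s in Ioi (0 : ℝ), k (s * x) = 0 := by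
    have h1 := integral_comp_abs (f := fun s => k (s * x))
    have h2 : ∀ s : ℝ, k (|s| * x) = k (s * x) := fun s => by
      rcases abs_choice s with h | h <;> rw [h]
      rw [neg_mul, heven]
    simp only [h2] at h1
    rw [Measure.integral_comp_mul_right, h0, smul_zero] at h1
    linarith
  -- The cancellation is used here: for `|x| ≤ 1` the integral over `[0, 1]` is at most `C`,
  -- uniformly in `x`.
  have hsplit0 : ∫ s in Ioi (1 : ℝ), k (s * x) = -∫ s in (0 : ℝ)..1, k (s * x) := by
    rw [← Ioc_union_Ioi_eq_Ioi zero_le_one, setIntegral_union (Ioc_disjoint_Ioi le_rfl)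
      measurableSet_Ioi hii.integrableOn hii.integrableOn] at hzero
    rw [intervalIntegral.integral_of_le zero_le_one]
    linarith
  have htail : |∫ s in Ioi R, k (s * x)| ≤ 2 * C * (R * (1 + (R * x) ^ 2)⁻¹) := by
    refine (abs_tail_le hb hC (by linarith) hx0).trans ?_
    have h1 := w2 (R * x) (by rw [hRx]; exact hs.le)
    have hR0 : 0 < R := by linarith
    calc C / (R * x ^ 2) = C * R * ((R * x) ^ 2)⁻¹ := by field_simp
      _ ≤ C * R * (2 * (1 + (R * x) ^ 2)⁻¹) := by gcongr
      _ = _ := by ring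
  have hhead : |∫ s in Ioi (1 : ℝ), k (s * x)| ≤ 2 * C * (1 + x ^ 2)⁻¹ := by
    rcases le_or_gt |x| 1 with h | h
    · rw [hsplit0, abs_neg]
      have := intervalIntegral.norm_integral_le_of_norm_le_const (a := 0) (b := 1) (C := C)
        (f := fun s => k (s * x)) (fun s _ => hkC _)
      rw [Real.norm_eq_abs, sub_zero, abs_one, mul_one] at this
      have h1 := w1 x h
      nlinarith
    · refine (abs_tail_le hb hC one_pos hx0).trans ?_
      have h1 := w2 x h.le
      rw [one_mul, div_eq_mul_inv]
      nlinarith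
  rw [hsplit]
  exact (abs_sub _ _).trans (add_le_add hhead htail)

end Dilates

end CaloricCapacity

namespace CaloricCapacity

/-! ### Functions equal to one near the origin with small half Laplacian in `L¹`. -/

section CapacitaryFunctions

/-- An even bump function of the line. -/
noncomputable def lineBump : ContDiffBump (0 : ℝ) := ⟨1, 2, by norm_num, by norm_num⟩

theorem contDiff_lineBump : ContDiff ℝ ∞ lineBump := lineBump.contDiff

theorem lineBump_neg (x : ℝ) : lineBump (-x) = lineBump x := by
  simpa using lineBump.neg x

theorem lineBump_eq_zero {x : ℝ} (hx : 2 ≤ |x|) : lineBump x = 0 :=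
  lineBump.zero_of_le_dist (by simpa [lineBump] using hx)

theorem lineBump_eq_one {x : ℝ} (hx : |x| ≤ 1) : lineBump x = 1 :=
  lineBump.one_of_mem_closedBall (by simpa [lineBump] using hx)

theorem integrable_lineBump : Integrable lineBump :=
  lineBump.continuous.integrable_of_hasCompactSupport lineBump.hasCompactSupport

/-- The logarithmic average of the dilates of `lineBump` by the factors in `[1, R]`. -/
noncomputable def logBump (R x : ℝ) : ℝ := ∫ s in Ioc 1 R, s⁻¹ * lineBump (s * x)

variable {R : ℝ}

theorem dominatedFamily_logBump (R : ℝ) :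
    DominatedFamily (volume.restrict (Ioc 1 R)) (fun s x : ℝ => s⁻¹ * lineBump (s * x)) := by
  obtain ⟨M, hM⟩ := lineBump.hasCompactSupport.exists_derivBound contDiff_lineBump
  have hω := contDiff_lineBump
  have key : ∀ (k : ℕ) (s x : ℝ), iteratedFDeriv ℝ k (fun x : ℝ => s⁻¹ * lineBump (s * x)) x =
      s⁻¹ • s ^ k • iteratedFDeriv ℝ k lineBump (s • x) := fun k s x => by
    have h1 : ContDiff ℝ k lineBump := hω.of_le (by exact_mod_cast le_top)
    have h2 : ContDiffAt ℝ k (fun x : ℝ => lineBump (s • x)) x :=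
      (h1.comp (by fun_prop : ContDiff ℝ k fun x : ℝ => s • x)).contDiffAt
    change iteratedFDeriv ℝ k (s⁻¹ • fun x : ℝ => lineBump (s • x)) x = _
    rw [iteratedFDeriv_const_smul_apply h2, iteratedFDeriv_comp_const_smul s h1]
  refine ⟨fun s => by fun_prop, fun k x => ?_, fun k x₀ => ?_⟩
  · simp only [key]
    have h1 := hM.continuous_iteratedFDeriv k
    refine AEStronglyMeasurable.smul (f := fun s : ℝ => s⁻¹)
      measurable_inv.aestronglyMeasurable ?_
    exact (by fun_prop : Continuous fun s : ℝ =>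
      s ^ k • iteratedFDeriv ℝ k lineBump (s • x)).aestronglyMeasurable
  · refine ⟨fun _ => R ^ k * M k, integrable_const _, ?_⟩
    filter_upwards [ae_restrict_mem measurableSet_Ioc] with s hs x _
    have hs0 : 0 < s := one_pos.trans hs.1
    rw [key, norm_smul, norm_smul, norm_pow, Real.norm_of_nonneg hs0.le,
      Real.norm_of_nonneg (inv_pos.2 hs0).le]
    refine (mul_le_of_le_one_left (by positivity) (inv_le_one_of_one_le₀ hs.1.le)).trans ?_
    have hsR := hs.2
    exact mul_le_mul (pow_le_pow_left₀ hs0.le hsR k) (hM.le k _) (norm_nonneg _)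
      (pow_nonneg (hs0.le.trans hsR) k)

theorem contDiff_logBump (R : ℝ) : ContDiff ℝ ∞ (logBump R) :=
  (dominatedFamily_logBump R).contDiff_integral

theorem integrableOn_logBump_integrand (R x : ℝ) :
    IntegrableOn (fun s => s⁻¹ * lineBump (s * x)) (Ioc 1 R) := by
  have h : Integrable (fun _ : ℝ => (1 : ℝ)) (volume.restrict (Ioc 1 R)) := integrable_const _
  refine h.mono' ?_ ?_
  · have := lineBump.continuous.measurable
    exact (by fun_prop : Measurable fun s : ℝ => s⁻¹ * lineBump (s * x)).aestronglyMeasurable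
  · filter_upwards [ae_restrict_mem measurableSet_Ioc] with s hs
    have hs0 : 0 < s := one_pos.trans hs.1
    rw [norm_mul, Real.norm_of_nonneg (inv_pos.2 hs0).le, Real.norm_of_nonneg lineBump.nonneg]
    exact mul_le_one₀ (inv_le_one_of_one_le₀ hs.1.le) lineBump.nonneg lineBump.le_one

theorem logBump_nonneg (R x : ℝ) : 0 ≤ logBump R x := by
  refine setIntegral_nonneg measurableSet_Ioc fun s hs => ?_
  exact mul_nonneg (inv_nonneg.2 (one_pos.trans hs.1).le) lineBump.nonneg

theorem logBump_eq_zero {x : ℝ} (hx : 2 ≤ |x|) : logBump R x = 0 := by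
  refine setIntegral_eq_zero_of_forall_eq_zero fun s hs => ?_
  rw [lineBump_eq_zero, mul_zero]
  rw [abs_mul, abs_of_pos (one_pos.trans hs.1)]
  nlinarith [hs.1]

theorem logBump_eq_log (hR : 1 ≤ R) {x : ℝ} (hx : |x| ≤ R⁻¹) : logBump R x = Real.log R := by
  have hR0 : 0 < R := by linarith
  have : ∀ s ∈ Ioc 1 R, s⁻¹ * lineBump (s * x) = s⁻¹ := fun s hs => by
    rw [lineBump_eq_one, mul_one]
    rw [abs_mul, abs_of_pos (one_pos.trans hs.1)]
    calc s * |x| ≤ R * R⁻¹ := mul_le_mul hs.2 hx (abs_nonneg _) hR0.le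
      _ = 1 := mul_inv_cancel₀ hR0.ne'
  rw [logBump, setIntegral_congr_fun measurableSet_Ioc this,
    ← intervalIntegral.integral_of_le hR, integral_inv_of_pos one_pos hR0, div_one]

/-- Dilation by `s` divides the mass by `s`, and `∫₁^R s⁻² ds ≤ 1`. -/
theorem integral_logBump_le (R : ℝ) : ∫ x, logBump R x ≤ ∫ x, lineBump x := by
  have hslice : ∀ s ∈ Ioc 1 R, ∫ x, s⁻¹ * lineBump (s * x) = s⁻¹ * s⁻¹ * ∫ x, lineBump x := by
    intro s hs
    rw [integral_const_mul, Measure.integral_comp_mul_left, smul_eq_mul, mul_assoc,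
      abs_of_pos (inv_pos.2 (one_pos.trans hs.1))]
  have hI : 0 ≤ ∫ x, lineBump x := integral_nonneg fun _ => lineBump.nonneg
  have hint : Integrable (Function.uncurry fun (s x : ℝ) => s⁻¹ * lineBump (s * x))
      ((volume.restrict (Ioc 1 R)).prod volume) := by
    have hm : AEStronglyMeasurable (Function.uncurry fun (s x : ℝ) => s⁻¹ * lineBump (s * x))
        ((volume.restrict (Ioc 1 R)).prod volume) := by
      have := lineBump.continuous.measurable
      refine Measurable.aestronglyMeasurable ?_
      simp only [Function.uncurry_def]
      fun_prop
    rw [integrable_prod_iff hm]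
    constructor
    · filter_upwards [ae_restrict_mem measurableSet_Ioc] with s hs
      exact (integrable_lineBump.comp_mul_left' (one_pos.trans hs.1).ne').const_mul s⁻¹
    · refine (integrable_const (∫ x, lineBump x)).mono' hm.norm.integral_prod_right' ?_
      filter_upwards [ae_restrict_mem measurableSet_Ioc] with s hs
      have hs0 : 0 < s := one_pos.trans hs.1
      rw [Real.norm_of_nonneg (integral_nonneg fun _ => norm_nonneg _)]
      have : ∀ x, ‖s⁻¹ * lineBump (s * x)‖ = s⁻¹ * lineBump (s * x) := fun x =>
        Real.norm_of_nonneg (mul_nonneg (inv_pos.2 hs0).le lineBump.nonneg)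
      simp only [Function.uncurry_apply_pair, this, hslice s hs]
      refine mul_le_of_le_one_left hI ?_
      have := inv_le_one_of_one_le₀ hs.1.le
      exact mul_le_one₀ this (inv_pos.2 hs0).le this
  have hswap := integral_integral_swap hint
  simp only [logBump]
  rw [← hswap, setIntegral_congr_fun measurableSet_Ioc hslice, integral_mul_const]
  refine mul_le_of_le_one_left hI ?_
  have h2 := integral_Ioi_rpow_of_lt (a := -2) (by norm_num) one_pos
  have h3 := integrableOn_Ioi_rpow_of_lt (a := -2) (by norm_num) one_pos
  have h4 : ∀ s ∈ Ioc 1 R, s⁻¹ * s⁻¹ = s ^ (-2 : ℝ) := fun s hs => by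
    rw [Real.rpow_neg (one_pos.trans hs.1).le, Real.rpow_two, sq, mul_inv]
  rw [setIntegral_congr_fun measurableSet_Ioc h4]
  refine (setIntegral_mono_set h3 ?_ Ioc_subset_Ioi_self.eventuallyLE).trans (by rw [h2]; norm_num)
  filter_upwards [ae_restrict_mem measurableSet_Ioi] with s hs
  exact Real.rpow_nonneg (one_pos.trans hs).le _

/-- The half Laplacian is homogeneous of degree one, so each dilate contributes a factor `s` that
cancels the weight `s⁻¹`. -/
theorem halfLap_logBump (R x : ℝ) :
    halfLap (1 : ℝ) (logBump R) x = ∫ s in Ioc 1 R, halfLap (1 : ℝ) lineBump (s * x) := by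
  obtain ⟨M, hM⟩ := lineBump.hasCompactSupport.exists_derivBound contDiff_lineBump
  have hi := integrableOn_logBump_integrand R
  have hM0 := hM.nonneg 0
  have hM2 := hM.nonneg 2
  let D : ℝ → ℝ → ℝ := fun y s =>
    2 * lineBump (s * x) - lineBump (s * (x + y)) - lineBump (s * (x - y))
  have e1 : ∀ y : ℝ, (y ^ 2)⁻¹ * (2 * logBump R x - logBump R (x + y) - logBump R (x - y)) =
      ∫ s in Ioc 1 R, (y ^ 2)⁻¹ * (s⁻¹ * D y s) := by
    intro y
    have hi2 : IntegrableOn (fun s => 2 * (s⁻¹ * lineBump (s * x)) -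
        s⁻¹ * lineBump (s * (x + y))) (Ioc 1 R) := ((hi x).const_mul 2).sub (hi (x + y))
    simp only [logBump]
    rw [← integral_const_mul, ← integral_sub ((hi x).const_mul 2) (hi (x + y)),
      ← integral_sub hi2 (hi (x - y)), ← integral_const_mul]
    congr 1
    ext1 s
    simp only [D]
    ring
  have hint : Integrable (Function.uncurry fun (y s : ℝ) => (y ^ 2)⁻¹ * (s⁻¹ * D y s))
      ((volume : Measure ℝ).prod (volume.restrict (Ioc 1 R))) := by
    have hb := (integrable_inv_one_add_sq.const_mul (2 * (4 * M 0 + 2 * M 2 * R ^ 2))).mul_prod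
      (integrable_const (μ := volume.restrict (Ioc 1 R)) (1 : ℝ))
    refine hb.mono' ?_ ?_
    · have := lineBump.continuous.measurable
      refine Measurable.aestronglyMeasurable ?_
      simp only [D, Function.uncurry_def]
      fun_prop
    · have hmem : ∀ᵐ p ∂((volume : Measure ℝ).prod (volume.restrict (Ioc 1 R))),
          p.2 ∈ Ioc 1 R := by
        have := Measure.quasiMeasurePreserving_snd
          (μ := (volume : Measure ℝ)) (ν := volume.restrict (Ioc 1 R))
        exact this.ae (ae_restrict_mem measurableSet_Ioc)
      filter_upwards [hmem] with p hp
      obtain ⟨y, s⟩ := p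
      simp only [Function.uncurry_apply_pair, mul_one] at hp ⊢
      have hs0 : 0 < s := one_pos.trans hp.1
      rw [norm_mul, norm_mul, Real.norm_of_nonneg (inv_pos.2 hs0).le,
        Real.norm_of_nonneg (by positivity : 0 ≤ (y ^ 2)⁻¹)]
      have h1 := hM.norm_secondDiff_le_four 0 (s * x) (s * y)
      have h2 := hM.norm_secondDiff_le 0 (s * x) (s * y)
      simp only [iteratedFDeriv_zero_eq_comp, Function.comp_apply, zero_add] at h1 h2
      rw [← map_smul, ← map_sub, ← map_sub, LinearIsometryEquiv.norm_map] at h1 h2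
      rw [Real.norm_eq_abs (s * y), sq_abs, mul_pow] at h2
      rw [smul_eq_mul, ← mul_add, ← mul_sub] at h1 h2
      refine (mul_le_mul_of_nonneg_left (mul_le_of_le_one_left (norm_nonneg _)
        (inv_le_one_of_one_le₀ hp.1.le)) (by positivity)).trans ?_
      refine inv_sq_mul_le (by positivity) (by positivity) h1 (h2.trans ?_)
      have : s ^ 2 ≤ R ^ 2 := by have := hp.2; gcongr
      have h3 : 0 ≤ 2 * M 2 * y ^ 2 := by positivity
      nlinarith
  simp only [halfLap, smul_eq_mul, mul_one]
  simp only [e1]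
  rw [integral_integral_swap hint, ← integral_const_mul]
  refine setIntegral_congr_fun measurableSet_Ioc fun s hs => ?_
  have hs0 : 0 < s := one_pos.trans hs.1
  have h := integral_secondDiff_comp_mul lineBump hs0 x
  congr 1
  have e2 : ∀ y : ℝ, (y ^ 2)⁻¹ * (s⁻¹ * D y s) = s⁻¹ * ((y ^ 2)⁻¹ * D y s) := fun y => by ring
  simp only [e2]
  rw [integral_const_mul]
  simp only [D]
  rw [h, inv_mul_cancel_left₀ hs0.ne']

/-- Both terms of `abs_integral_dilates_le` are `L¹`-normalised dilates of `2C (1 + x²)⁻¹`, of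
integral `2Cπ` each. -/
theorem exists_integral_abs_halfLap_logBump_le :
    ∃ C, ∀ R, 1 ≤ R → ∫ x, |halfLap (1 : ℝ) (logBump R) x| ≤ C := by
  obtain ⟨C, hC⟩ := exists_halfLap_decay contDiff_lineBump lineBump.hasCompactSupport 0
  obtain ⟨M, hM⟩ := lineBump.hasCompactSupport.exists_derivBound contDiff_lineBump
  simp only [norm_iteratedFDeriv_zero, Real.norm_eq_abs] at hC
  have hcont : Continuous (halfLap (1 : ℝ) lineBump) := (hM.halfLap (by simp)).contDiff.continuous
  have hbound := fun R (hR : 1 ≤ R) => abs_integral_dilates_le (R := R) hcont hC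
    (halfLap_neg_arg lineBump_neg)
    (integral_halfLap_eq_zero contDiff_lineBump lineBump.hasCompactSupport) hR
  refine ⟨4 * C * Real.pi, fun R hR => ?_⟩
  have hR0 : 0 < R := by linarith
  have i1 := integrable_inv_one_add_sq.const_mul (2 * C)
  have i2 := ((integrable_inv_one_add_sq.comp_mul_left' hR0.ne').const_mul R).const_mul (2 * C)
  have e : ∀ x, halfLap (1 : ℝ) (logBump R) x =
      ∫ s in (1 : ℝ)..R, halfLap (1 : ℝ) lineBump (s * x) := fun x => by
    rw [halfLap_logBump, intervalIntegral.integral_of_le hR]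
  calc ∫ x, |halfLap (1 : ℝ) (logBump R) x|
      ≤ ∫ x, (2 * C * (1 + x ^ 2)⁻¹ + 2 * C * (R * (1 + (R * x) ^ 2)⁻¹)) := by
        refine integral_mono_of_nonneg (.of_forall fun x => abs_nonneg _) (i1.add i2)
          (.of_forall fun x => ?_)
        simp only [e]
        exact hbound R hR x
    _ = 4 * C * Real.pi := by
        rw [integral_add i1 i2, integral_const_mul, integral_const_mul, integral_const_mul,
          Measure.integral_comp_mul_left (fun x => (1 + x ^ 2)⁻¹), integral_univ_inv_one_add_sq,
          smul_eq_mul, abs_of_pos (inv_pos.2 hR0), mul_inv_cancel_left₀ hR0.ne']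
        ring

theorem halfLap_const_mul (c : ℝ) (V : ℝ → ℝ) (x : ℝ) :
    halfLap (1 : ℝ) (fun x => c * V x) x = c * halfLap (1 : ℝ) V x := by
  simp only [halfLap, smul_eq_mul]
  rw [mul_left_comm c, ← integral_const_mul c]
  congr 2
  ext1 y
  ring

/-- Points of the line have vanishing capacity for `(-Δ)^{1/2}` and `L¹`. -/
theorem exists_capacitary_function {ε : ℝ} (hε : 0 < ε) :
    ∃ V : ℝ → ℝ, ContDiff ℝ ∞ V ∧ (∀ x, 2 ≤ |x| → V x = 0) ∧ V =ᶠ[𝓝 0] (fun _ => 1) ∧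
      ∫ x, |V x| ≤ ε ∧ ∫ x, |halfLap (1 : ℝ) V x| ≤ ε := by
  obtain ⟨C, hC⟩ := exists_integral_abs_halfLap_logBump_le
  set I := ∫ x, lineBump x with hI
  -- Both `L¹` norms stay bounded in `R`, and the height near the origin is `log R`; normalising the
  -- height to one divides the norms by `log R`.
  have hlim := Real.tendsto_log_atTop.eventually_ge_atTop (max C I / ε)
  obtain ⟨R, hR1, hR2⟩ := (hlim.and (Filter.eventually_gt_atTop 1)).exists
  have hR0 : 0 < R := by linarith
  have hlog : 0 < Real.log R := Real.log_pos hR2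
  have hmax : max C I ≤ ε * Real.log R := by rwa [div_le_iff₀' hε] at hR1
  refine ⟨fun x => (Real.log R)⁻¹ * logBump R x, contDiff_const.mul (contDiff_logBump R),
    fun x hx => mul_eq_zero_of_right _ (logBump_eq_zero hx), ?_, ?_, ?_⟩
  · filter_upwards [Metric.closedBall_mem_nhds (0 : ℝ) (inv_pos.2 hR0)] with x hx
    rw [mem_closedBall_zero_iff, Real.norm_eq_abs] at hx
    rw [logBump_eq_log hR2.le hx, inv_mul_cancel₀ hlog.ne']
  · have : ∀ x, |(Real.log R)⁻¹ * logBump R x| = (Real.log R)⁻¹ * logBump R x := fun x =>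
      abs_of_nonneg (mul_nonneg (inv_pos.2 hlog).le (logBump_nonneg R x))
    simp only [this]
    rw [integral_const_mul, inv_mul_le_iff₀ hlog, mul_comm]
    exact ((integral_logBump_le R).trans (le_max_right _ _)).trans hmax
  · simp only [halfLap_const_mul, abs_mul, abs_of_pos (inv_pos.2 hlog)]
    rw [integral_const_mul, inv_mul_le_iff₀ hlog, mul_comm]
    exact ((hC R hR2.le).trans (le_max_left _ _)).trans hmax

end CapacitaryFunctions

end CaloricCapacity

namespace CaloricCapacity

/-! ### Truncation of functions with quadratic decay. -/

section Cutoff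

variable {E F : Type*} [NormedAddCommGroup E] [NormedSpace ℝ E] [NormedAddCommGroup F]
  [NormedSpace ℝ F] {Φ Ψ : E → F} {M N : ℕ → ℝ}

theorem DerivBound.const (c : F) : DerivBound (fun _ : E => c) (fun _ => ‖c‖) where
  contDiff := contDiff_const
  le k q := by
    cases k with
    | zero => simp
    | succ k => rw [iteratedFDeriv_succ_const]; simp

theorem DerivBound.sub (hΦ : DerivBound Φ M) (hΨ : DerivBound Ψ N) :
    DerivBound (Φ - Ψ) (fun k => M k + N k) where
  contDiff := hΦ.contDiff.sub hΨ.contDiff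
  le k q := by
    rw [iteratedFDeriv_sub_apply (hΦ.contDiff.of_le (by exact_mod_cast le_top)).contDiffAt
      (hΨ.contDiff.of_le (by exact_mod_cast le_top)).contDiffAt]
    exact (_root_.norm_sub_le _ _).trans (add_le_add (hΦ.le k q) (hΨ.le k q))

theorem DerivBound.halfLap_sub (hΦ : DerivBound Φ M) (hΨ : DerivBound Ψ N) {e : E} (he : ‖e‖ ≤ 1)
    (q : E) :
    CaloricCapacity.halfLap e (Φ - Ψ) q =
      CaloricCapacity.halfLap e Φ q - CaloricCapacity.halfLap e Ψ q := by
  have key : ∀ {Φ : E → F} {M : ℕ → ℝ}, DerivBound Φ M → Integrable fun y : ℝ =>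
      (y ^ 2)⁻¹ • ((2 : ℝ) • Φ q - Φ (q + y • e) - Φ (q - y • e)) := fun {Φ M} h => by
    have h1 := (h.dominatedFamily_secondDiff he).integrable 0 q
    rw [← integrable_norm_iff h1.aestronglyMeasurable] at h1
    simp only [norm_iteratedFDeriv_zero] at h1
    refine (integrable_norm_iff ?_).1 h1
    have := h.contDiff.continuous
    refine AEStronglyMeasurable.smul (f := fun y : ℝ => (y ^ 2)⁻¹) ?_ ?_
    · exact (by fun_prop : Measurable fun y : ℝ => (y ^ 2)⁻¹).aestronglyMeasurable
    · exact (by fun_prop : Continuous _).aestronglyMeasurable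
  simp only [CaloricCapacity.halfLap]
  rw [← smul_sub, ← integral_sub (key hΦ) (key hΨ)]
  congr 2
  ext1 y
  simp only [Pi.sub_apply, ← smul_sub]
  congr 1
  module

/-- A smooth function whose derivatives are `O(|x|⁻²)` is the limit of its truncations. -/
theorem exists_derivBound_truncation {ψ : ℝ → ℝ} (hψ : ContDiff ℝ ∞ ψ)
    (hdecay : ∀ k : ℕ, ∃ C, ∀ x, ‖iteratedFDeriv ℝ k ψ x‖ ≤ C * (1 + x ^ 2)⁻¹) :
    ∃ A : ℕ → ℝ, ∀ R, 1 ≤ R →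
      DerivBound (fun x => ψ x * (1 - lineBump (R⁻¹ * x))) (fun k => A k * R⁻¹) := by
  choose C hC using hdecay
  have hC0 : ∀ k, 0 ≤ C k := fun k => by
    have := (norm_nonneg _).trans (hC k 0)
    simpa using this
  obtain ⟨M, hM⟩ := lineBump.hasCompactSupport.exists_derivBound contDiff_lineBump
  have hη := (DerivBound.const (E := ℝ) (1 : ℝ)).sub hM
  refine ⟨fun k => ∑ i ∈ Finset.range (k + 1), (k.choose i : ℝ) * C i * (‖(1 : ℝ)‖ + M (k - i)),
    fun R hR => ?_⟩
  have hR0 : 0 < R := by linarith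
  have hg : ‖R⁻¹ • ContinuousLinearMap.id ℝ ℝ‖ ≤ 1 := by
    rw [norm_smul, ContinuousLinearMap.norm_id, mul_one, Real.norm_of_nonneg (inv_pos.2 hR0).le]
    exact inv_le_one_of_one_le₀ hR
  have hηR : DerivBound (fun x => 1 - lineBump (R⁻¹ * x)) _ := hη.comp_clm hg
  refine ⟨hψ.mul hηR.contDiff, fun k x => ?_⟩
  -- Inside `|x| < R` the remainder is identically zero; outside, `(1 + x²)⁻¹ ≤ R⁻¹`.
  rcases lt_or_ge |x| R with hx | hx
  · have h0 : (fun x => ψ x * (1 - lineBump (R⁻¹ * x))) =ᶠ[𝓝 x] fun _ => 0 := by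
      have ho : IsOpen {x : ℝ | |x| < R} := isOpen_lt continuous_abs continuous_const
      filter_upwards [ho.mem_nhds hx] with z hz
      have hz' : |z| < R := hz
      rw [lineBump_eq_one, sub_self, mul_zero]
      rw [abs_mul, abs_of_pos (inv_pos.2 hR0), inv_mul_le_iff₀ hR0]
      linarith
    rw [(h0.iteratedFDeriv ℝ k).self_of_nhds, iteratedFDeriv_fun_zero, Pi.zero_apply, norm_zero]
    refine mul_nonneg (Finset.sum_nonneg fun i _ => ?_) (inv_pos.2 hR0).le
    have := hC0 i
    have := hM.nonneg (k - i)
    positivity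
  · refine (norm_iteratedFDeriv_mul_le hψ hηR.contDiff x (n := k)
      (by exact_mod_cast le_top)).trans ?_
    rw [Finset.sum_mul]
    refine Finset.sum_le_sum fun i _ => ?_
    have h1 : (1 + x ^ 2)⁻¹ ≤ R⁻¹ := by
      refine inv_anti₀ hR0 ?_
      have : R ^ 2 ≤ x ^ 2 := by rw [← sq_abs x]; gcongr
      nlinarith
    have h2 := (hC i x).trans (mul_le_mul_of_nonneg_left h1 (hC0 i))
    calc (k.choose i : ℝ) * ‖iteratedFDeriv ℝ i ψ x‖ * _
        ≤ (k.choose i : ℝ) * (C i * R⁻¹) * (‖(1 : ℝ)‖ + M (k - i)) := by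
          have := hC0 i
          gcongr
          exact hηR.le _ x
      _ = _ := by ring

end Cutoff

/-! ### Consequences of the `L^∞` bound on `(-Δₓ)^{1/2}(W ∗ T)`. -/

section Upper

variable {T : 𝓓'((⊤ : Opens (ℝ × ℝ)), ℝ)} {a b : ℝ}

/-- If `(-Δₓ)^{1/2}(W ∗ T)` is bounded by one then `⟨T, Wᵗ ∗ (χ ⊗ (-Δ)^{1/2}ψ)⟩` is bounded by
the `L¹` norm of `χ ⊗ ψ`, for functions `ψ` that decay quadratically. -/
theorem abs_pairing_heatTranspose_le (hT : dsupport T ⊆ verticalSegment)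
    (hsp : LInftyNormLeOne (halfLaplacianPotential T)) (hab : a ≤ b) {χ : ℝ → ℝ}
    (hχ : ContDiff ℝ ∞ χ) (hχs : ∀ t ∉ Icc a b, χ t = 0) {ψ : ℝ → ℝ} (hψ : ContDiff ℝ ∞ ψ)
    (hdecay : ∀ k : ℕ, ∃ C, ∀ x, ‖iteratedFDeriv ℝ k ψ x‖ ≤ C * (1 + x ^ 2)⁻¹) :
    |pairing T (heatTranspose fun p => χ p.2 * halfLap (1 : ℝ) ψ p.1)| ≤
      (∫ t, |χ t|) * ∫ x, |ψ x| := by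
  obtain ⟨g, ⟨-, hg⟩, hg1⟩ := hsp
  have hχc : HasCompactSupport χ := HasCompactSupport.intro isCompact_Icc hχs
  obtain ⟨B, hB⟩ := hχc.exists_derivBound hχ
  obtain ⟨A, hA⟩ := exists_derivBound_truncation hψ hdecay
  obtain ⟨C, N, hC0, hC⟩ := exists_pairing_bound hT
  have he : ‖(1 : ℝ)‖ ≤ 1 := by simp
  have hψb : ∃ P, DerivBound ψ P := by
    choose C hC using hdecay
    refine ⟨C, hψ, fun k x => (hC k x).trans (mul_le_of_le_one_right ?_ ?_)⟩
    · simpa using (norm_nonneg _).trans (hC k 0)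
    · exact inv_le_one_of_one_le₀ (by nlinarith [sq_nonneg x])
  obtain ⟨P, hP⟩ := hψb
  have hψi : Integrable ψ := by
    obtain ⟨C, hC⟩ := hdecay 0
    refine (integrable_inv_one_add_sq.const_mul C).mono' hψ.continuous.aestronglyMeasurable
      (.of_forall fun x => ?_)
    simpa using hC x
  have hχi : Integrable χ := hχ.continuous.integrable_of_hasCompactSupport hχc
  let K : ℕ → ℝ := fun k => (∑ i ∈ Finset.range (k + 1), (k.choose i : ℝ) * B i *
    (4 * A (k - i) + 2 * A (k - i + 2))) * (b - a)
  have hts : ∀ θ : ℝ → ℝ, TimeSupp a b (fun p : ℝ × ℝ => χ p.2 * θ p.1) := fun θ p hp =>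
    mul_eq_zero_of_left (hχs _ hp) _
  -- The hypothesis speaks of test functions only, so `ψ` is truncated at scale `R`. The remainder
  -- `h` has all derivatives `O(R⁻¹)`, and the finite order of `T` makes its contribution `O(R⁻¹)`
  -- as well.
  have main : ∀ R, 1 ≤ R → |pairing T (heatTranspose fun p => χ p.2 * halfLap (1 : ℝ) ψ p.1)| ≤
      (∫ t, |χ t|) * (∫ x, |ψ x|) + C * (∑ k ∈ Finset.range (N + 1), |K k|) * R⁻¹ := by
    intro R hR
    have hR0 : 0 < R := by linarith
    have hη : ContDiff ℝ ∞ fun x : ℝ => lineBump (R⁻¹ * x) :=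
      contDiff_lineBump.comp (contDiff_const.mul contDiff_id)
    let φ : 𝓓((⊤ : Opens (ℝ × ℝ)), ℝ) :=
      { toFun := fun p => χ p.2 * (ψ p.1 * lineBump (R⁻¹ * p.1))
        contDiff' := (hχ.comp contDiff_snd).mul ((hψ.mul hη).comp contDiff_fst)
        hasCompactSupport' := by
          refine HasCompactSupport.intro (K := Icc (-(2 * R)) (2 * R) ×ˢ Icc a b)
            (isCompact_Icc.prod isCompact_Icc) fun p hp => ?_
          by_cases h2 : p.2 ∈ Icc a b
          · have h1 : p.1 ∉ Icc (-(2 * R)) (2 * R) := fun h1 => hp ⟨h1, h2⟩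
            rw [lineBump_eq_zero, mul_zero, mul_zero]
            rw [abs_mul, abs_of_pos (inv_pos.2 hR0), le_inv_mul_iff₀ hR0, mul_comm]
            by_contra h
            exact h1 (abs_le.1 (not_le.1 h).le)
          · rw [hχs _ h2, zero_mul]
        tsupport_subset' := fun _ _ => trivial }
    set h : ℝ → ℝ := fun x => ψ x * (1 - lineBump (R⁻¹ * x)) with hh
    have hL := hP.halfLap he
    have hLh := (hA R hR).halfLap he
    have e1 : halfLaplacian φ = (fun p : ℝ × ℝ => χ p.2 * halfLap (1 : ℝ) ψ p.1) -
        fun p => χ p.2 * halfLap (1 : ℝ) h p.1 := by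
      have e0 : (φ : ℝ × ℝ → ℝ) = fun p => χ p.2 * (ψ - h) p.1 := by
        ext p
        change χ p.2 * (ψ p.1 * lineBump (R⁻¹ * p.1)) = χ p.2 * (ψ p.1 - h p.1)
        rw [hh]
        ring
      rw [e0, halfLaplacian_tensor]
      ext p
      rw [hP.halfLap_sub (hA R hR) he]
      simp only [Pi.sub_apply]
      ring
    have t1 := hB.tensor hL
    have t2 := hB.tensor hLh
    have H1 := t1.heatTranspose hab (hts _)
    have H2 := t2.heatTranspose hab (hts _)
    have e2 : heatTranspose (fun p => χ p.2 * halfLap (1 : ℝ) ψ p.1) =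
        heatTranspose (halfLaplacian φ) + heatTranspose fun p => χ p.2 * halfLap (1 : ℝ) h p.1 := by
      ext q
      have i1 := integrable_heatKernel_mul t1.contDiff.continuous (hts _) t1.norm_le q
      have i2 := integrable_heatKernel_mul t2.contDiff.continuous (hts _) t2.norm_le q
      rw [e1, Pi.add_apply, heatTranspose_eq, heatTranspose_eq, heatTranspose_eq, ← sub_eq_iff_eq_add,
        ← integral_sub i1 i2]
      congr 1
      ext p
      simp only [Pi.sub_apply]
      ring
    have hsm : ContDiff ℝ ∞ (heatTranspose (halfLaplacian φ)) := by
      rw [eq_sub_of_add_eq e2.symm]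
      exact H1.contDiff.sub H2.contDiff
    rw [e2, pairing_add hT hsm H2.contDiff]
    refine (abs_add_le _ _).trans (add_le_add ?_ ?_)
    · have h1 : pairing T (heatTranspose (halfLaplacian φ)) = ∫ p, g p * φ p := hg φ
      have hgle : ∀ᵐ p, ‖g p‖ ≤ 1 := by
        filter_upwards [ae_le_eLpNormEssSup (f := g) (μ := volume)] with p hp
        rw [eLpNorm_exponent_top] at hg1
        have := hp.trans hg1
        rw [← ofReal_norm, ENNReal.ofReal_le_one] at this
        exact this
      have hprod : Integrable fun p : ℝ × ℝ => |ψ p.1| * |χ p.2| := by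
        rw [Measure.volume_eq_prod]
        exact hψi.abs.mul_prod hχi.abs
      rw [h1, ← Real.norm_eq_abs]
      refine (norm_integral_le_of_norm_le hprod ?_).trans (le_of_eq ?_)
      · filter_upwards [hgle] with p hp
        change ‖g p * (χ p.2 * (ψ p.1 * lineBump (R⁻¹ * p.1)))‖ ≤ _
        rw [norm_mul, norm_mul, norm_mul, Real.norm_of_nonneg lineBump.nonneg, Real.norm_eq_abs (χ _),
          Real.norm_eq_abs (ψ _)]
        refine (mul_le_of_le_one_left (by have := lineBump.nonneg (x := R⁻¹ * p.1); positivity)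
          hp).trans ?_
        rw [mul_comm |ψ p.1| |χ p.2|]
        exact mul_le_mul_of_nonneg_left (mul_le_of_le_one_right (abs_nonneg _) lineBump.le_one)
          (abs_nonneg _)
      · rw [Measure.volume_eq_prod, integral_prod_mul (fun x => |ψ x|) fun t => |χ t|, mul_comm]
    · have := hC _ _ ((∑ k ∈ Finset.range (N + 1), |K k|) * R⁻¹) H2 (fun k hk => ?_)
      · rwa [← mul_assoc] at this
      · have e3 : (∑ i ∈ Finset.range (k + 1), (k.choose i : ℝ) * B i *
            (4 * (A (k - i) * R⁻¹) + 2 * (A (k - i + 2) * R⁻¹))) * (b - a) = K k * R⁻¹ := by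
          simp only [K]
          rw [mul_right_comm _ (b - a), Finset.sum_mul _ _ R⁻¹]
          congr 1
          refine Finset.sum_congr rfl fun i _ => ?_
          ring
        refine e3.le.trans ?_
        refine mul_le_mul_of_nonneg_right ((le_abs_self _).trans ?_) (inv_pos.2 hR0).le
        exact Finset.single_le_sum (f := fun k => |K k|) (fun k _ => abs_nonneg _)
          (Finset.mem_range.2 (by omega))
  have hlim := (tendsto_inv_atTop_zero (𝕜 := ℝ)).const_mul
    (C * ∑ k ∈ Finset.range (N + 1), |K k|)
  have hlim2 := hlim.const_add ((∫ t, |χ t|) * ∫ x, |ψ x|)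
  rw [mul_zero, add_zero] at hlim2
  refine ge_of_tendsto hlim2 ?_
  filter_upwards [Filter.eventually_ge_atTop 1] with R hR using main R hR

end Upper

end CaloricCapacity

namespace CaloricCapacity

/-! ### Sources separated in time from the segment. -/

section SmoothKernel

theorem contDiffAt_heatKernel {p : ℝ × ℝ} (hp : 0 < p.2) : ContDiffAt ℝ ∞ heatKernel p := by
  have ho : IsOpen {p : ℝ × ℝ | 0 < p.2} := isOpen_lt continuous_const continuous_snd
  have h1 : heatKernel =ᶠ[𝓝 p] fun p => (Real.sqrt (4 * Real.pi * p.2))⁻¹ *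
      Real.exp (-p.1 ^ 2 / (4 * p.2)) := by
    filter_upwards [ho.mem_nhds hp] with x hx using heatKernel_of_pos hx
  refine ContDiffAt.congr_of_eventuallyEq ?_ h1
  have h2 : 4 * Real.pi * p.2 ≠ 0 := by positivity
  have h3 : ContDiffAt ℝ ∞ (fun p : ℝ × ℝ => 4 * Real.pi * p.2) p := by fun_prop
  have h4 : ContDiffAt ℝ ∞ (fun p : ℝ × ℝ => -p.1 ^ 2 / (4 * p.2)) p :=
    ContDiffAt.div (by fun_prop) (by fun_prop) (by positivity)
  exact ((h3.sqrt h2).inv (Real.sqrt_pos.2 (by positivity)).ne').mul h4.exp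

/-- Away from its singularity the heat kernel agrees with a compactly supported smooth function. -/
theorem exists_smooth_heatKernel : ∃ G : ℝ × ℝ → ℝ, ContDiff ℝ ∞ G ∧ HasCompactSupport G ∧
    (∀ p : ℝ × ℝ, |p.1| ≤ 4 → p.2 ∈ Icc 1 6 → G p = heatKernel p) ∧
    ∀ p : ℝ × ℝ, p.2 ≤ 0 → G p = 0 := by
  -- For `q` in the ball of radius `2` and a source point `p` with `|p.1| < 2`, `3 < |p.2| < 4`, the
  -- difference `p - q` has space part below `4` in modulus, and time part in `[1, 6]` or negative.
  -- The cutoff `β` is one on `[1, 6]` and vanishes before time `1/2`.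
  let α : ContDiffBump (0 : ℝ) := ⟨4, 5, by norm_num, by norm_num⟩
  let β : ContDiffBump (7 / 2 : ℝ) := ⟨5 / 2, 3, by norm_num, by norm_num⟩
  have hα : ContDiff ℝ ∞ α := α.contDiff
  have hβ : ContDiff ℝ ∞ β := β.contDiff
  have hβ0 : ∀ t : ℝ, t ≤ 1 / 2 → β t = 0 := fun t ht => β.zero_of_le_dist (by
    change 3 ≤ dist t (7 / 2)
    rw [Real.dist_eq, abs_of_nonpos (by linarith)]
    linarith)
  refine ⟨fun p => α p.1 * β p.2 * heatKernel p, ?_, ?_, fun p h1 h2 => ?_,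
    fun p hp => mul_eq_zero_of_left (mul_eq_zero_of_right _ (hβ0 _ (by linarith))) _⟩
  · rw [contDiff_iff_contDiffAt]
    intro p
    rcases lt_or_ge p.2 (1 / 2) with h | h
    · have ho : IsOpen {p : ℝ × ℝ | p.2 < 1 / 2} := isOpen_lt continuous_snd continuous_const
      refine (contDiffAt_const (c := (0 : ℝ))).congr_of_eventuallyEq ?_
      filter_upwards [ho.mem_nhds h] with x hx
      have hx' : x.2 < 1 / 2 := hx
      rw [hβ0 _ hx'.le, mul_zero, zero_mul]
    · exact ((hα.comp contDiff_fst).mul (hβ.comp contDiff_snd)).contDiffAt.mul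
        (contDiffAt_heatKernel (by linarith))
  · refine HasCompactSupport.intro (K := Metric.closedBall 0 5 ×ˢ Metric.closedBall (7 / 2) 3)
      ((isCompact_closedBall _ _).prod (isCompact_closedBall _ _)) fun p hp => ?_
    by_cases h1 : p.1 ∈ Metric.closedBall 0 5
    · have h2 : p.2 ∉ Metric.closedBall (7 / 2) 3 := fun h2 => hp ⟨h1, h2⟩
      rw [β.zero_of_le_dist (not_le.1 h2).le, mul_zero, zero_mul]
    · rw [α.zero_of_le_dist (not_le.1 h1).le, zero_mul, zero_mul]
  · have e1 : α p.1 = 1 := α.one_of_mem_closedBall (by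
      change dist p.1 0 ≤ 4
      rwa [dist_zero_right, Real.norm_eq_abs])
    have e2 : β p.2 = 1 := β.one_of_mem_closedBall (by
      change dist p.2 (7 / 2) ≤ 5 / 2
      rw [Real.dist_eq, abs_le]
      constructor <;> linarith [h2.1, h2.2])
    simp only [e1, e2, one_mul]

variable {E : Type*} [NormedAddCommGroup E] [NormedSpace ℝ E] [MeasurableSpace E] [BorelSpace E]
  [SecondCountableTopology E] {μ : Measure E}

theorem DerivBound.integral_smul_comp_sub {Φ : E → ℝ} {M : ℕ → ℝ} (h : DerivBound Φ M) {ψ : E → ℝ}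
    (hψ : Integrable ψ μ) :
    DerivBound (fun q => ∫ p, ψ p * Φ (q - p) ∂μ) (fun k => M k * ∫ p, |ψ p| ∂μ) := by
  have key : ∀ (k : ℕ) (p q : E), iteratedFDeriv ℝ k (fun q => ψ p * Φ (q - p)) q =
      ψ p • iteratedFDeriv ℝ k Φ (q - p) := fun k p q => by
    have h1 : ContDiff ℝ k Φ := h.contDiff.of_le (by exact_mod_cast le_top)
    have h2 : ContDiffAt ℝ k (fun q => Φ (q - p)) q :=
      (h1.comp (contDiff_id.sub contDiff_const)).contDiffAt
    change iteratedFDeriv ℝ k (ψ p • fun q => Φ (q - p)) q = _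
    rw [iteratedFDeriv_const_smul_apply h2, iteratedFDeriv_comp_sub]
  have hle : ∀ (k : ℕ) (p q : E), ‖ψ p • iteratedFDeriv ℝ k Φ (q - p)‖ ≤ M k * |ψ p| :=
    fun k p q => by
      rw [norm_smul, mul_comm, Real.norm_eq_abs]
      exact mul_le_mul_of_nonneg_right (h.le k _) (abs_nonneg _)
  have hd : DominatedFamily μ (fun p q => ψ p * Φ (q - p)) := by
    refine ⟨fun p => ?_, fun k q => ?_, fun k q₀ => ⟨fun p => M k * |ψ p|, hψ.abs.const_mul _, ?_⟩⟩
    · have := h.contDiff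
      fun_prop
    · simp only [key]
      have := h.continuous_iteratedFDeriv k
      exact hψ.aestronglyMeasurable.smul
        (by fun_prop : Continuous fun p => iteratedFDeriv ℝ k Φ (q - p)).aestronglyMeasurable
    · refine .of_forall fun p q _ => ?_
      rw [key]
      exact hle k p q
  refine ⟨hd.contDiff_integral, fun k q => ?_⟩
  rw [hd.iteratedFDeriv_integral]
  simp only [key]
  refine (norm_integral_le_of_norm_le (hψ.abs.const_mul (M k)) (.of_forall (hle k · q))).trans ?_
  rw [integral_const_mul]

/-- Heat potentials of sources far from the segment are smooth near the segment, with derivatives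
controlled by the `L¹` norm of the source. -/
theorem exists_pairing_heatTranspose_le {T : 𝓓'((⊤ : Opens (ℝ × ℝ)), ℝ)}
    (hT : dsupport T ⊆ verticalSegment) :
    ∃ C, ∀ G : ℝ × ℝ → ℝ, Integrable G → (∀ p, 2 ≤ |p.1| → G p = 0) →
      (∀ p, |p.2| ≤ 3 → G p = 0) → (∀ p, 4 ≤ |p.2| → G p = 0) →
      |pairing T (heatTranspose G)| ≤ C * ∫ p, |G p| := by
  obtain ⟨W, hW, hWc, hWeq, hW0⟩ := exists_smooth_heatKernel
  have hn : ContDiff ℝ ∞ fun p : ℝ × ℝ => W (-p) := hW.comp contDiff_neg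
  obtain ⟨M, hM⟩ := (hWc.comp_homeomorph (Homeomorph.neg (ℝ × ℝ))).exists_derivBound hn
  obtain ⟨C, N, hC0, hC⟩ := exists_pairing_bound hT
  refine ⟨C * ∑ k ∈ Finset.range (N + 1), M k, fun G hG h1 h2 h3 => ?_⟩
  have hb := hM.integral_smul_comp_sub hG
  -- On a neighbourhood of the segment the smooth kernel replaces the heat kernel exactly; source
  -- points in the past contribute zero to both.
  have heq : (fun q => ∫ p, G p * ((W ∘ Homeomorph.neg (ℝ × ℝ)) (q - p)))
      =ᶠ[𝓝ˢ (dsupport T)] heatTranspose G := by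
    have h : Metric.ball (0 : ℝ × ℝ) 2 ∈ 𝓝ˢ (dsupport T) :=
      Metric.isOpen_ball.mem_nhdsSet.2 (hT.trans verticalSegment_subset_ball)
    filter_upwards [h] with q hq
    rw [mem_ball_zero_iff, Prod.norm_def, max_lt_iff, Real.norm_eq_abs, Real.norm_eq_abs, abs_lt,
      abs_lt] at hq
    refine integral_congr_ae (.of_forall fun p => ?_)
    change G p * W (-(q - p)) = heatKernel (p - q) * G p
    rw [neg_sub, mul_comm]
    by_cases hp1 : 2 ≤ |p.1|
    · rw [h1 p hp1, mul_zero, mul_zero]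
    by_cases hp3 : 4 ≤ |p.2|
    · rw [h3 p hp3, mul_zero, mul_zero]
    by_cases hp2 : |p.2| ≤ 3
    · rw [h2 p hp2, mul_zero, mul_zero]
    rw [not_le, abs_lt] at hp1 hp3
    rw [not_le, lt_abs] at hp2
    rcases hp2 with hp2 | hp2
    · rw [hWeq (p - q)]
      · rw [Prod.fst_sub, abs_le]
        constructor <;> linarith [hp1.1, hp1.2, hq.1.1, hq.1.2]
      · rw [Prod.snd_sub]
        constructor <;> linarith [hp3.1, hp3.2, hq.2.1, hq.2.2]
    · have : (p - q).2 ≤ 0 := by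
        rw [Prod.snd_sub]
        linarith [hq.2.1]
      rw [hW0 _ this, heatKernel_of_nonpos this]
  rw [pairing_congr hT hb.contDiff heq, mul_assoc, Finset.sum_mul]
  refine hC _ _ _ hb fun k hk => ?_
  exact Finset.single_le_sum (f := fun k => M k * ∫ p, |G p|)
    (fun k _ => mul_nonneg (hM.nonneg k) (integral_nonneg fun _ => abs_nonneg _))
    (Finset.mem_range.2 (by omega))

end SmoothKernel

/-! ### The `Δ^{1/2}`-caloric capacity of the segment is zero. -/

section Vanishing

variable {T : 𝓓'((⊤ : Opens (ℝ × ℝ)), ℝ)}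

/-- A distribution on the segment with bounded `(-Δₓ)^{1/2}(W ∗ T)` annihilates the constants. -/
theorem pairing_one_eq_zero (hT : dsupport T ⊆ verticalSegment)
    (hsp : LInftyNormLeOne (halfLaplacianPotential T)) : pairing T (fun _ => 1) = 0 := by
  obtain ⟨c, hc, hcc⟩ := exists_halfLap_halfLap
  obtain ⟨C, hC⟩ := exists_pairing_heatTranspose_le hT
  -- With these radii `χ' ⊗ V` vanishes for `|t| ≤ 3` and for `|t| ≥ 4`, as
  -- `exists_pairing_heatTranspose_le` requires.
  let χ : ContDiffBump (0 : ℝ) := ⟨3, 4, by norm_num, by norm_num⟩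
  have hχ : ContDiff ℝ ∞ χ := χ.contDiff
  have hχs : ∀ t, 4 ≤ |t| → χ t = 0 := fun t ht => χ.zero_of_le_dist (by
    change 4 ≤ dist t 0
    rwa [dist_zero_right])
  have hχ1 : ∀ t, |t| ≤ 3 → χ t = 1 := fun t ht => χ.one_of_mem_closedBall (by
    rwa [mem_closedBall_zero_iff])
  have hχ' : ContDiff ℝ ∞ (deriv χ) := hχ.deriv'
  -- Points where `χ` takes its extreme values `0` or `1` are critical, the endpoints included.
  have hχs' : ∀ t, 4 ≤ |t| → deriv χ t = 0 := fun t ht => by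
    refine IsLocalMin.deriv_eq_zero (.of_forall fun s => ?_)
    rw [hχs t ht]
    exact χ.nonneg
  have hχ1' : ∀ t, |t| ≤ 3 → deriv χ t = 0 := fun t ht => by
    refine IsLocalMax.deriv_eq_zero (.of_forall fun s => ?_)
    rw [hχ1 t ht]
    exact χ.le_one
  have hIcc : ∀ t ∉ Icc (-4 : ℝ) 4, 4 ≤ |t| := fun t ht => by
    by_contra h
    exact ht (abs_le.1 (not_le.1 h).le)
  have hχc : HasCompactSupport χ := χ.hasCompactSupport
  obtain ⟨B, hB⟩ := hχc.exists_derivBound hχ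
  obtain ⟨B', hB'⟩ := hχc.deriv.exists_derivBound hχ'
  have hab : (-4 : ℝ) ≤ 4 := by norm_num
  have main : ∀ ε : ℝ, 0 < ε → |c * pairing T fun _ => 1| ≤
      ((∫ t, |χ t|) + |c| * |C| * ∫ t, |deriv χ t|) * ε := by
    intro ε hε
    obtain ⟨V, hV, hV2, hV1, hVε, hLε⟩ := exists_capacitary_function hε
    have hVc : HasCompactSupport V := HasCompactSupport.intro (isCompact_Icc (a := -2) (b := 2))
      fun x hx => hV2 x (by
        by_contra h
        exact hx (abs_le.1 (not_le.1 h).le))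
    have hV' : ContDiff ℝ ∞ (deriv V) := hV.deriv'
    have hV'' : ContDiff ℝ ∞ (deriv (deriv V)) := hV'.deriv'
    obtain ⟨M, hM⟩ := hVc.exists_derivBound hV
    obtain ⟨M', hM'⟩ := hVc.deriv.exists_derivBound hV'
    obtain ⟨M'', hM''⟩ := hVc.deriv.deriv.exists_derivBound hV''
    have hL := hM.halfLap (e := (1 : ℝ)) (by simp)
    have hbound := abs_pairing_heatTranspose_le hT hsp hab hχ (fun t ht => hχs t (hIcc t ht))
      hL.contDiff (exists_halfLap_decay hV hVc)
    have tV := hB.tensor hM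
    have t1 := hB'.tensor hM
    have t2 := hB.tensor hM''
    have s1 : TimeSupp (-4) 4 (fun p : ℝ × ℝ => deriv χ p.2 * V p.1) := fun p hp =>
      mul_eq_zero_of_left (hχs' _ (hIcc _ hp)) _
    have s2 : TimeSupp (-4) 4 (fun p : ℝ × ℝ => χ p.2 * deriv (deriv V) p.1) := fun p hp =>
      mul_eq_zero_of_left (hχs _ (hIcc _ hp)) _
    have H1 := t1.heatTranspose hab s1
    have hheat := heatTranspose_heat_eq (χ := χ) (χ' := deriv χ) (V := V) (V' := deriv V)
      (V'' := deriv (deriv V)) (a := -4) (b := 4) (C := B 0 + B' 0 + M 0 + M' 0 + M'' 0)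
      (fun t => (hχ.differentiable (by simp) t).hasDerivAt) hχ'.continuous
      (fun t ht => hχs t (hIcc t ht)) (fun t ht => hχs' t (hIcc t ht))
      (fun x => (hV.differentiable (by simp) x).hasDerivAt)
      (fun x => (hV'.differentiable (by simp) x).hasDerivAt) hV''.continuous
    have := hB.nonneg 0
    have := hB'.nonneg 0
    have := hM.nonneg 0
    have := hM'.nonneg 0
    have := hM''.nonneg 0
    have hheat := hheat (fun t => by linarith [hB.norm_le t]) (fun t => by linarith [hB'.norm_le t])
      (fun t => by linarith [hM.norm_le t]) (fun t => by linarith [hM'.norm_le t])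
      (fun t => by linarith [hM''.norm_le t])
    -- The backward heat equation for `χ ⊗ V`, with `V''` expressed through the squared half
    -- Laplacian.
    have e : (heatTranspose fun p => χ p.2 * halfLap (1 : ℝ) (halfLap (1 : ℝ) V) p.1) =
        c • ((fun p : ℝ × ℝ => χ p.2 * V p.1) + heatTranspose fun p => deriv χ p.2 * V p.1) := by
      ext q
      have i1 := integrable_heatKernel_mul t1.contDiff.continuous s1 t1.norm_le q
      have i2 := integrable_heatKernel_mul t2.contDiff.continuous s2 t2.norm_le q
      have h := hheat q
      rw [heatTranspose_eq] at h
      simp only [mul_add] at h i1 i2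
      rw [integral_add i1 i2] at h
      simp only [Pi.smul_apply, Pi.add_apply, smul_eq_mul]
      rw [heatTranspose_eq, heatTranspose_eq]
      simp only [hcc V hV hVc]
      have e1 : ∀ p : ℝ × ℝ, heatKernel p * (χ (q + p).2 * -(c * deriv (deriv V) (q + p).1)) =
          -c * (heatKernel p * (χ (q + p).2 * deriv (deriv V) (q + p).1)) := fun p => by ring
      simp only [e1]
      rw [integral_const_mul]
      linear_combination (-c) * h
    have hG := hC (fun p => deriv χ p.2 * V p.1) (by
        rw [Measure.volume_eq_prod]
        simp only [mul_comm (deriv χ _)]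
        exact (hV.continuous.integrable_of_hasCompactSupport hVc).mul_prod
          (hχ'.continuous.integrable_of_hasCompactSupport hχc.deriv))
      (fun p hp => mul_eq_zero_of_right _ (hV2 _ hp)) (fun p hp => mul_eq_zero_of_left (hχ1' _ hp) _)
      (fun p hp => mul_eq_zero_of_left (hχs' _ hp) _)
    have e2 : ∫ p : ℝ × ℝ, |deriv χ p.2 * V p.1| = (∫ x, |V x|) * ∫ t, |deriv χ t| := by
      simp only [abs_mul, mul_comm |deriv χ _|]
      rw [Measure.volume_eq_prod, integral_prod_mul (fun x => |V x|) fun t => |deriv χ t|]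
    have e3 : pairing T (fun _ => 1) = pairing T (fun p : ℝ × ℝ => χ p.2 * V p.1) := by
      refine pairing_congr hT tV.contDiff ?_
      have h1 : {p : ℝ × ℝ | |p.2| < 3} ∈ 𝓝ˢ (dsupport T) := by
        refine (isOpen_lt (by fun_prop) continuous_const).mem_nhdsSet.2 fun p hp => ?_
        have := (hT hp).2
        rw [mem_ofPred_eq, abs_of_nonneg this.1]
        linarith [this.2]
      have h2 : ∀ᶠ p in 𝓝ˢ (dsupport T), V (p : ℝ × ℝ).1 = 1 := by
        refine Filter.eventually_iff_exists_mem.2 ?_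
        obtain ⟨U, hU, hUo, h0⟩ := eventually_nhds_iff.1 hV1
        refine ⟨Prod.fst ⁻¹' U, (hUo.preimage continuous_fst).mem_nhdsSet.2 fun p hp => ?_,
          fun p hp => hU _ hp⟩
        have : p.1 = 0 := (hT hp).1
        rwa [mem_preimage, this]
      filter_upwards [h1, h2] with p hp1 hp2
      rw [hχ1 _ (le_of_lt hp1), hp2, one_mul]
    have hsum : ContDiff ℝ ∞ ((fun p : ℝ × ℝ => χ p.2 * V p.1) +
      heatTranspose fun p => deriv χ p.2 * V p.1) := tV.contDiff.add H1.contDiff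
    rw [e, pairing_smul hT hsum, pairing_add hT tV.contDiff H1.contDiff, ← e3] at hbound
    rw [e2] at hG
    have hI : 0 ≤ ∫ t, |χ t| := integral_nonneg fun _ => abs_nonneg _
    have hI' : 0 ≤ ∫ t, |deriv χ t| := integral_nonneg fun _ => abs_nonneg _
    have hI'' : 0 ≤ ∫ t, |V t| := integral_nonneg fun _ => abs_nonneg _
    set P := pairing T fun _ => 1
    set Q := pairing T (heatTranspose fun p => deriv χ p.2 * V p.1)
    calc |c * P| = |c * (P + Q) - c * Q| := by ring_nf
      _ ≤ |c * (P + Q)| + |c| * |Q| := by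
        rw [← abs_mul c Q]
        exact abs_sub _ _
      _ ≤ (∫ t, |χ t|) * ε + |c| * (|C| * (ε * ∫ t, |deriv χ t|)) := by
        gcongr
        · exact hbound.trans (mul_le_mul_of_nonneg_left hLε hI)
        · refine hG.trans ?_
          gcongr
          exact le_abs_self C
      _ = _ := by ring
  by_contra h
  have hpos : 0 < |c * pairing T fun _ => 1| := abs_pos.2 (mul_ne_zero hc.ne' h)
  set D := (∫ t, |χ t|) + |c| * |C| * ∫ t, |deriv χ t| with hD
  have hD0 : 0 ≤ D := by
    have hI : 0 ≤ ∫ t, |χ t| := integral_nonneg fun _ => abs_nonneg _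
    have hI' : 0 ≤ ∫ t, |deriv χ t| := integral_nonneg fun _ => abs_nonneg _
    positivity
  -- For this `ε` the bound `D ε` is less than half of the positive quantity it should dominate.
  have := main (|c * pairing T fun _ => 1| / (2 * (D + 1))) (by positivity)
  rw [← mul_div_assoc, le_div_iff₀ (by positivity)] at this
  nlinarith

theorem halfLaplacianCaloricCapacity_verticalSegment :
    halfLaplacianCaloricCapacity verticalSegment = 0 := by
  simp only [halfLaplacianCaloricCapacity, ENNReal.iSup_eq_zero]
  intro T hT
  rw [pairing_one_eq_zero hT.support_subset hT.space, enorm_zero]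

end Vanishing

end CaloricCapacity

namespace CaloricCapacity

/-! ### Lipschitz bounds for the potential of a density on the segment. -/

section SegmentPotential

/-- The heat potential of the density `f` on the vertical axis. -/
noncomputable def segmentPotential (f : ℝ → ℝ) (p : ℝ × ℝ) : ℝ :=
  ∫ t, f t * heatKernel (p - (0, t))

/-- The substitution of `r²` for the elapsed time cancels the factor `s^{-1/2}` of the kernel on the
axis and leaves a bounded integrand. -/
theorem segmentPotential_eq (f : ℝ → ℝ) (p : ℝ × ℝ) :
    segmentPotential f p = (Real.sqrt Real.pi)⁻¹ *
      ∫ r in Ioi (0 : ℝ), f (p.2 - r ^ 2) * Real.exp (-p.1 ^ 2 / (4 * r ^ 2)) := by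
  have e1 : ∀ s, f (p.2 - s) * heatKernel (p - (0, p.2 - s)) =
      (Ioi (0 : ℝ)).indicator (fun s => f (p.2 - s) * heatKernel (p.1, s)) s := fun s => by
    have : p - (0, p.2 - s) = (p.1, s) := by ext <;> simp
    rw [this]
    by_cases hs : s ∈ Ioi (0 : ℝ)
    · rw [indicator_of_mem hs]
    · rw [indicator_of_notMem hs, heatKernel_of_nonpos (p := (p.1, s)) (not_lt.1 hs), mul_zero]
  rw [segmentPotential, ← integral_sub_left_eq_self _ volume p.2]
  simp only [e1]
  rw [integral_indicator measurableSet_Ioi,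
    ← integral_comp_rpow_Ioi_of_pos (g := fun s => f (p.2 - s) * heatKernel (p.1, s)) two_pos,
    ← integral_const_mul]
  refine setIntegral_congr_fun measurableSet_Ioi fun r hr => ?_
  have hr0 : 0 < r := hr
  have hr2 : 0 < r ^ 2 := by positivity
  have hπ := Real.sqrt_pos.2 Real.pi_pos
  have e2 : Real.sqrt (4 * Real.pi * r ^ 2) = 2 * Real.sqrt Real.pi * r := by
    rw [show 4 * Real.pi * r ^ 2 = (2 * r) ^ 2 * Real.pi by ring, Real.sqrt_mul (by positivity),
      Real.sqrt_sq (by positivity)]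
    ring
  simp only [Real.rpow_two, smul_eq_mul]
  rw [show (2 : ℝ) - 1 = 1 by norm_num, Real.rpow_one, heatKernel_of_pos (p := (p.1, r ^ 2)) hr2]
  simp only [e2]
  field_simp

/-- The window lies between `√(t - 2)` and `√(t + 1)`, so its length is bounded uniformly in `t`.
The interval `[-1, 2]` leaves room for shifting a density on `[0, 1]` by a time less than one. -/
theorem volume_sqrt_window_le (t : ℝ) :
    volume (Ioi (0 : ℝ) ∩ {r | t - r ^ 2 ∈ Icc (-1 : ℝ) 2}) ≤ 2 := by
  have h : Ioi (0 : ℝ) ∩ {r | t - r ^ 2 ∈ Icc (-1 : ℝ) 2} ⊆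
      Icc (Real.sqrt (t - 2)) (Real.sqrt (t + 1)) := by
    rintro r ⟨h0, h1, h2⟩
    have h0' : 0 < r := h0
    exact ⟨Real.sqrt_le_iff.2 ⟨h0'.le, by linarith⟩, Real.le_sqrt_of_sq_le (by linarith)⟩
  refine (measure_mono h).trans ?_
  rw [Real.volume_Icc]
  refine ENNReal.ofReal_le_of_le_toReal ?_
  rw [ENNReal.toReal_ofNat, sub_le_iff_le_add, Real.sqrt_le_iff]
  have h0 := Real.sqrt_nonneg (t - 2)
  refine ⟨by positivity, ?_⟩
  have h1 : t - 2 ≤ Real.sqrt (t - 2) ^ 2 := by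
    rcases le_total 0 (t - 2) with h | h
    · rw [Real.sq_sqrt h]
    · exact h.trans (sq_nonneg _)
  nlinarith

variable {f : ℝ → ℝ} {t C : ℝ} {h : ℝ → ℝ}

theorem abs_integral_sqrt_window_le (hC : ∀ r, |h r| ≤ C)
    (h0 : ∀ r, t - r ^ 2 ∉ Icc (-1 : ℝ) 2 → h r = 0) : |∫ r in Ioi (0 : ℝ), h r| ≤ 2 * C := by
  have hC0 : 0 ≤ C := (abs_nonneg _).trans (hC 0)
  rw [setIntegral_eq_of_subset_of_forall_sdiff_eq_zero measurableSet_Ioi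
    (s := Ioi (0 : ℝ) ∩ {r | t - r ^ 2 ∈ Icc (-1 : ℝ) 2}) inter_subset_left
    fun r hr => h0 r fun h' => hr.2 ⟨hr.1, h'⟩]
  have hv := volume_sqrt_window_le t
  rw [← Real.norm_eq_abs]
  refine (norm_setIntegral_le_of_norm_le_const (f := h) (hv.trans_lt ENNReal.ofNat_lt_top)
    fun r _ => hC r).trans ?_
  rw [mul_comm]
  refine mul_le_mul_of_nonneg_right ?_ hC0
  exact ENNReal.toReal_le_of_le_ofReal two_pos.le (by simpa using hv)

theorem integrableOn_sqrt_window (hm : Measurable h) (hC : ∀ r, |h r| ≤ C)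
    (h0 : ∀ r, t - r ^ 2 ∉ Icc (-1 : ℝ) 2 → h r = 0) : IntegrableOn h (Ioi (0 : ℝ)) := by
  have hv := volume_sqrt_window_le t
  have : IntegrableOn h (Ioi (0 : ℝ) ∩ {r | t - r ^ 2 ∈ Icc (-1 : ℝ) 2}) := by
    refine Measure.integrableOn_of_bounded (M := C) (hv.trans_lt ENNReal.ofNat_lt_top).ne
      hm.aestronglyMeasurable (.of_forall hC)
  exact this.of_forall_sdiff_eq_zero measurableSet_Ioi fun r hr => h0 r fun h' => hr.2 ⟨hr.1, h'⟩

/-- The function `r ↦ 1 - exp (-x² / (4 r²))`. -/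
noncomputable def expDefect (x r : ℝ) : ℝ := 1 - Real.exp (-x ^ 2 / (4 * r ^ 2))

theorem expDefect_nonneg (x r : ℝ) : 0 ≤ expDefect x r :=
  sub_nonneg.2 (Real.exp_le_one_iff.2 (by rw [neg_div]; exact neg_nonpos.2 (by positivity)))

/-- The defect is at most one, and at most `x² / (4r²)` by `1 - e^{-u} ≤ u`. -/
theorem integrableOn_expDefect (x : ℝ) : IntegrableOn (expDefect x) (Ioi 0) := by
  have hb := (integrable_inv_one_add_sq.const_mul (1 + x ^ 2 / 4)).integrableOn (s := Ioi (0 : ℝ))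
  refine hb.mono' ?_ ?_
  · unfold expDefect
    exact (by fun_prop : Measurable fun r : ℝ => 1 - Real.exp (-x ^ 2 / (4 * r ^ 2))).aestronglyMeasurable
  · filter_upwards [ae_restrict_mem measurableSet_Ioi] with r hr
    have hr0 : 0 < r := hr
    rw [Real.norm_of_nonneg (expDefect_nonneg x r), ← div_eq_mul_inv, le_div_iff₀ (by positivity),
      mul_add, mul_one]
    have h1 : expDefect x r ≤ 1 := by
      rw [expDefect]
      linarith [Real.exp_pos (-x ^ 2 / (4 * r ^ 2))]
    have h2 : expDefect x r ≤ x ^ 2 / (4 * r ^ 2) := by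
      rw [expDefect]
      linarith [Real.add_one_le_exp (-x ^ 2 / (4 * r ^ 2)), neg_div (4 * r ^ 2) (x ^ 2)]
    have h3 := mul_le_mul_of_nonneg_right h2 (sq_nonneg r)
    have h4 : x ^ 2 / (4 * r ^ 2) * r ^ 2 = x ^ 2 / 4 := by field_simp
    linarith

/-- Scaling `r` by `|x|`. This linear growth in `|x|` is what makes the potential Lipschitz across
the segment. -/
theorem integral_expDefect (x : ℝ) :
    ∫ r in Ioi (0 : ℝ), expDefect x r = |x| * ∫ r in Ioi (0 : ℝ), expDefect 1 r := by
  rcases eq_or_ne x 0 with rfl | hx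
  · simp [expDefect]
  have hx' : 0 < |x| := abs_pos.2 hx
  have h := integral_comp_mul_left_Ioi (expDefect x) 0 hx'
  rw [mul_zero, smul_eq_mul, eq_inv_mul_iff_mul_eq₀ hx'.ne'] at h
  rw [← h]
  congr 1
  refine setIntegral_congr_fun measurableSet_Ioi fun r hr => ?_
  have hr0 : 0 < r := hr
  simp only [expDefect]
  rw [mul_pow, sq_abs]
  congr 2
  field_simp

theorem abs_segmentPotential_le (hs : ∀ t ∉ Icc (0 : ℝ) 1, f t = 0) (h1 : ∀ t, |f t| ≤ 1)
    (p : ℝ × ℝ) : |segmentPotential f p| ≤ 2 := by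
  have hπ : (Real.sqrt Real.pi)⁻¹ ≤ 1 := inv_le_one_of_one_le₀
    (Real.one_le_sqrt.2 (by linarith [Real.pi_gt_three]))
  rw [segmentPotential_eq, abs_mul, abs_of_nonneg (by positivity : 0 ≤ (Real.sqrt Real.pi)⁻¹)]
  refine (mul_le_of_le_one_left (abs_nonneg _) hπ).trans ?_
  refine (abs_integral_sqrt_window_le (t := p.2) (C := 1) (fun r => ?_) fun r hr => ?_).trans
    (by norm_num)
  · rw [abs_mul, Real.abs_exp]
    exact mul_le_one₀ (h1 _) (Real.exp_pos _).le (sub_nonneg.1 (expDefect_nonneg p.1 r))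
  · rw [hs _ fun h' => hr ⟨by linarith [h'.1], by linarith [h'.2]⟩, zero_mul]

/-- For `|x| ≤ |y|` the two exponentials are ordered for every `r`, so the absolute value of their
difference integrates exactly to a multiple of `|y| - |x|`. -/
theorem abs_segmentPotential_sub_fst_le (hf : Continuous f) (hs : ∀ t ∉ Icc (0 : ℝ) 1, f t = 0)
    (h1 : ∀ t, |f t| ≤ 1) (x y t : ℝ) :
    |segmentPotential f (x, t) - segmentPotential f (y, t)| ≤
      (∫ r in Ioi (0 : ℝ), expDefect 1 r) * |x - y| := by
  have hπ : (Real.sqrt Real.pi)⁻¹ ≤ 1 := inv_le_one_of_one_le₀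
    (Real.one_le_sqrt.2 (by linarith [Real.pi_gt_three]))
  have hI : 0 ≤ ∫ r in Ioi (0 : ℝ), expDefect 1 r := integral_nonneg fun _ => expDefect_nonneg _ _
  wlog hxy : |x| ≤ |y| generalizing x y
  · rw [abs_sub_comm, abs_sub_comm x]
    exact this y x (not_le.1 hxy).le
  have hint : ∀ x : ℝ, IntegrableOn (fun r => f (t - r ^ 2) * Real.exp (-x ^ 2 / (4 * r ^ 2)))
      (Ioi (0 : ℝ)) := fun x => by
    have := hf.measurable
    refine integrableOn_sqrt_window (t := t) (C := 1) (by fun_prop) (fun r => ?_) fun r hr => ?_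
    · rw [abs_mul, Real.abs_exp]
      exact mul_le_one₀ (h1 _) (Real.exp_pos _).le (sub_nonneg.1 (expDefect_nonneg x r))
    · rw [hs _ fun h' => hr ⟨by linarith [h'.1], by linarith [h'.2]⟩, zero_mul]
  rw [segmentPotential_eq, segmentPotential_eq, ← mul_sub, ← integral_sub (hint x) (hint y), abs_mul,
    abs_of_nonneg (by positivity : 0 ≤ (Real.sqrt Real.pi)⁻¹)]
  refine (mul_le_of_le_one_left (abs_nonneg _) hπ).trans ?_
  have hd : IntegrableOn (fun r => expDefect y r - expDefect x r) (Ioi (0 : ℝ)) :=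
    (integrableOn_expDefect y).sub (integrableOn_expDefect x)
  rw [← Real.norm_eq_abs]
  refine (norm_integral_le_of_norm_le hd (.of_forall fun r => ?_)).trans ?_
  · rw [← mul_sub, norm_mul]
    refine (mul_le_of_le_one_left (norm_nonneg _) (h1 _)).trans ?_
    have e : Real.exp (-x ^ 2 / (4 * r ^ 2)) - Real.exp (-y ^ 2 / (4 * r ^ 2)) =
        expDefect y r - expDefect x r := by
      simp only [expDefect]
      ring
    rw [e, Real.norm_of_nonneg]
    rw [← e, sub_nonneg]
    refine Real.exp_le_exp.2 (div_le_div_of_nonneg_right ?_ (by positivity))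
    exact neg_le_neg (sq_le_sq.2 hxy)
  · rw [integral_sub (integrableOn_expDefect y) (integrableOn_expDefect x), integral_expDefect y,
      integral_expDefect x, ← sub_mul, mul_comm]
    refine mul_le_mul_of_nonneg_left ?_ hI
    rw [abs_sub_comm]
    exact abs_sub_abs_le_abs_sub y x

/-- For `|t - u| < 1` the Lipschitz bound of `f` is integrated over a window of length at most two,
giving `2L`; for larger shifts the bound `2` on each potential gives `4`. -/
theorem abs_segmentPotential_sub_snd_le {L : ℝ≥0} (hf : LipschitzWith L f)
    (hs : ∀ t ∉ Icc (0 : ℝ) 1, f t = 0) (h1 : ∀ t, |f t| ≤ 1) (x t u : ℝ) :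
    |segmentPotential f (x, t) - segmentPotential f (x, u)| ≤ (2 * L + 4) * |t - u| := by
  rcases le_or_gt 1 |t - u| with h | h
  · refine (abs_sub _ _).trans ?_
    have e1 := abs_segmentPotential_le hs h1 (x, t)
    have e2 := abs_segmentPotential_le hs h1 (x, u)
    nlinarith [L.2]
  have hπ : (Real.sqrt Real.pi)⁻¹ ≤ 1 := inv_le_one_of_one_le₀
    (Real.one_le_sqrt.2 (by linarith [Real.pi_gt_three]))
  have hle : ∀ r, Real.exp (-x ^ 2 / (4 * r ^ 2)) ≤ 1 := fun r => sub_nonneg.1 (expDefect_nonneg x r)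
  have hint : ∀ t : ℝ, IntegrableOn (fun r => f (t - r ^ 2) * Real.exp (-x ^ 2 / (4 * r ^ 2)))
      (Ioi (0 : ℝ)) := fun t => by
    have := hf.continuous.measurable
    refine integrableOn_sqrt_window (t := t) (C := 1) (by fun_prop) (fun r => ?_) fun r hr => ?_
    · rw [abs_mul, Real.abs_exp]
      exact mul_le_one₀ (h1 _) (Real.exp_pos _).le (hle r)
    · rw [hs _ fun h' => hr ⟨by linarith [h'.1], by linarith [h'.2]⟩, zero_mul]
  rw [segmentPotential_eq, segmentPotential_eq, ← mul_sub, ← integral_sub (hint t) (hint u), abs_mul,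
    abs_of_nonneg (by positivity : 0 ≤ (Real.sqrt Real.pi)⁻¹)]
  refine (mul_le_of_le_one_left (abs_nonneg _) hπ).trans ?_
  rw [abs_lt] at h
  refine (abs_integral_sqrt_window_le (t := t) (C := L * |t - u|) (fun r => ?_)
    fun r hr => ?_).trans (by nlinarith [abs_nonneg (t - u)])
  · rw [← sub_mul, abs_mul, Real.abs_exp]
    refine (mul_le_of_le_one_right (abs_nonneg _) (hle r)).trans ?_
    have := hf.dist_le_mul (t - r ^ 2) (u - r ^ 2)
    rwa [Real.dist_eq, Real.dist_eq, sub_sub_sub_cancel_right] at this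
  · rw [hs _ fun h' => hr ⟨by linarith [h'.1], by linarith [h'.2]⟩,
      hs (u - r ^ 2) fun h' => hr ⟨by linarith [h'.1], by linarith [h'.2]⟩, zero_mul, sub_self]

theorem exists_lipschitzWith_segmentPotential {L : ℝ≥0} (hf : LipschitzWith L f)
    (hs : ∀ t ∉ Icc (0 : ℝ) 1, f t = 0) (h1 : ∀ t, |f t| ≤ 1) :
    ∃ C, LipschitzWith C (segmentPotential f) := by
  have hI : 0 ≤ ∫ r in Ioi (0 : ℝ), expDefect 1 r := integral_nonneg fun _ => expDefect_nonneg _ _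
  refine ⟨Real.toNNReal ((∫ r in Ioi (0 : ℝ), expDefect 1 r) + (2 * L + 4)),
    LipschitzWith.of_dist_le_mul fun p q => ?_⟩
  rw [Real.coe_toNNReal _ (by positivity), Real.dist_eq, dist_eq_norm]
  have e1 := abs_segmentPotential_sub_fst_le hf.continuous hs h1 p.1 q.1 p.2
  have e2 := abs_segmentPotential_sub_snd_le hf hs h1 q.1 p.2 q.2
  have n1 : |p.1 - q.1| ≤ ‖p - q‖ := norm_fst_le (p - q)
  have n2 : |p.2 - q.2| ≤ ‖p - q‖ := norm_snd_le (p - q)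
  rw [add_mul]
  refine (abs_sub_le _ (segmentPotential f (q.1, p.2)) _).trans (add_le_add (e1.trans ?_)
    (e2.trans ?_)) <;> gcongr

end SegmentPotential

end CaloricCapacity

namespace CaloricCapacity

/-! ### The half derivative commutes with heat potentials. -/

section HalfDerivFubini

/-- Fubini for the kernel `|s|^{-3/2}`: an increment whose `L¹` norm is bounded and `O(|s|)` is
dominated by a multiple of `halfWeight`. -/
theorem integral_halfDeriv_swap {α : Type*} [MeasurableSpace α] {μ : Measure α} [SFinite μ]
    {D : ℝ → α → ℝ} {A B : ℝ}
    (hm : AEStronglyMeasurable (Function.uncurry D) (volume.prod μ))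
    (hi : ∀ s, Integrable (D s) μ) (hA : ∀ s, ∫ a, |D s a| ∂μ ≤ A)
    (hB : ∀ s, ∫ a, |D s a| ∂μ ≤ B * |s|) (hB0 : 0 ≤ B) :
    ∫ a, (∫ s, (|s| ^ (3 / 2 : ℝ))⁻¹ * D s a) ∂μ = ∫ s, (|s| ^ (3 / 2 : ℝ))⁻¹ * ∫ a, D s a ∂μ := by
  have hA0 : 0 ≤ A := (integral_nonneg fun _ => abs_nonneg _).trans (hA 0)
  have hmw : Measurable fun s : ℝ => (|s| ^ (3 / 2 : ℝ))⁻¹ := by fun_prop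
  have hm' : AEStronglyMeasurable (Function.uncurry fun s a => (|s| ^ (3 / 2 : ℝ))⁻¹ * D s a)
      (volume.prod μ) := (hmw.comp measurable_fst).aestronglyMeasurable.mul hm
  have hint : Integrable (Function.uncurry fun s a => (|s| ^ (3 / 2 : ℝ))⁻¹ * D s a)
      (volume.prod μ) := by
    rw [integrable_prod_iff hm']
    refine ⟨.of_forall fun s => (hi s).const_mul (|s| ^ (3 / 2 : ℝ))⁻¹, ?_⟩
    refine (integrable_halfWeight.const_mul (A + B)).mono' hm'.norm.integral_prod_right'
      (.of_forall fun s => ?_)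
    rw [Real.norm_of_nonneg (integral_nonneg fun _ => norm_nonneg _)]
    simp only [Function.uncurry_apply_pair, norm_mul, Real.norm_eq_abs]
    rw [integral_const_mul, abs_of_nonneg (by positivity : 0 ≤ (|s| ^ (3 / 2 : ℝ))⁻¹)]
    exact inv_rpow_mul_le_halfWeight hA0 hB0 (hA s) (hB s)
  rw [← integral_integral_swap hint]
  simp only [integral_const_mul]

variable {Φ : ℝ × ℝ → ℝ} {M : ℕ → ℝ} {a b : ℝ}

theorem integral_abs_heatKernel_mul_le {G : ℝ × ℝ → ℝ} {C : ℝ} (hab : a ≤ b)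
    (hG : TimeSupp a b G) (hC : ∀ p, ‖G p‖ ≤ C) (q : ℝ × ℝ) :
    ∫ p, |heatKernel p * G (q + p)| ≤ C * (b - a) := by
  have := norm_heatTranspose_le (G := fun p => |G p|) hab (fun p hp => by simp [hG p hp])
    (C := C) (fun p => by simpa using hC p) q
  rw [heatTranspose_eq] at this
  simp only [abs_mul, abs_of_nonneg (heatKernel_nonneg _)]
  exact (le_abs_self _).trans this

theorem TimeSupp.translate (h : TimeSupp a b Φ) (s : ℝ) :
    TimeSupp (a - s) (b - s) (fun p => Φ (p + s • ((0, 1) : ℝ × ℝ))) := fun p hp => by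
  refine h _ fun h' => hp ?_
  simp only [Prod.snd_add, Prod.smul_snd, smul_eq_mul, mul_one] at h'
  exact ⟨by linarith [h'.1], by linarith [h'.2]⟩

/-- The half derivative of `Φ` need not have bounded time support, so the estimates for heat
potentials do not cover it directly. After commutation the heat potential is taken of `Φ` itself,
and smoothness follows from `DerivBound.halfDeriv`. -/
theorem DerivBound.heatTranspose_halfDeriv (h : DerivBound Φ M) (hab : a ≤ b)
    (hs : TimeSupp a b Φ) :
    CaloricCapacity.heatTranspose (CaloricCapacity.halfDeriv ((0, 1) : ℝ × ℝ) Φ) =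
      CaloricCapacity.halfDeriv ((0, 1) : ℝ × ℝ) (CaloricCapacity.heatTranspose Φ) := by
  ext q
  set e : ℝ × ℝ := (0, 1) with he
  have he1 : ‖e‖ ≤ 1 := by simp [he, Prod.norm_def]
  have hc := h.contDiff.continuous
  let D : ℝ → ℝ × ℝ → ℝ := fun s p => heatKernel p * (Φ (q + s • e + p) - Φ (q + p))
  have i1 : ∀ s : ℝ, Integrable fun p => heatKernel p * Φ (q + s • e + p) := fun s =>
    integrable_heatKernel_mul hc hs h.norm_le (q + s • e)
  have i0 : Integrable fun p => heatKernel p * Φ (q + p) :=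
    integrable_heatKernel_mul hc hs h.norm_le _
  have hi : ∀ s, Integrable (D s) := fun s => by
    simp only [D, mul_sub]
    exact (i1 s).sub i0
  have hM0 := h.nonneg 0
  have hM1 := h.nonneg 1
  have hA : ∀ s, ∫ p, |D s p| ≤ 2 * M 0 * (b - a) := fun s => by
    have e1 := integral_abs_heatKernel_mul_le hab hs h.norm_le (q + s • e)
    have e0 := integral_abs_heatKernel_mul_le hab hs h.norm_le q
    refine (integral_mono (hi s).abs ((i1 s).abs.add i0.abs) fun p => ?_).trans ?_
    · simp only [D, mul_sub, Pi.add_apply]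
      exact abs_sub _ _
    · simp only [Pi.add_apply]
      rw [integral_add (i1 s).abs i0.abs]
      linarith
  -- For `|s| ≤ 1` the increment is supported in times `[a - 1, b + 1]`, which accounts for `b - a +
  -- 2`; for `|s| > 1` the uniform bound is multiplied by `|s|`.
  have hB : ∀ s, ∫ p, |D s p| ≤ (M 1 * (b - a + 2) + 2 * M 0 * (b - a)) * |s| := fun s => by
    have hp1 : 0 ≤ M 1 * (b - a + 2) := mul_nonneg hM1 (by linarith)
    have hp0 : 0 ≤ 2 * M 0 * (b - a) := mul_nonneg (by positivity) (by linarith)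
    rcases le_or_gt |s| 1 with h1 | h1
    · rw [abs_le] at h1
      have e1 := integral_abs_heatKernel_mul_le (a := a - 1) (b := b + 1)
        (G := fun p => Φ (p + s • e) - Φ p) (C := M 1 * |s|) (by linarith) (fun p hp => by
          have z1 : Φ (p + s • e) = 0 := (hs.translate s) p
            fun h' => hp ⟨by linarith [h'.1, h1.2], by linarith [h'.2, h1.1]⟩
          have z0 : Φ p = 0 := hs p fun h' => hp ⟨by linarith [h'.1], by linarith [h'.2]⟩
          simp only [z1, z0, sub_zero])
        (fun p => by
          have := h.norm_sub_le 0 p (s • e)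
          simp only [iteratedFDeriv_zero_eq_comp, Function.comp_apply, zero_add] at this
          rw [← map_sub, LinearIsometryEquiv.norm_map] at this
          refine this.trans (mul_le_mul_of_nonneg_left ?_ hM1)
          rw [norm_smul]
          exact mul_le_of_le_one_right (abs_nonneg _) he1) q
      simp only [add_right_comm q _ (s • e)] at e1
      refine e1.trans ?_
      nlinarith [abs_nonneg s]
    · refine (hA s).trans ?_
      nlinarith
  have hmeas : AEStronglyMeasurable (Function.uncurry D) (volume.prod volume) := by
    have := measurable_heatKernel
    have := hc.measurable
    refine Measurable.aestronglyMeasurable ?_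
    simp only [D, Function.uncurry_def]
    fun_prop
  have hswap := integral_halfDeriv_swap hmeas hi hA hB (by
    have : 0 ≤ b - a := by linarith
    positivity)
  rw [heatTranspose_eq]
  simp only [CaloricCapacity.halfDeriv, smul_eq_mul, ← integral_const_mul]
  convert hswap using 1
  · congr 1
    ext p
    congr 1
    ext s
    simp only [D, add_right_comm q _ (s • e)]
    ring
  · congr 1
    ext s
    rw [heatTranspose_eq, heatTranspose_eq, ← integral_sub (i1 s) i0]
    simp only [D, mul_sub]

end HalfDerivFubini

/-! ### Duality between the segment potential and the transposed heat operator. -/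

section SegmentDuality

variable {f : ℝ → ℝ} {G : ℝ × ℝ → ℝ} {a b C : ℝ}

theorem integral_mul_heatTranspose (hf : Integrable f) (hab : a ≤ b) (hc : Continuous G)
    (hG : TimeSupp a b G) (hC : ∀ p, ‖G p‖ ≤ C) :
    ∫ t, f t * heatTranspose G (0, t) = ∫ p, segmentPotential f p * G p := by
  have hC0 : 0 ≤ C := (norm_nonneg _).trans (hC 0)
  have hint : Integrable (Function.uncurry fun (t : ℝ) (p : ℝ × ℝ) =>
      f t * (heatKernel (p - (0, t)) * G p)) (volume.prod volume) := by
    have hm : AEStronglyMeasurable (Function.uncurry fun (t : ℝ) (p : ℝ × ℝ) =>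
        f t * (heatKernel (p - (0, t)) * G p)) (volume.prod volume) := by
      have := measurable_heatKernel
      have := hc.measurable
      refine hf.aestronglyMeasurable.comp_fst.mul (Measurable.aestronglyMeasurable ?_)
      fun_prop
    rw [integrable_prod_iff hm]
    have e : ∀ t : ℝ, (∫ p, ‖f t * (heatKernel (p - (0, t)) * G p)‖) =
        |f t| * ∫ p, |heatKernel p * G ((0, t) + p)| := fun t => by
      simp only [norm_mul (f t), Real.norm_eq_abs]
      rw [integral_const_mul,
        ← integral_sub_right_eq_self (fun p => |heatKernel p * G ((0, t) + p)|) ((0, t) : ℝ × ℝ)]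
      simp only [add_sub_cancel]
    refine ⟨.of_forall fun t => ?_, (hf.abs.mul_const (C * (b - a))).mono'
      hm.norm.integral_prod_right' (.of_forall fun t => ?_)⟩
    · have := (integrable_heatKernel_mul hc hG hC (0, t)).comp_sub_right ((0, t) : ℝ × ℝ)
      simp only [add_sub_cancel] at this
      exact this.const_mul (f t)
    · rw [Real.norm_of_nonneg (integral_nonneg fun _ => norm_nonneg _)]
      simp only [Function.uncurry_apply_pair, e]
      exact mul_le_mul_of_nonneg_left (integral_abs_heatKernel_mul_le hab hG hC _) (abs_nonneg _)
  simp only [heatTranspose, segmentPotential, ← integral_const_mul, ← integral_mul_const]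
  rw [integral_integral_swap hint]
  simp only [mul_assoc]

end SegmentDuality

end CaloricCapacity

namespace CaloricCapacity

/-! ### Duality for the half derivative in time. -/

section TimeDuality

variable {f : ℝ → ℝ} {Φ F : ℝ × ℝ → ℝ} {M : ℕ → ℝ} {a b : ℝ}

/-- For each `s` a translation moves the increment from `Φ` to `F` and reverses its sign, which the
evenness of the kernel undoes. Boundedness and the Lipschitz property of `F` suffice for Fubini. -/
theorem integral_halfDeriv_mul {K : ℝ≥0} {A : ℝ} (hF : LipschitzWith K F) (hA : ∀ p, |F p| ≤ A)
    (hc : Continuous Φ) (hΦ : HasCompactSupport Φ) :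
    ∫ s, (|s| ^ (3 / 2 : ℝ))⁻¹ * ∫ p, F p * (Φ (p + s • ((0, 1) : ℝ × ℝ)) - Φ p) =
      ∫ p, halfDeriv ((0, 1) : ℝ × ℝ) F p * Φ p := by
  set e : ℝ × ℝ := (0, 1) with he
  have he1 : ‖e‖ ≤ 1 := by simp [he, Prod.norm_def]
  have hFc := hF.continuous
  have hA0 : 0 ≤ A := (abs_nonneg _).trans (hA 0)
  have hΦi : Integrable Φ := hc.integrable_of_hasCompactSupport hΦ
  let D : ℝ → ℝ × ℝ → ℝ := fun s p => (F (p - s • e) - F p) * Φ p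
  have hD2 : ∀ s p, |D s p| ≤ 2 * A * |Φ p| := fun s p => by
    simp only [D, abs_mul]
    gcongr
    refine (abs_sub _ _).trans ?_
    linarith [hA (p - s • e), hA p]
  have hD1 : ∀ s p, |D s p| ≤ K * |s| * |Φ p| := fun s p => by
    simp only [D, abs_mul]
    gcongr
    have := hF.dist_le_mul (p - s • e) p
    rw [Real.dist_eq, dist_eq_norm, sub_sub_cancel_left, norm_neg, norm_smul, Real.norm_eq_abs] at this
    refine this.trans ?_
    gcongr
    exact mul_le_of_le_one_right (abs_nonneg _) he1
  have hm : AEStronglyMeasurable (Function.uncurry D) (volume.prod volume) := by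
    refine Continuous.aestronglyMeasurable ?_
    simp only [D, Function.uncurry_def]
    fun_prop
  have hi : ∀ s, Integrable (D s) := fun s => by
    refine (hΦi.abs.const_mul (2 * A)).mono' ?_ (.of_forall (hD2 s))
    exact (by fun_prop : Continuous fun p => (F (p - s • e) - F p) * Φ p).aestronglyMeasurable
  have hI : 0 ≤ ∫ p, |Φ p| := integral_nonneg fun _ => abs_nonneg _
  have hswap := integral_halfDeriv_swap hm hi (A := 2 * A * ∫ p, |Φ p|) (B := K * ∫ p, |Φ p|)
    (fun s => by
      rw [← integral_const_mul]
      exact integral_mono (hi s).abs (hΦi.abs.const_mul _) (hD2 s))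
    (fun s => by
      rw [mul_right_comm, ← integral_const_mul]
      exact integral_mono (hi s).abs (hΦi.abs.const_mul _) (hD1 s)) (by positivity)
  have hFΦ : ∀ v : ℝ × ℝ, Integrable fun p => F p * Φ (p + v) := fun v =>
    (hΦi.comp_add_right v).bdd_mul hFc.aestronglyMeasurable (.of_forall hA)
  have hFΦ' : ∀ v : ℝ × ℝ, Integrable fun p => F (p - v) * Φ p := fun v =>
    hΦi.bdd_mul (c := A) (by fun_prop : Continuous fun p => F (p - v)).aestronglyMeasurable
      (.of_forall fun p => hA _)
  have e1 : ∀ s : ℝ, ∫ p, F p * (Φ (p + s • e) - Φ p) = ∫ p, D s p := fun s => by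
    have h0 := hFΦ 0
    have h0' := hFΦ' 0
    simp only [add_zero, sub_zero] at h0 h0'
    simp only [mul_sub, D, sub_mul]
    rw [integral_sub (hFΦ _) h0, integral_sub (hFΦ' _) h0',
      ← integral_sub_right_eq_self (fun p => F p * Φ (p + s • e)) (s • e)]
    simp only [sub_add_cancel]
  simp only [e1]
  rw [← hswap]
  congr 1
  ext p
  rw [halfDeriv, ← integral_neg_eq_self, ← integral_mul_const]
  congr 1
  ext s
  have e2 : p - -s • e = p + s • e := by rw [neg_smul, sub_neg_eq_add]
  simp only [D, smul_eq_mul, abs_neg, e2]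
  ring

/-- The heat duality is applied to the increment of `Φ` for each fixed `s`, which has bounded time
support, and only then integrated against `|s|^{-3/2}`. -/
theorem DerivBound.integral_mul_halfDeriv_heatTranspose (h : DerivBound Φ M) (hab : a ≤ b)
    (hs : TimeSupp a b Φ) (hΦ : HasCompactSupport Φ) (hf : Continuous f) (hfc : HasCompactSupport f)
    {K : ℝ≥0} {A : ℝ} (hF : LipschitzWith K (segmentPotential f))
    (hA : ∀ p, |segmentPotential f p| ≤ A) :
    ∫ t, f t * CaloricCapacity.halfDeriv ((0, 1) : ℝ × ℝ) (CaloricCapacity.heatTranspose Φ) (0, t) =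
      ∫ p, CaloricCapacity.halfDeriv ((0, 1) : ℝ × ℝ) (segmentPotential f) p * Φ p := by
  rw [← integral_halfDeriv_mul hF hA h.contDiff.continuous hΦ]
  set e : ℝ × ℝ := (0, 1) with he
  have he1 : ‖e‖ ≤ 1 := by simp [he, Prod.norm_def]
  have hfi : Integrable f := hf.integrable_of_hasCompactSupport hfc
  have hc := h.contDiff.continuous
  set H := CaloricCapacity.heatTranspose Φ with hHdef
  have hH : DerivBound H _ := h.heatTranspose hab hs
  have hHc := hH.contDiff.continuous
  let D : ℝ → ℝ → ℝ := fun s t => f t * (H ((0, t) + s • e) - H (0, t))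
  have hD2 : ∀ s t, |D s t| ≤ 2 * (M 0 * (b - a)) * |f t| := fun s t => by
    simp only [D, abs_mul]
    rw [mul_comm]
    gcongr
    refine (abs_sub _ _).trans ?_
    have := hH.norm_le ((0, t) + s • e)
    have := hH.norm_le (0, t)
    simp only [Real.norm_eq_abs] at *
    linarith
  have hD1 : ∀ s t, |D s t| ≤ M 1 * (b - a) * |s| * |f t| := fun s t => by
    simp only [D, abs_mul]
    rw [mul_comm]
    gcongr
    have := hH.norm_sub_le 0 (0, t) (s • e)
    simp only [iteratedFDeriv_zero_eq_comp, Function.comp_apply, zero_add] at this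
    rw [← map_sub, LinearIsometryEquiv.norm_map] at this
    refine this.trans (mul_le_mul_of_nonneg_left ?_ (hH.nonneg 1))
    rw [norm_smul]
    exact mul_le_of_le_one_right (abs_nonneg _) he1
  have hm : AEStronglyMeasurable (Function.uncurry D) (volume.prod volume) := by
    refine Continuous.aestronglyMeasurable ?_
    simp only [D, Function.uncurry_def]
    fun_prop
  have hi : ∀ s, Integrable (D s) := fun s => by
    refine (hfi.abs.const_mul (2 * (M 0 * (b - a)))).mono' ?_ (.of_forall (hD2 s))
    exact (by fun_prop : Continuous fun t : ℝ =>
      f t * (H ((0, t) + s • e) - H (0, t))).aestronglyMeasurable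
  have hI : 0 ≤ ∫ t, |f t| := integral_nonneg fun _ => abs_nonneg _
  have hswap := integral_halfDeriv_swap hm hi (A := 2 * (M 0 * (b - a)) * ∫ t, |f t|)
    (B := M 1 * (b - a) * ∫ t, |f t|)
    (fun s => by
      rw [← integral_const_mul]
      exact integral_mono (hi s).abs (hfi.abs.const_mul _) (hD2 s))
    (fun s => by
      rw [mul_right_comm, ← integral_const_mul]
      exact integral_mono (hi s).abs (hfi.abs.const_mul _) (hD1 s))
    (mul_nonneg (hH.nonneg 1) hI)
  have e1 : ∀ s : ℝ, ∫ t, D s t = ∫ p, segmentPotential f p * (Φ (p + s • e) - Φ p) := fun s => by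
    rw [← integral_mul_heatTranspose (a := a - |s|) (b := b + |s|) (C := 2 * M 0) hfi
      (by linarith [abs_nonneg s]) (by fun_prop) (fun p hp => by
        have z1 : Φ (p + s • e) = 0 := (hs.translate s) p fun h' => hp
          ⟨by linarith [h'.1, le_abs_self s], by linarith [h'.2, neg_abs_le s]⟩
        have z0 : Φ p = 0 := hs p fun h' => hp
          ⟨by linarith [h'.1, abs_nonneg s], by linarith [h'.2, abs_nonneg s]⟩
        simp only [z1, z0, sub_zero])
      (fun p => by
        have := h.norm_sub_le_two 0 p (s • e)
        simp only [iteratedFDeriv_zero_eq_comp, Function.comp_apply] at this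
        rwa [← map_sub, LinearIsometryEquiv.norm_map] at this)]
    congr 1
    ext t
    simp only [D]
    rw [hHdef, heatTranspose_eq, heatTranspose_eq, heatTranspose_eq,
      ← integral_sub (integrable_heatKernel_mul hc hs h.norm_le ((0, t) + s • e))
        (integrable_heatKernel_mul hc hs h.norm_le (0, t))]
    congr 2
    ext p
    rw [add_right_comm (0, t) _ (s • e)]
    ring
  simp only [← e1]
  rw [← hswap]
  simp only [D, CaloricCapacity.halfDeriv, smul_eq_mul, ← integral_const_mul]
  congr 1
  ext t
  congr 1
  ext s
  ring

theorem abs_halfDeriv_le {K : ℝ≥0} {A : ℝ} (hF : LipschitzWith K F) (hA : ∀ p, |F p| ≤ A)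
    (p : ℝ × ℝ) : |halfDeriv ((0, 1) : ℝ × ℝ) F p| ≤ (2 * A + K) * ∫ s, halfWeight s := by
  have hA0 : 0 ≤ A := (abs_nonneg _).trans (hA 0)
  rw [halfDeriv, ← integral_const_mul, ← Real.norm_eq_abs]
  refine norm_integral_le_of_norm_le (integrable_halfWeight.const_mul _) (.of_forall fun s => ?_)
  rw [norm_smul, Real.norm_of_nonneg (by positivity)]
  refine inv_rpow_mul_le_halfWeight (by positivity) K.2 ?_ ?_
  · refine (abs_sub _ _).trans ?_
    linarith [hA (p + s • ((0, 1) : ℝ × ℝ)), hA p]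
  · have := hF.dist_le_mul (p + s • ((0, 1) : ℝ × ℝ)) p
    rw [Real.dist_eq, dist_eq_norm, add_sub_cancel_left, norm_smul, Real.norm_eq_abs] at this
    simpa [Prod.norm_def] using this

theorem measurable_halfDeriv (hF : Continuous F) : Measurable (halfDeriv ((0, 1) : ℝ × ℝ) F) := by
  refine StronglyMeasurable.measurable ?_
  refine StronglyMeasurable.integral_prod_right (f := fun (p : ℝ × ℝ) (s : ℝ) =>
    (|s| ^ (3 / 2 : ℝ))⁻¹ • (F (p + s • ((0, 1) : ℝ × ℝ)) - F p)) ?_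
  refine Measurable.stronglyMeasurable ?_
  have := hF.measurable
  simp only [Function.uncurry_def]
  fun_prop

end TimeDuality

end CaloricCapacity

namespace CaloricCapacity

/-! ### An admissible distribution for the Lipschitz caloric capacity. -/

section Lower

theorem volume_parabolicCube_pos (a : ℝ × ℝ) {ℓ : ℝ} (hℓ : 0 < ℓ) :
    0 < volume (parabolicCube a ℓ) := by
  rw [parabolicCube, Measure.volume_eq_prod, Measure.prod_prod, Real.volume_Icc, Real.volume_Icc]
  simp only [add_sub_cancel_left]
  exact ENNReal.mul_pos (ENNReal.ofReal_pos.2 hℓ).ne' (ENNReal.ofReal_pos.2 (by positivity)).ne'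

/-- The mean over any cube is also at most `1/2` in modulus, so the oscillation is at most one
pointwise. -/
theorem parabolicBMONorm_le_one {g : ℝ × ℝ → ℝ} (hg : ∀ p, ‖g p‖ ≤ 1 / 2) :
    parabolicBMONorm g ≤ 1 := by
  refine iSup_le fun a => iSup_le fun ℓ => iSup_le fun hℓ => ?_
  have h0 := (volume_parabolicCube_pos a hℓ).ne'
  have h1 : volume (parabolicCube a ℓ) ≠ ⊤ := (isCompact_Icc.prod isCompact_Icc).measure_ne_top
  have hv : 0 < volume.real (parabolicCube a ℓ) := ENNReal.toReal_pos h0 h1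
  have havg : ‖⨍ q in parabolicCube a ℓ, g q‖ ≤ 1 / 2 := by
    rw [setAverage_eq, norm_smul, norm_inv, Real.norm_of_nonneg measureReal_nonneg,
      inv_mul_le_iff₀ hv, mul_comm]
    exact norm_setIntegral_le_of_norm_le_const h1.lt_top fun q _ => hg q
  have hle : ∀ p, ‖g p - ⨍ q in parabolicCube a ℓ, g q‖ₑ ≤ 1 := fun p => by
    rw [← ofReal_norm, ENNReal.ofReal_le_one]
    linarith [_root_.norm_sub_le (g p) (⨍ q in parabolicCube a ℓ, g q), hg p]
  calc _ ≤ (volume (parabolicCube a ℓ))⁻¹ * ∫⁻ _ in parabolicCube a ℓ, 1 := by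
        gcongr with p
        exact hle p
    _ = 1 := by rw [setLIntegral_one, ENNReal.inv_mul_cancel h0 h1]

theorem locallyIntegrable_of_bounded {g : ℝ × ℝ → ℝ} {C : ℝ} (hm : Measurable g)
    (hg : ∀ p, ‖g p‖ ≤ C) : LocallyIntegrable g :=
  (locallyIntegrable_const C).mono hm.aestronglyMeasurable
    (.of_forall fun p => (hg p).trans (le_abs_self C))

/-- The distribution with density `c f` on the vertical segment. -/
noncomputable def segmentDistribution (c : ℝ) (f : ℝ → ℝ) : 𝓓'((⊤ : Opens (ℝ × ℝ)), ℝ) :=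
  let Λ : 𝓓((⊤ : Opens (ℝ × ℝ)), ℝ) →L[ℝ] ℝ :=
    TestFunction.integralAgainstBilinCLM (ContinuousLinearMap.mul ℝ ℝ)
      (Measure.map (fun t : ℝ => ((0 : ℝ), t)) (volume.restrict (Icc 0 1))) (fun p => c * f p.2)
  { toFun := Λ
    map_add' := map_add Λ
    map_smul' := map_smul Λ
    cont := Λ.continuous }

variable {f : ℝ → ℝ} {c : ℝ}

theorem segmentDistribution_apply (hf : Continuous f) (hs : ∀ t ∉ Icc (0 : ℝ) 1, f t = 0)
    (φ : 𝓓((⊤ : Opens (ℝ × ℝ)), ℝ)) :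
    segmentDistribution c f φ = c * ∫ t, f t * φ (0, t) := by
  have hm : Measurable fun t : ℝ => ((0 : ℝ), t) := by fun_prop
  have hcont : Continuous fun p : ℝ × ℝ => c * f p.2 := by fun_prop
  have : IsFiniteMeasure (Measure.map (fun t : ℝ => ((0 : ℝ), t)) (volume.restrict (Icc 0 1))) :=
    Measure.isFiniteMeasure_map _ _
  have hloc := (hcont.locallyIntegrable (μ := Measure.map (fun t : ℝ => ((0 : ℝ), t))
    (volume.restrict (Icc 0 1)))).locallyIntegrableOn ((⊤ : Opens (ℝ × ℝ)) : Set (ℝ × ℝ))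
  have hφ := φ.contDiff.continuous
  change TestFunction.integralAgainstBilinCLM _ _ _ φ = _
  rw [TestFunction.integralAgainstBilinCLM_eq_integral hloc]
  simp only [ContinuousLinearMap.mul_apply']
  rw [integral_map hm.aemeasurable (by fun_prop : Continuous fun p : ℝ × ℝ =>
    φ p * (c * f p.2)).aestronglyMeasurable, ← integral_const_mul,
    setIntegral_eq_integral_of_forall_compl_eq_zero fun t ht => by rw [hs t ht]; ring]
  congr 1
  ext t
  ring

theorem dsupport_segmentDistribution (hf : Continuous f) (hs : ∀ t ∉ Icc (0 : ℝ) 1, f t = 0) :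
    dsupport (segmentDistribution c f) ⊆ verticalSegment := by
  intro p hp
  refine (mem_dsupport_iff p).1 hp _ (fun φ hφ => ?_) isCompact_verticalSegment.isClosed
  have : ∀ t, f t * φ (0, t) = 0 := fun t => by
    by_cases ht : t ∈ Icc (0 : ℝ) 1
    · have hmem : ((0 : ℝ), t) ∈ verticalSegment := ⟨rfl, ht⟩
      rw [image_eq_zero_of_notMem_tsupport fun h => hφ h hmem, mul_zero]
    · rw [hs t ht, zero_mul]
  rw [segmentDistribution_apply hf hs]
  simp only [this, integral_zero, mul_zero]

theorem pairing_segmentDistribution (hf : Continuous f) (hs : ∀ t ∉ Icc (0 : ℝ) 1, f t = 0)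
    {u : ℝ × ℝ → ℝ} (hu : ContDiff ℝ ∞ u) :
    pairing (segmentDistribution c f) u = c * ∫ t, f t * u (0, t) := by
  rw [pairing_eq_localize (dsupport_segmentDistribution hf hs) hu, segmentDistribution_apply hf hs]
  congr 2
  ext t
  by_cases ht : t ∈ Icc (0 : ℝ) 1
  · change f t * (planeBump (0, t) * u (0, t)) = _
    rw [planeBump.one_of_mem_closedBall, one_mul]
    exact Metric.ball_subset_closedBall (verticalSegment_subset_ball ⟨rfl, ht⟩)
  · rw [hs t ht, zero_mul, zero_mul]

theorem spaceDeriv_eq_fderiv {φ : ℝ × ℝ → ℝ} (hφ : Differentiable ℝ φ) (p : ℝ × ℝ) :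
    spaceDeriv φ p = fderiv ℝ φ p (1, 0) := by
  have h : HasDerivAt (fun x : ℝ => (x, p.2)) ((1 : ℝ), (0 : ℝ)) p.1 :=
    (hasDerivAt_id p.1).prodMk (hasDerivAt_const p.1 p.2)
  exact ((hφ p).hasFDerivAt.comp_hasDerivAt p.1 h).deriv

theorem _root_.HasCompactSupport.exists_timeSupp {Φ : ℝ × ℝ → ℝ} (hΦ : HasCompactSupport Φ) :
    ∃ r, 0 ≤ r ∧ TimeSupp (-r) r Φ := by
  obtain ⟨r, hr0, hr⟩ := hΦ.isCompact.isBounded.subset_closedBall_lt 0 0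
  refine ⟨r, hr0.le, fun p hp => ?_⟩
  by_contra h
  have h1 := hr (subset_tsupport _ h)
  rw [mem_closedBall_zero_iff] at h1
  exact hp (abs_le.1 ((norm_snd_le p).trans h1))

/-- The potential is bounded and Lipschitz, so its `x`-derivative and its half derivative in time
are bounded functions. Duality identifies them, up to the factor `c`, with the two distributions to
be controlled. -/
theorem exists_lipschitzAdmissible (hf : ContDiff ℝ ∞ f) (hs : ∀ t ∉ Icc (0 : ℝ) 1, f t = 0)
    (h1 : ∀ t, |f t| ≤ 1) :
    ∃ c > 0, LipschitzAdmissible verticalSegment (segmentDistribution c f) := by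
  have hfc : HasCompactSupport f := HasCompactSupport.intro isCompact_Icc hs
  have hfi := hf.continuous.integrable_of_hasCompactSupport hfc (μ := volume)
  obtain ⟨L, hL⟩ := ContDiff.lipschitzWith_of_hasCompactSupport hfc hf (by simp)
  obtain ⟨K, hK⟩ := exists_lipschitzWith_segmentPotential hL hs h1
  have hA := abs_segmentPotential_le hs h1
  set B := (2 * 2 + K) * ∫ s, halfWeight s with hB
  have hB0 : 0 ≤ B := mul_nonneg (by positivity) (integral_nonneg halfWeight_nonneg)
  -- This brings both the Lipschitz constant `K` and the half derivative bound `B` below `1/2`.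
  set c : ℝ := (2 * (K + B + 1))⁻¹ with hc
  have hc0 : 0 < c := by positivity
  have hcc : c * (K + B + 1) = 1 / 2 := by
    rw [hc]
    field_simp
  have hsup := dsupport_segmentDistribution (c := c) hf.continuous hs
  have hg1 : ∀ p, ‖c * lineDeriv ℝ (segmentPotential f) p (1, 0)‖ ≤ 1 / 2 := fun p => by
    have h := norm_lineDeriv_le_of_lipschitz ℝ hK (x₀ := p) (v := (1, 0))
    have hv : ‖((1, 0) : ℝ × ℝ)‖ = 1 := by simp [Prod.norm_def]
    rw [hv, mul_one] at h
    rw [norm_mul, Real.norm_of_nonneg hc0.le, ← hcc]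
    exact mul_le_mul_of_nonneg_left (by linarith) hc0.le
  have hg2 : ∀ p, ‖c * halfDeriv ((0, 1) : ℝ × ℝ) (segmentPotential f) p‖ ≤ 1 / 2 := fun p => by
    have h := abs_halfDeriv_le hK hA p
    rw [norm_mul, Real.norm_of_nonneg hc0.le, Real.norm_eq_abs, ← hcc]
    exact mul_le_mul_of_nonneg_left (by linarith [K.2]) hc0.le
  refine ⟨c, hc0, hsup, ⟨fun p => c * lineDeriv ℝ (segmentPotential f) p (1, 0), ?_, ?_⟩,
    ⟨fun p => c * halfDeriv ((0, 1) : ℝ × ℝ) (segmentPotential f) p, ?_, ?_⟩⟩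
  · refine ⟨locallyIntegrable_of_bounded (measurable_const.mul (measurable_lineDeriv hK.continuous))
      hg1, fun φ => ?_⟩
    have hφ : ContDiff ℝ ∞ φ := φ.contDiff
    have hφc := φ.hasCompactSupport
    obtain ⟨D, hD⟩ := ContDiff.lipschitzWith_of_hasCompactSupport hφc hφ (by simp)
    let G : ℝ × ℝ → ℝ := fun p => fderiv ℝ φ p (-(1, 0))
    have hG : ContDiff ℝ ∞ G := (hφ.fderiv_right (m := ∞) (by simp)).clm_apply contDiff_const
    have hGc : HasCompactSupport G := hφc.fderiv_apply ℝ _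
    obtain ⟨M, hM⟩ := hGc.exists_derivBound hG
    obtain ⟨r, hr0, hr⟩ := hGc.exists_timeSupp
    have hr' : -r ≤ r := by linarith
    have e : (fun p => -spaceDeriv φ p) = G := by
      ext p
      rw [spaceDeriv_eq_fderiv (hφ.differentiable (by simp)), ← map_neg]
    rw [spaceDerivPotential, e, pairing_segmentDistribution hf.continuous hs
      (hM.heatTranspose hr' hr).contDiff, integral_mul_heatTranspose hfi hr' hG.continuous hr hM.norm_le]
    simp only [mul_assoc]
    -- Integration by parts for a Lipschitz function, whose line derivative exists almost
    -- everywhere.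
    rw [integral_const_mul, hK.integral_lineDeriv_mul_eq hD hφc]
    congr 2
    ext p
    rw [(hφ.differentiable (by simp) p).lineDeriv_eq_fderiv, mul_comm]
  · refine eLpNormEssSup_le_of_ae_bound (C := 1) ?_ |>.trans (by simp)
    exact .of_forall fun p => (hg1 p).trans (by linarith)
  · refine ⟨locallyIntegrable_of_bounded (measurable_const.mul (measurable_halfDeriv hK.continuous))
      hg2, fun φ => ?_⟩
    have hφ : ContDiff ℝ ∞ φ := φ.contDiff
    have hφc := φ.hasCompactSupport
    obtain ⟨M, hM⟩ := hφc.exists_derivBound hφ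
    obtain ⟨r, hr0, hr⟩ := hφc.exists_timeSupp
    have hr' : -r ≤ r := by linarith
    have he : ‖((0, 1) : ℝ × ℝ)‖ ≤ 1 := by simp [Prod.norm_def]
    rw [halfTimeDerivPotential, halfTimeDeriv_eq, hM.heatTranspose_halfDeriv hr' hr,
      pairing_segmentDistribution hf.continuous hs ((hM.heatTranspose hr' hr).halfDeriv he).contDiff,
      hM.integral_mul_halfDeriv_heatTranspose hr' hr hφc hf.continuous hfc hK hA]
    simp only [mul_assoc]
    rw [integral_const_mul]
  · exact parabolicBMONorm_le_one hg2

end Lower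

end CaloricCapacity

/-! ### Conclusion: positivity from a bump on the segment, and non-comparability. -/

theorem theorem2p5p5 :
    CaloricCapacity.halfLaplacianCaloricCapacity CaloricCapacity.verticalSegment = 0 ∧
    0 < CaloricCapacity.lipschitzCaloricCapacity CaloricCapacity.verticalSegment ∧
    ¬ CaloricCapacity.Comparable CaloricCapacity.lipschitzCaloricCapacity
        CaloricCapacity.halfLaplacianCaloricCapacity := by
  open CaloricCapacity in
  have hpos : 0 < lipschitzCaloricCapacity verticalSegment := by
    let f : ContDiffBump (1 / 2 : ℝ) := ⟨1 / 4, 1 / 2, by norm_num, by norm_num⟩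
    have hf : ContDiff ℝ ∞ f := f.contDiff
    have hs : ∀ t ∉ Icc (0 : ℝ) 1, f t = 0 := fun t ht => f.zero_of_le_dist (by
      by_contra h
      have h' : dist t (1 / 2) < 1 / 2 := not_le.1 h
      rw [Real.dist_eq, abs_lt] at h'
      exact ht ⟨by linarith [h'.1], by linarith [h'.2]⟩)
    obtain ⟨c, hc, hadm⟩ := exists_lipschitzAdmissible hf hs fun t => by
      rw [abs_of_nonneg f.nonneg]
      exact f.le_one
    have hT : pairing (segmentDistribution c f) (fun _ => 1) ≠ 0 := by
      rw [pairing_segmentDistribution hf.continuous hs contDiff_const]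
      simp only [mul_one]
      exact (mul_pos hc f.integral_pos).ne'
    refine (enorm_pos.2 hT).trans_le ?_
    exact le_iSup₂_of_le (segmentDistribution c f) hadm le_rfl
  refine ⟨CaloricCapacity.halfLaplacianCaloricCapacity_verticalSegment, hpos, ?_⟩
  rintro ⟨C, hC⟩
  -- A finite multiple of zero is zero, so a comparison on the segment alone contradicts positivity.
  have := (hC _ CaloricCapacity.isCompact_verticalSegment).1
  rw [CaloricCapacity.halfLaplacianCaloricCapacity_verticalSegment, mul_zero] at this
  exact hpos.not_ge this
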